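/- **Setting.** Let $I=(0,1]$; "for $\varepsilon$ small" means for all $\varepsilon\in(0,\varepsilon_0]$, some $\varepsilon_0\in I$. Let $\rho=(\rho_\varepsilon)\in(0,1]^I$ with $\rho_\varepsilon\to0$ as $\varepsilon\to0^+$. A net $(x_\varepsilon)$ is moderate if $|x_\varepsilon|\le\rho_\varepsilon^{-N}$ for $\varepsilon$ small, for some $N\in\mathbb N$, and negligible if for every $m\in\mathbb N$, $|x_\varepsilon|\le\rho_\varepsilon^{m}$ for $\varepsilon$ small. Let $\widetilde{\mathbb R}$, $\widetilde{\mathbb C}$ be the rings of moderate real, complex nets modulo negligible ones, with classes $[x_\varepsilon]$; put $|[x_\varepsilon]|=[|x_\varepsilon|]$ and $d\rho^{s}=[\rho_\varepsilon^{s}]$ for $s\in\mathbb R$. Write $x\le y$ if $x_\varepsilon\le y_\varepsilon$ for $\varepsilon$ small for suitable representatives, and $x<y$ if $x\le y$ and $x-y$ is invertible. A number $x\in\widetilde{\mathbb R}$ is infinite if $|x|\ge r$ for all real $r>0$, and large infinite if $|x|\ge d\rho^{-s}$ for some real $s>0$. The sharp topology on $\widetilde{\mathbb R}^n$ is generated by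 the balls $\{x:|x-c|<r\}$ with $r\in\widetilde{\mathbb R}$, $r>0$. A function $f:X\subseteq\widetilde{\mathbb R}^n\to\widetilde{\mathbb C}$ is generalized smooth if there are smooth $f_\varepsilon:\Omega_\varepsilon\to\mathbb C$, $\Omega_\varepsilon\subseteq\mathbb R^n$ open, such that for every $[x_\varepsilon]\in X$ and each of its representatives, $x_\varepsilon\in\Omega_\varepsilon$ for $\varepsilon$ small, all nets $(\partial^\alpha f_\varepsilon(x_\varepsilon))$ are moderate, and $f([x_\varepsilon])=[f_\varepsilon(x_\varepsilon)]$. If $X=\widetilde{\mathbb R}^n$, $\operatorname{supp} f$ is the closure of $\{x:|f(x)|>0\}$ in the sharp topology. Let $n\ge1$, and let $b=[b_\varepsilon]\in\widetilde{\mathbb R}$, with all $b_\varepsilon>0$, be a large infinite number. Let $(\psi_\varepsilon)_{\varepsilon\in I}$ be even real-valued functions in $\mathcal D(\mathbb R^n)$, supported in the open unit ball, with $\int\psi_\varepsilon=1$ and $\psi_\varepsilon(0)=2n/\sigma_n$ ($\sigma_n$ the surface area of $S^{n-1}$), such that: for each $\alpha$ there is $p\in\mathbb N$ with $\sup|\partial^\alpha\psi_\varepsilon|=O(b_\varepsilon^p)$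 as $\varepsilon\to0^+$; for each $j\in\mathbb N$, for $\varepsilon$ small, $\int x^\alpha\psi_\varepsilon(x)\,dx=0$ whenever $1\le|\alpha|\le j$; for each real $\eta>0$, $\int|\psi_\varepsilon|\le1+\eta$ for $\varepsilon$ small. Put $\psi^b_\varepsilon(x)=b_\varepsilon^n\psi_\varepsilon(b_\varepsilon x)$. For $T\in\mathcal S'(\mathbb R^n)$ and $x=[x_\varepsilon]\in\widetilde{\mathbb R}^n$ let $\iota^b(T)(x)=[(T*\psi^b_\varepsilon)(x_\varepsilon)]$, and let $\hat T$ be the classical Fourier transform, $\langle\hat T,\varphi\rangle=\langle T,\hat\varphi\rangle$, $\hat\varphi(\omega)=\int\varphi(x)e^{-ix\cdot\omega}\,dx$. Let $k=[k_\varepsilon]\in\widetilde{\mathbb R}$, $k>0$, be infinite and $K=[-k,k]^n\subseteq\widetilde{\mathbb R}^n$. For $f$ generalized smooth on $K$, defined by $(f_\varepsilon)$, the hyperfinite Fourier transform is $$\mathcal F_k(f)(\omega)=\int_K f(x)e^{-ix\cdot\omega}\,dx=\Big[\int_{[-k_\varepsilon,k_\varepsilon]^n}f_\varepsilon(x)e^{-ix\cdot\omega_\varepsilon}\,dx\Big],\qquad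 \omega=[\omega_\varepsilon]\in\widetilde{\mathbb R}^n.$$ If $f$ is generalized smooth on $\widetilde{\mathbb R}^n$ and $\operatorname{supp}f\subseteq[-h,h]^n$ for some infinite $h>0$, one writes $\mathcal F(f):=\mathcal F_h(f)$ for any such $h$. Let $\mathbb 1:=\mathcal F(\delta)$ with $\delta=\iota^b(\delta_0)$, $\delta_0$ the Dirac delta at $0$. A generalized smooth $f:\widetilde{\mathbb R}^n\to\widetilde{\mathbb C}$ is bounded by a tame polynomial at $x$ if there are a real $r>0$ and $M,c\in\widetilde{\mathbb R}$, $c$ invertible, such that $b/c$ is a large infinite number and $|d^jf(y)|\le Mc^j$ for all $j\in\mathbb N$ and all $y$ with $|y-x|\le r$. **Theorem.** Let $T\in\mathcal S'(\mathbb R^n)$ and suppose that $\operatorname{supp}(\iota^b(T)\cdot\mathbb 1)\subseteq K$. Let $\omega\in\widetilde{\mathbb R}^n$ be such that $\mathcal F_k(\iota^b(T))$ is bounded by a tame polynomial at $\omega$. Then $$\mathcal F_k(\iota^b(T))(\omega)=\mathcal F(\iota^b(T)\cdot\mathbb 1)(\omega).$$ If moreover $|\omega|\le d\rho^{s}\,b$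 for some real $s>0$ (in particular, if $\omega$ is finite, i.e. $|\omega|\le r$ for some real $r$), then also $$\mathcal F(\iota^b(T)\cdot\mathbb 1)(\omega)=\iota^b(\hat T)(\omega).$$ -/

import Mathlib

open Filter Topology MeasureTheory
open scoped ContDiff SchwartzMap FourierTransform

noncomputable section

namespace HFT

/-- The index set `I = (0,1]`. A property holds "for `ε` small" when there is `ε₀ ∈ I` such that it
holds for all `ε ∈ (0,ε₀]`; this is `∀ᶠ ε in (atBot : Filter I)`. -/
abbrev I : Type := Set.Ioc (0 : ℝ) 1

/-- The ordinary Euclidean space `ℝⁿ`. -/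
abbrev E (n : ℕ) : Type := EuclideanSpace ℝ (Fin n)

/-- A gauge: a net in `(0,1]` that tends to `0` as `ε → 0⁺`. -/
structure Gauge where
  toFun : I → ℝ
  pos : ∀ ε, 0 < toFun ε
  le_one : ∀ ε, toFun ε ≤ 1
  tendsto : Tendsto toFun atBot (𝓝 0)

instance : CoeFun Gauge (fun _ => I → ℝ) := ⟨Gauge.toFun⟩

/-! ### Generalized numbers -/

section Numbers

variable (ρ : Gauge)

/-- `ρ`-moderate nets. -/
def Moderate {V : Type*} [NormedAddCommGroup V] (x : I → V) : Prop :=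
  ∃ N : ℕ, ∀ᶠ ε in atBot, ‖x ε‖ ≤ (ρ ε ^ N)⁻¹

/-- `ρ`-negligible nets. -/
def Negligible {V : Type*} [NormedAddCommGroup V] (x : I → V) : Prop :=
  ∀ m : ℕ, ∀ᶠ ε in atBot, ‖x ε‖ ≤ ρ ε ^ m

lemma eventually_le (c : ℝ) (hc : 0 < c) : ∀ᶠ ε in atBot, ρ ε ≤ c :=
  ρ.tendsto.eventually (Iic_mem_nhds hc)

lemma inv_pow_mono {N M : ℕ} (h : N ≤ M) (ε : I) : (ρ ε ^ N)⁻¹ ≤ (ρ ε ^ M)⁻¹ :=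
  inv_anti₀ (pow_pos (ρ.pos ε) M) (pow_le_pow_of_le_one (ρ.pos ε).le (ρ.le_one ε) h)

lemma Moderate.add {V : Type*} [NormedAddCommGroup V] {x y : I → V}
    (hx : Moderate ρ x) (hy : Moderate ρ y) : Moderate ρ (x + y) := by
  obtain ⟨N, hN⟩ := hx
  obtain ⟨M, hM⟩ := hy
  refine ⟨N + M + 1, ?_⟩
  filter_upwards [hN, hM, eventually_le ρ (1 / 2) (by norm_num)] with ε h1 h2 h3
  have a1 := inv_pow_mono ρ (Nat.le_add_right N M) ε
  have a2 := inv_pow_mono ρ (Nat.le_add_left M N) ε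
  have p : 0 < (ρ ε ^ (N + M))⁻¹ := inv_pos.2 (pow_pos (ρ.pos ε) _)
  have q : (2 : ℝ) ≤ (ρ ε)⁻¹ := by
    rw [le_inv_comm₀ (by norm_num) (ρ.pos ε)]
    linarith
  have e : (ρ ε ^ (N + M + 1))⁻¹ = (ρ ε ^ (N + M))⁻¹ * (ρ ε)⁻¹ := by rw [pow_succ, mul_inv]
  have n := norm_add_le (x ε) (y ε)
  rw [e, Pi.add_apply]
  nlinarith

lemma Negligible.add {V : Type*} [NormedAddCommGroup V] {x y : I → V}
    (hx : Negligible ρ x) (hy : Negligible ρ y) : Negligible ρ (x + y) := by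
  intro m
  filter_upwards [hx (m + 1), hy (m + 1), eventually_le ρ (1 / 2) (by norm_num)] with ε h1 h2 h3
  have p : 0 < ρ ε ^ m := pow_pos (ρ.pos ε) _
  have n := norm_add_le (x ε) (y ε)
  rw [pow_succ] at h1 h2
  rw [Pi.add_apply]
  nlinarith

variable (R : Type) [NormedField R]

/-- The ring of `ρ`-moderate nets in `R` (for us `R = ℝ` or `R = ℂ`). -/
def moderateNets : Subring (I → R) where
  carrier := {x | Moderate ρ x}
  mul_mem' := by
    rintro x y ⟨N, hN⟩ ⟨M, hM⟩
    refine ⟨N + M, ?_⟩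
    filter_upwards [hN, hM] with ε h1 h2
    rw [Pi.mul_apply, norm_mul, pow_add, mul_inv]
    have := ρ.pos ε
    gcongr
  one_mem' := ⟨0, by simp⟩
  add_mem' := fun hx hy => hx.add ρ hy
  zero_mem' := ⟨0, by simp⟩
  neg_mem' := by
    rintro x ⟨N, hN⟩
    exact ⟨N, by simpa using hN⟩

/-- The ideal of `ρ`-negligible nets. -/
def negligibleNets : Ideal (moderateNets ρ R) where
  carrier := {x | Negligible ρ (x : I → R)}
  add_mem' := fun hx hy => hx.add ρ hy
  zero_mem' := by
    intro m
    exact Eventually.of_forall fun ε => by simpa using (pow_pos (ρ.pos ε) m).le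
  smul_mem' := by
    rintro ⟨x, N, hN⟩ ⟨y, _⟩ hy m
    filter_upwards [hN, hy (m + N)] with ε h1 h2
    have p : 0 < ρ ε ^ N := pow_pos (ρ.pos ε) _
    calc ‖x ε * y ε‖ = ‖x ε‖ * ‖y ε‖ := norm_mul _ _
      _ ≤ (ρ ε ^ N)⁻¹ * ρ ε ^ (m + N) := by gcongr
      _ = ρ ε ^ m := by rw [pow_add]; field_simp

/-- The Robinson–Colombeau ring of generalized numbers: moderate nets modulo negligible nets.
`GenNum ρ ℝ` is the ring of real generalized numbers and `GenNum ρ ℂ` is its complexification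
(a complex net is moderate or negligible iff its real and imaginary parts are). -/
def GenNum : Type := moderateNets ρ R ⧸ negligibleNets ρ R

instance : CommRing (GenNum ρ R) :=
  inferInstanceAs (CommRing (moderateNets ρ R ⧸ negligibleNets ρ R))

end Numbers

section Basics

variable {ρ : Gauge} {R : Type} [NormedField R] {n : ℕ}

open Classical in
/-- The class `[x_ε]` of a moderate net (and `0` for a net that is not moderate). -/
def cls (ρ : Gauge) (x : I → R) : GenNum ρ R :=
  if h : Moderate ρ x then Ideal.Quotient.mk (negligibleNets ρ R) ⟨x, h⟩ else 0

/-- The net `(x_ε)` is a representative of `x`: it is moderate and `[x_ε] = x`. -/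
def IsRep (xs : I → R) (x : GenNum ρ R) : Prop := Moderate ρ xs ∧ cls ρ xs = x

lemma exists_isRep (x : GenNum ρ R) : ∃ xs : I → R, IsRep xs x := by
  obtain ⟨⟨xs, h⟩, rfl⟩ := Ideal.Quotient.mk_surjective (I := negligibleNets ρ R) x
  exact ⟨xs, h, dif_pos h⟩

/-- A representative of a generalized number. -/
def rep (x : GenNum ρ R) : I → R := (exists_isRep x).choose

/-- A net of points of `ℝⁿ` represents a generalized point of `(GenNum ρ ℝ)ⁿ` if it does so in each
coordinate. -/
def IsRepPt (xs : I → E n) (x : Fin n → GenNum ρ ℝ) : Prop :=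
  ∀ i, IsRep (fun ε => xs ε i) (x i)

/-- A representative of a generalized point. -/
def repPt (x : Fin n → GenNum ρ ℝ) : I → E n := fun ε => WithLp.toLp 2 fun i => rep (x i) ε

/-- `x ≤ y` iff `x_ε ≤ y_ε` for `ε` small, for some representatives. -/
instance : LE (GenNum ρ ℝ) :=
  ⟨fun x y => ∃ xs ys : I → ℝ, IsRep xs x ∧ IsRep ys y ∧ ∀ᶠ ε in atBot, xs ε ≤ ys ε⟩

/-- `x < y` iff `x ≤ y` and `x - y` is invertible. -/
instance : LT (GenNum ρ ℝ) := ⟨fun x y => x ≤ y ∧ IsUnit (x - y)⟩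

/-- The absolute value `|[x_ε]| = [|x_ε|]`. -/
def gabs (x : GenNum ρ R) : GenNum ρ ℝ := cls ρ fun ε => ‖rep x ε‖

/-- The generalized Euclidean norm `|[x_ε]| = [|x_ε|]` on `(GenNum ρ ℝ)ⁿ`. -/
def gnorm (x : Fin n → GenNum ρ ℝ) : GenNum ρ ℝ := cls ρ fun ε => ‖repPt x ε‖

/-- The embedding of the reals into the generalized numbers. -/
def const (ρ : Gauge) (r : ℝ) : GenNum ρ ℝ := cls ρ fun _ => r

/-- The generalized number `dρ^s = [ρ_ε^s]`, where `s ∈ ℝ`. -/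
def dRho (ρ : Gauge) (s : ℝ) : GenNum ρ ℝ := cls ρ fun ε => ρ ε ^ s

/-- Infinite generalized numbers. -/
def IsInfinite (x : GenNum ρ ℝ) : Prop := ∀ r : ℝ, 0 < r → const ρ r ≤ gabs x

/-- Large (strong) infinite generalized numbers: `|x| ≥ dρ^(-s)` for some real `s > 0`. -/
def IsLargeInfinite (x : GenNum ρ ℝ) : Prop := ∃ s : ℝ, 0 < s ∧ dRho ρ (-s) ≤ gabs x

/-- The box `[-k,k]ⁿ` of generalized points. -/
def cube (n : ℕ) (k : GenNum ρ ℝ) : Set (Fin n → GenNum ρ ℝ) := {x | ∀ i, -k ≤ x i ∧ x i ≤ k}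

/-! ### Generalized smooth functions -/

/-- The strongly internal set `⟨Ω_ε⟩`: all points each of whose representatives lies in `Ω_ε` for
`ε` small. -/
def stronglyInternal (ρ : Gauge) (Ω : I → Set (E n)) : Set (Fin n → GenNum ρ ℝ) :=
  {x | ∀ xs : I → E n, IsRepPt xs x → ∀ᶠ ε in atBot, xs ε ∈ Ω ε}

/-- The net of smooth functions `u_ε : Ω_ε → ℂ` defines the generalized smooth function
`f : X → GenNum ρ ℂ`. (Moderateness of all partial derivatives of order `j` is the same as
moderateness of the `j`-th differential.) -/
structure Defines (X : Set (Fin n → GenNum ρ ℝ)) (Ω : I → Set (E n)) (u : I → E n → ℂ)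
    (f : (Fin n → GenNum ρ ℝ) → GenNum ρ ℂ) : Prop where
  isOpen : ∀ ε, IsOpen (Ω ε)
  smooth : ∀ ε, ContDiffOn ℝ ∞ (u ε) (Ω ε)
  subset : X ⊆ stronglyInternal ρ Ω
  moderate : ∀ x ∈ X, ∀ xs : I → E n, IsRepPt xs x →
    ∀ j : ℕ, Moderate ρ fun ε => iteratedFDeriv ℝ j (u ε) (xs ε)
  value : ∀ x ∈ X, ∀ xs : I → E n, IsRepPt xs x → IsRep (fun ε => u ε (xs ε)) (f x)

/-- `f` is a generalized smooth function on `X` with values in `GenNum ρ ℂ`. -/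
def IsGSF (X : Set (Fin n → GenNum ρ ℝ)) (f : (Fin n → GenNum ρ ℝ) → GenNum ρ ℂ) : Prop :=
  ∃ u : I → E n → ℂ, ∃ Ω : I → Set (E n), Defines X Ω u f

open Classical in
/-- A net of smooth functions defining `f` on `X` (and `0` if `f` is not generalized smooth). -/
def netOf (X : Set (Fin n → GenNum ρ ℝ)) (f : (Fin n → GenNum ρ ℝ) → GenNum ρ ℂ) :
    I → E n → ℂ :=
  if h : IsGSF X f then h.choose else 0

/-- The support of `f` on the whole of `(GenNum ρ ℝ)ⁿ`: the closure, in the sharp topology, of the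
set of the points `y` with `|f y| > 0`. -/
def gsupp (f : (Fin n → GenNum ρ ℝ) → GenNum ρ ℂ) : Set (Fin n → GenNum ρ ℝ) :=
  {x | ∀ r : GenNum ρ ℝ, 0 < r → ∃ y, 0 < gabs (f y) ∧ gnorm (x - y) < r}

/-- `f` is bounded by a tame polynomial at `x` (relative to the infinite number `b`): in a ball
around `x` of real radius all differentials satisfy `|d^j f(y)| ≤ M c^j`, where `b/c` is a large
infinite number. Here `d^j f(y) = [d^j u_ε(y_ε)]` for any net `(u_ε)` defining `f`. -/
def BoundedByTame (b : GenNum ρ ℝ) (f : (Fin n → GenNum ρ ℝ) → GenNum ρ ℂ)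
    (x : Fin n → GenNum ρ ℝ) : Prop :=
  ∃ u : I → E n → ℂ, ∃ Ω : I → Set (E n), Defines Set.univ Ω u f ∧
    ∃ r : ℝ, 0 < r ∧ ∃ M : GenNum ρ ℝ, ∃ c : (GenNum ρ ℝ)ˣ,
      IsLargeInfinite (b * (↑c⁻¹ : GenNum ρ ℝ)) ∧
      ∀ y, gnorm (y - x) ≤ const ρ r → ∀ ys : I → E n, IsRepPt ys y →
        ∀ j : ℕ, cls ρ (fun ε => ‖iteratedFDeriv ℝ j (u ε) (ys ε)‖) ≤ M * (c : GenNum ρ ℝ) ^ j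

/-! ### The hyperfinite Fourier transform -/

/-- The hyperfinite Fourier transform on `K = [-k,k]ⁿ` of a generalized smooth function on `K`:
`𝓕_k(f)(w) = ∫_K f(x) e^{-i x·w} dx = [∫_{[-k_ε,k_ε]ⁿ} f_ε(x) e^{-i x·w_ε} dx]`. -/
def hftOn (k : GenNum ρ ℝ) (f : (Fin n → GenNum ρ ℝ) → GenNum ρ ℂ)
    (w : Fin n → GenNum ρ ℝ) : GenNum ρ ℂ :=
  cls ρ fun ε => ∫ x in {x : E n | ∀ i, |x i| ≤ rep k ε},
    netOf (cube n k) f ε x * Complex.exp (-Complex.I * (inner ℝ x (repPt w ε) : ℝ))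

open Classical in
/-- The hyperfinite Fourier transform `𝓕(f) := 𝓕_h(f)` of a compactly supported `f`, where `h` is
any positive infinite number with `supp f ⊆ [-h,h]ⁿ` (and `0` if there is none). -/
def hft (f : (Fin n → GenNum ρ ℝ) → GenNum ρ ℂ) (w : Fin n → GenNum ρ ℝ) : GenNum ρ ℂ :=
  if hf : ∃ h : GenNum ρ ℝ, 0 < h ∧ IsInfinite h ∧ gsupp f ⊆ cube n h then
    hftOn hf.choose f w
  else 0

end Basics

/-! ### Embedding of tempered distributions -/

/-- The nets `(ψ_ε)` of mollifiers used to embed distributions, relative to the net `(b_ε)`.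
The constant in `value_zero` is `2n / σ_n`, where `w_n` is the surface area of the unit sphere. -/
structure MollifierNet (n : ℕ) (b : I → ℝ) where
  ψ : I → E n → ℝ
  smooth : ∀ ε, ContDiff ℝ ∞ (ψ ε)
  supp : ∀ ε, tsupport (ψ ε) ⊆ Metric.ball 0 1
  even : ∀ ε x, ψ ε (-x) = ψ ε x
  value_zero : ∀ ε, ψ ε 0 = 2 * n / ((volume : Measure (E n)).toSphere.real Set.univ)
  integral_eq_one : ∀ ε, ∫ x, ψ ε x = 1
  deriv_bound : ∀ j : ℕ, ∃ p : ℕ, ∃ C : ℝ, ∀ᶠ ε in atBot, ∀ x,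
    ‖iteratedFDeriv ℝ j (ψ ε) x‖ ≤ C * b ε ^ p
  moments : ∀ j : ℕ, ∀ᶠ ε in atBot, ∀ α : Fin n → ℕ, 1 ≤ ∑ i, α i → ∑ i, α i ≤ j →
    ∫ x, (∏ i, x i ^ α i) * ψ ε x = 0
  abs_integral_le : ∀ η : ℝ, 0 < η → ∀ᶠ ε in atBot, ∫ x, |ψ ε x| ≤ 1 + η

open Classical in
/-- A compactly supported smooth function, viewed as a Schwartz function (and `0` otherwise). -/
def toSchwartz {n : ℕ} (f : E n → ℂ) : 𝓢(E n, ℂ) :=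
  if h : HasCompactSupport f ∧ ContDiff ℝ ∞ f then h.1.toSchwartzMap h.2 else 0

/-- The rescaled mollifier `ψ^b_ε(x) = b_ε^n ψ_ε(b_ε x)`. -/
def MollifierNet.scaled {n : ℕ} {b : I → ℝ} (m : MollifierNet n b) (ε : I) (x : E n) : ℝ :=
  b ε ^ n * m.ψ ε (b ε • x)

/-- The embedding `ι^b(T) = [(T * ψ^b_ε)(-)]` of tempered distributions, where
`(T * ψ^b_ε)(x) = ⟨T(y), ψ^b_ε(x - y)⟩`. -/
def embed (ρ : Gauge) {n : ℕ} {b : I → ℝ} (m : MollifierNet n b) (T : 𝓢'(E n, ℂ)) :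
    (Fin n → GenNum ρ ℝ) → GenNum ρ ℂ :=
  fun x => cls ρ fun ε => T (toSchwartz fun y => (m.scaled ε (repPt x ε - y) : ℂ))

/-- The dilation of `ℝⁿ` by `(2π)⁻¹`. -/
def dilation (n : ℕ) : E n ≃L[ℝ] E n :=
  ContinuousLinearEquiv.smulLeft (Units.mk0 ((2 * Real.pi)⁻¹ : ℝ) (by positivity))

/-- The classical Fourier transform `φ̂(w) = ∫ φ(x) e^{-i x·w} dx` on the Schwartz space, that is
Mathlib's transform (which has `e^{-2πi x·w}`) evaluated at `w / 2π`. -/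
def schwartzFT (n : ℕ) : 𝓢(E n, ℂ) →L[ℂ] 𝓢(E n, ℂ) :=
  (SchwartzMap.compCLMOfContinuousLinearEquiv ℂ (dilation n)).comp
    (FourierTransform.fourierCLM ℂ 𝓢(E n, ℂ))

lemma schwartzFT_apply {n : ℕ} (φ : 𝓢(E n, ℂ)) (w : E n) :
    schwartzFT n φ w = ∫ x, φ x * Complex.exp (-Complex.I * (inner ℝ x w : ℝ)) := by
  have h : schwartzFT n φ w = 𝓕 (φ : E n → ℂ) (((2 * Real.pi)⁻¹ : ℝ) • w) := by
    rw [← SchwartzMap.fourier_coe]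
    rfl
  rw [h, Real.fourier_eq']
  refine integral_congr_ae (Eventually.of_forall fun x => ?_)
  have hp : (Real.pi : ℝ) ≠ 0 := Real.pi_ne_zero
  have e : -2 * Real.pi * ((2 * Real.pi)⁻¹ * inner ℝ x w) = -inner ℝ x w := by field_simp
  simp only [inner_smul_right, smul_eq_mul, e]
  rw [mul_comm]
  congr 2
  push_cast
  ring

/-- The classical Fourier transform of a tempered distribution: `⟨T̂, φ⟩ = ⟨T, φ̂⟩`. -/
def distribFT {n : ℕ} (T : 𝓢'(E n, ℂ)) : 𝓢'(E n, ℂ) :=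
  PointwiseConvergenceCLM.precomp ℂ (schwartzFT n) T

lemma distribFT_apply {n : ℕ} (T : 𝓢'(E n, ℂ)) (φ : 𝓢(E n, ℂ)) :
    distribFT T φ = T (schwartzFT n φ) := rfl

/-- `𝟙 := 𝓕(δ)`, the hyperfinite Fourier transform of the embedded Dirac delta. -/
def oneHat (ρ : Gauge) {n : ℕ} {b : I → ℝ} (m : MollifierNet n b) :
    (Fin n → GenNum ρ ℝ) → GenNum ρ ℂ :=
  hft (embed ρ m (TemperedDistribution.delta 0))

end HFT

end

open Filter Topology MeasureTheory
open scoped ContDiff SchwartzMap FourierTransform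

noncomputable section

namespace HFT

/-! ### Calculus of moderate and negligible nets -/

section Nets

variable {ρ : Gauge} {V W : Type*} [NormedAddCommGroup V] [NormedAddCommGroup W]

/-! Let P_ε be the scaled mollifier and F_ε = T * P_ε. Since F_ε(x) = ⟨T, P_ε(· - x)⟩ and T has
finite order, F_ε and its derivatives grow polynomially with moderate constants. Since δ * P_ε = P_ε
lives in a ball of radius 1/b_ε, inside every infinite box, 𝟙 is the class of the classical
transforms P̂_ε. Hence ι(T)·𝟙 is defined by F_ε P̂_ε, which decays rapidly with moderate constants.

Independence of the box. The transform of ι(T)·𝟙 uses an arbitrary box containing the support, and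
must equal the integral of F_ε P̂_ε e^{-ix·ω} over the whole space. This requires F_ε P̂_ε to be
small off the box, but the support only sees points where the value is invertible, that is, bounded
below for all small ε; a net that is large merely along a sequence of ε is invisible to it. The cure
(`PolyModerate.small_outside`) is to splice: use the bad point when there is one and elsewhere a
point where F_ε P̂_ε stays above a fixed constant. Such points exist when T ≠ 0, because ∫ F_ε ĝ
tends to ⟨T, ĝ⟩ and P̂_ε is close to 1 on balls of radius much smaller than b_ε
(`exists_le_norm_prodNet`).

First equality. By Fubini (`boxFT_mul_schwartzFT`), inserting P̂_ε in the box integral averages the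
box transform of F_ε against P_ε around ω. On the ball of radius 1/b_ε the tame bound makes the
Taylor remainder of order J + 1 at most of size M(c/b)^{J+1}, while the vanishing moments of P_ε
kill the terms of orders 1 to J. As b/c is large infinite, J can be chosen to beat any power of the
gauge (`BoundedByTame.exists_net`, `IsMollifier.norm_integral_sub_le`).

Second equality. A distribution commutes with integrals of Schwartz functions (`dist_integral`), so
∫ F_ε ĝ = ⟨T̂, g P̂_ε⟩ for Schwartz g. Taking g = P_ε(· - ω) gives the transform of ι(T)·𝟙 at ω,
whereas ι(T̂)(ω) is ⟨T̂, g⟩. On the support of g, |ξ|/b_ε is at most a power of the gauge, and the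
vanishing moments make P̂_ε - 1 and its derivatives of arbitrarily high order in |ξ|/b_ε
(`IsMollifier.norm_iteratedFDeriv_sub_one_le`); continuity of T̂ concludes. -/

lemma Moderate.mono {x : I → V} {y : I → W} (hy : Moderate ρ y)
    (h : ∀ᶠ ε in atBot, ‖x ε‖ ≤ ‖y ε‖) : Moderate ρ x := by
  obtain ⟨N, hN⟩ := hy
  exact ⟨N, by filter_upwards [h, hN] with ε h1 h2 using h1.trans h2⟩

lemma Negligible.mono {x : I → V} {y : I → W} (hy : Negligible ρ y)
    (h : ∀ᶠ ε in atBot, ‖x ε‖ ≤ ‖y ε‖) : Negligible ρ x := fun m => by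
  filter_upwards [h, hy m] with ε h1 h2 using h1.trans h2

lemma moderate_const (c : V) : Moderate ρ fun _ => c := by
  refine ⟨1, ?_⟩
  filter_upwards [eventually_le ρ ((‖c‖ + 1)⁻¹) (by positivity)] with ε h
  rw [pow_one]
  have := (le_inv_comm₀ (ρ.pos ε) (by positivity)).1 h
  linarith

lemma Moderate.norm {x : I → V} (h : Moderate ρ x) : Moderate ρ fun ε => ‖x ε‖ :=
  h.mono (Eventually.of_forall fun ε => by simp)

lemma Negligible.norm {x : I → V} (h : Negligible ρ x) : Negligible ρ fun ε => ‖x ε‖ :=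
  h.mono (Eventually.of_forall fun ε => by simp)

lemma Moderate.fun_add {x y : I → V} (hx : Moderate ρ x) (hy : Moderate ρ y) :
    Moderate ρ fun ε => x ε + y ε := hx.add ρ hy

lemma Negligible.fun_add {x y : I → V} (hx : Negligible ρ x) (hy : Negligible ρ y) :
    Negligible ρ fun ε => x ε + y ε := hx.add ρ hy

lemma Moderate.fun_neg {x : I → V} (hx : Moderate ρ x) : Moderate ρ fun ε => -x ε :=
  hx.mono (Eventually.of_forall fun ε => by simp)

lemma Negligible.fun_neg {x : I → V} (hx : Negligible ρ x) : Negligible ρ fun ε => -x ε :=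
  hx.mono (Eventually.of_forall fun ε => by simp)

lemma Moderate.fun_sub {x y : I → V} (hx : Moderate ρ x) (hy : Moderate ρ y) :
    Moderate ρ fun ε => x ε - y ε := by simpa [sub_eq_add_neg] using hx.fun_add hy.fun_neg

lemma Negligible.symm {x y : I → V} (h : Negligible ρ fun ε => x ε - y ε) :
    Negligible ρ fun ε => y ε - x ε := by simpa using h.fun_neg

lemma Negligible.moderate {x : I → V} (h : Negligible ρ x) : Moderate ρ x :=
  ⟨0, by simpa using h 0⟩

lemma Moderate.of_sub {x y : I → V} (hx : Moderate ρ x)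
    (h : Negligible ρ fun ε => x ε - y ε) : Moderate ρ y := by
  simpa using hx.fun_sub h.moderate

lemma Moderate.fun_mul {x y : I → ℝ} (hx : Moderate ρ x) (hy : Moderate ρ y) :
    Moderate ρ fun ε => x ε * y ε :=
  (moderateNets ρ ℝ).mul_mem hx hy

lemma Moderate.fun_pow {x : I → ℝ} (hx : Moderate ρ x) (k : ℕ) :
    Moderate ρ fun ε => x ε ^ k :=
  (moderateNets ρ ℝ).pow_mem hx k

lemma Negligible.mul_moderate {x y : I → ℝ} (hx : Negligible ρ x) (hy : Moderate ρ y) :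
    Negligible ρ fun ε => x ε * y ε := by
  obtain ⟨N, hN⟩ := hy
  intro m
  filter_upwards [hN, hx (m + N)] with ε h1 h2
  have p : 0 < ρ ε ^ N := pow_pos (ρ.pos ε) _
  have p' : 0 < ρ ε ^ (m + N) := pow_pos (ρ.pos ε) _
  calc ‖x ε * y ε‖ = ‖x ε‖ * ‖y ε‖ := norm_mul _ _
    _ ≤ ρ ε ^ (m + N) * (ρ ε ^ N)⁻¹ := by gcongr
    _ = ρ ε ^ m := by rw [pow_add]; field_simp

lemma Moderate.sum {ι : Type*} {s : Finset ι} {x : ι → I → V} (h : ∀ i ∈ s, Moderate ρ (x i)) :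
    Moderate ρ fun ε => ∑ i ∈ s, x i ε := by
  classical
  induction s using Finset.induction_on with
  | empty => simpa using moderate_const (ρ := ρ) (0 : V)
  | insert a s ha ih =>
    simp only [Finset.sum_insert ha]
    exact (h a (by simp)).fun_add (ih fun i hi => h i (by simp [hi]))

lemma Negligible.sum {ι : Type*} {s : Finset ι} {x : ι → I → V}
    (h : ∀ i ∈ s, Negligible ρ (x i)) : Negligible ρ fun ε => ∑ i ∈ s, x i ε := by
  classical
  induction s using Finset.induction_on with
  | empty => exact fun m => Eventually.of_forall fun ε => by simpa using (pow_pos (ρ.pos ε) m).le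
  | insert a s ha ih =>
    simp only [Finset.sum_insert ha]
    exact (h a (by simp)).fun_add (ih fun i hi => h i (by simp [hi]))

lemma moderate_inv_pow (N : ℕ) : Moderate ρ fun ε => (ρ ε ^ N)⁻¹ :=
  ⟨N, Eventually.of_forall fun ε => by
    rw [Real.norm_of_nonneg (inv_nonneg.2 (pow_nonneg (ρ.pos ε).le _))]⟩

lemma negligible_of_le_mul {x : I → V} {c : I → ℝ} (hc : Moderate ρ c)
    (h : ∀ m : ℕ, ∀ᶠ ε in atBot, ‖x ε‖ ≤ c ε * ρ ε ^ m) : Negligible ρ x := by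
  obtain ⟨N, hN⟩ := hc
  intro m
  filter_upwards [hN, h (N + m)] with ε h1 h2
  have p : 0 < ρ ε ^ N := pow_pos (ρ.pos ε) _
  have p' : 0 < ρ ε ^ (N + m) := pow_pos (ρ.pos ε) _
  calc ‖x ε‖ ≤ c ε * ρ ε ^ (N + m) := h2
    _ ≤ (ρ ε ^ N)⁻¹ * ρ ε ^ (N + m) := by gcongr; exact (le_abs_self _).trans h1
    _ = ρ ε ^ m := by rw [pow_add]; field_simp

lemma eventually_mul_pow_le (c : ℝ) (m : ℕ) : ∀ᶠ ε in atBot, c * ρ ε ^ (m + 1) ≤ ρ ε ^ m := by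
  filter_upwards [eventually_le ρ ((|c| + 1)⁻¹) (by positivity)] with ε h
  have p : 0 < ρ ε ^ m := pow_pos (ρ.pos ε) _
  have h' : c * ρ ε ≤ 1 := by
    have := ρ.pos ε
    calc c * ρ ε ≤ (|c| + 1) * ρ ε := by gcongr; linarith [le_abs_self c]
      _ ≤ (|c| + 1) * (|c| + 1)⁻¹ := by gcongr
      _ = 1 := mul_inv_cancel₀ (by positivity)
  rw [pow_succ]
  nlinarith

/-- A property holds uniformly on a net of sets if it holds along all nets of points in them. -/
lemma eventually_forall_mem_of_forall_net {X : Type*} {S : I → Set X} {P : I → X → Prop}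
    (hS : ∀ ε, (S ε).Nonempty)
    (h : ∀ xs : I → X, (∀ ε, xs ε ∈ S ε) → ∀ᶠ ε in atBot, P ε (xs ε)) :
    ∀ᶠ ε in atBot, ∀ x ∈ S ε, P ε x := by
  classical
  -- Pick a counterexample whenever there is one: the property at the picked point then forces it on
  -- the whole set.
  have key : ∀ ε, ∃ x ∈ S ε, P ε x → ∀ y ∈ S ε, P ε y := by
    intro ε
    by_cases hb : ∃ x ∈ S ε, ¬ P ε x
    · obtain ⟨x, hx, hP⟩ := hb
      exact ⟨x, hx, fun h => absurd h hP⟩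
    · push Not at hb
      obtain ⟨x, hx⟩ := hS ε
      exact ⟨x, hx, fun _ => hb⟩
  choose xs hxs hP using key
  filter_upwards [h xs hxs] with ε hε using hP ε hε

end Nets

/-! ### Representatives -/

section Representatives

variable {ρ : Gauge} {R : Type} [NormedField R] {n : ℕ}

lemma cls_of_moderate {x : I → R} (h : Moderate ρ x) :
    cls ρ x = Ideal.Quotient.mk (negligibleNets ρ R) ⟨x, h⟩ := dif_pos h

lemma isRep_cls {x : I → R} (h : Moderate ρ x) : IsRep x (cls ρ x) := ⟨h, rfl⟩

lemma isRep_rep (x : GenNum ρ R) : IsRep (rep x) x := (exists_isRep x).choose_spec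

lemma cls_eq_iff {x y : I → R} (hx : Moderate ρ x) (hy : Moderate ρ y) :
    cls ρ x = cls ρ y ↔ Negligible ρ fun ε => x ε - y ε := by
  rw [cls_of_moderate hx, cls_of_moderate hy]
  exact Ideal.Quotient.eq

/-- No moderateness is needed: a negligible difference transfers it between the nets, and if both
fail to be moderate both classes take the default value 0. -/
lemma cls_eq_of_sub {x y : I → R} (h : Negligible ρ fun ε => x ε - y ε) : cls ρ x = cls ρ y := by
  by_cases hx : Moderate ρ x
  · exact (cls_eq_iff hx (hx.of_sub h)).2 h
  · have hy : ¬ Moderate ρ y := fun hy => hx (hy.of_sub h.symm)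
    have h0 : ∀ z : I → R, ¬ Moderate ρ z → cls ρ z = 0 := fun z hz => dif_neg hz
    rw [h0 x hx, h0 y hy]

lemma IsRep.sub_negligible {x : GenNum ρ R} {xs ys : I → R} (h : IsRep xs x) (h' : IsRep ys x) :
    Negligible ρ fun ε => xs ε - ys ε :=
  (cls_eq_iff h.1 h'.1).1 (h.2.trans h'.2.symm)

lemma IsRep.of_sub {x : GenNum ρ R} {xs ys : I → R} (h : IsRep xs x)
    (h' : Negligible ρ fun ε => xs ε - ys ε) : IsRep ys x :=
  ⟨h.1.of_sub h', by rw [← h.2, cls_eq_of_sub h']⟩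

lemma IsRep.unique {x y : GenNum ρ R} {xs : I → R} (h : IsRep xs x) (h' : IsRep xs y) : x = y :=
  h.2.symm.trans h'.2

lemma IsRep.exists_mk {x : GenNum ρ R} {xs : I → R} (h : IsRep xs x) :
    x = Ideal.Quotient.mk (negligibleNets ρ R) ⟨xs, h.1⟩ :=
  h.2.symm.trans (cls_of_moderate h.1)

lemma IsRep.mul {x y : GenNum ρ R} {xs ys : I → R} (hx : IsRep xs x) (hy : IsRep ys y) :
    IsRep (fun ε => xs ε * ys ε) (x * y) := by
  refine ⟨(moderateNets ρ R).mul_mem hx.1 hy.1, ?_⟩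
  rw [hx.exists_mk, hy.exists_mk]
  exact cls_of_moderate ((moderateNets ρ R).mul_mem hx.1 hy.1)

lemma IsRep.sub {x y : GenNum ρ R} {xs ys : I → R} (hx : IsRep xs x) (hy : IsRep ys y) :
    IsRep (fun ε => xs ε - ys ε) (x - y) := by
  refine ⟨(moderateNets ρ R).sub_mem hx.1 hy.1, ?_⟩
  rw [hx.exists_mk, hy.exists_mk]
  exact cls_of_moderate ((moderateNets ρ R).sub_mem hx.1 hy.1)

lemma isRep_zero : IsRep (fun _ => 0) (0 : GenNum ρ R) :=
  ⟨moderate_const 0, by rw [cls_of_moderate (moderate_const 0)]; rfl⟩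

lemma isRep_one : IsRep (fun _ => 1) (1 : GenNum ρ R) :=
  ⟨moderate_const 1, by rw [cls_of_moderate (moderate_const 1)]; rfl⟩

lemma IsRep.neg {x : GenNum ρ R} {xs : I → R} (hx : IsRep xs x) :
    IsRep (fun ε => -xs ε) (-x) := by
  simpa using isRep_zero.sub hx

lemma IsRep.pow {x : GenNum ρ R} {xs : I → R} (hx : IsRep xs x) (j : ℕ) :
    IsRep (fun ε => xs ε ^ j) (x ^ j) := by
  induction j with
  | zero => simpa using isRep_one
  | succ j ih => simpa [pow_succ] using ih.mul hx

/-- The order is defined by suitable representatives; arbitrary ones only cost an error below every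
power of the gauge. Conversely such an error is absorbed by replacing `ys` with the maximum of both
nets. -/
lemma le_iff {x y : GenNum ρ ℝ} {xs ys : I → ℝ} (hx : IsRep xs x) (hy : IsRep ys y) :
    x ≤ y ↔ ∀ m : ℕ, ∀ᶠ ε in atBot, xs ε ≤ ys ε + ρ ε ^ m := by
  constructor
  · rintro ⟨xs', ys', hx', hy', h⟩ m
    filter_upwards [h, hx.sub_negligible hx' (m + 1), hy'.sub_negligible hy (m + 1),
      eventually_mul_pow_le (ρ := ρ) 2 m] with ε h1 h2 h3 h4
    have h2 := (le_abs_self _).trans h2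
    have h3 := (le_abs_self _).trans h3
    linarith
  · intro h
    refine ⟨xs, fun ε => max (xs ε) (ys ε), hx, hy.of_sub fun m => ?_,
      Eventually.of_forall fun ε => le_max_left _ _⟩
    filter_upwards [h m] with ε hε
    have p : 0 < ρ ε ^ m := pow_pos (ρ.pos ε) _
    rw [Real.norm_eq_abs, abs_le]
    rcases max_cases (xs ε) (ys ε) with ⟨h1, h2⟩ | ⟨h1, h2⟩ <;> rw [h1] <;>
      constructor <;> linarith

lemma le_of_eventually {x y : GenNum ρ ℝ} {xs ys : I → ℝ} (hx : IsRep xs x) (hy : IsRep ys y)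
    (h : ∀ᶠ ε in atBot, xs ε ≤ ys ε) : x ≤ y := ⟨xs, ys, hx, hy, h⟩

/-- The inverse must be moderate, so invertibility is a lower bound by a power of the gauge, valid
for all small ε and not merely along a sequence. -/
lemma isUnit_iff {x : GenNum ρ R} {xs : I → R} (hx : IsRep xs x) :
    IsUnit x ↔ ∃ m : ℕ, ∀ᶠ ε in atBot, ρ ε ^ m ≤ ‖xs ε‖ := by
  constructor
  · rintro hu
    obtain ⟨z, hz⟩ := hu.exists_right_inv
    obtain ⟨zs, hzs⟩ := exists_isRep z
    obtain ⟨N, hN⟩ := hzs.1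
    have h1 := (hx.mul hzs).sub_negligible (hz ▸ isRep_one)
    -- If the inverse is at most ρ^{-N}, then |xs| ρ^{-N} ≥ 1 - ρ ≥ ρ as soon as 2ρ ≤ 1.
    refine ⟨N + 1, ?_⟩
    filter_upwards [h1 1, hN, eventually_mul_pow_le (ρ := ρ) 2 0] with ε h1 h2 h3
    have p : 0 < ρ ε ^ N := pow_pos (ρ.pos ε) _
    have p1 := ρ.pos ε
    have h4 : (1 : ℝ) ≤ ‖xs ε‖ * ‖zs ε‖ + ρ ε := by
      rw [pow_one] at h1
      calc (1 : ℝ) = ‖(1 : R)‖ := norm_one.symm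
        _ = ‖xs ε * zs ε - (xs ε * zs ε - 1)‖ := by congr 1; ring
        _ ≤ ‖xs ε * zs ε‖ + ‖xs ε * zs ε - 1‖ := norm_sub_le _ _
        _ ≤ _ := by rw [norm_mul]; linarith
    norm_num at h3
    have h5 : ‖xs ε‖ * ‖zs ε‖ ≤ ‖xs ε‖ * (ρ ε ^ N)⁻¹ := by gcongr
    have h6 : ρ ε ≤ ‖xs ε‖ * (ρ ε ^ N)⁻¹ := by linarith
    rw [pow_succ]
    calc ρ ε ^ N * ρ ε ≤ ρ ε ^ N * (‖xs ε‖ * (ρ ε ^ N)⁻¹) := by gcongr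
      _ = ‖xs ε‖ := by field_simp
  · rintro ⟨m, hm⟩
    have hinv : Moderate ρ fun ε => (xs ε)⁻¹ := by
      refine ⟨m, ?_⟩
      filter_upwards [hm] with ε h
      rw [norm_inv]
      exact inv_anti₀ (pow_pos (ρ.pos ε) _) h
    refine IsUnit.of_mul_eq_one (cls ρ fun ε => (xs ε)⁻¹) ?_
    refine (hx.mul (isRep_cls hinv)).unique (isRep_one.of_sub fun k => ?_)
    filter_upwards [hm] with ε h
    have : xs ε ≠ 0 := fun h0 => by
      have := pow_pos (ρ.pos ε) m
      rw [h0, norm_zero] at h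
      linarith
    rw [mul_inv_cancel₀ this, sub_self, norm_zero]
    exact (pow_pos (ρ.pos ε) _).le

lemma IsRep.norm {x : GenNum ρ R} {xs : I → R} (hx : IsRep xs x) :
    IsRep (fun ε => ‖xs ε‖) (gabs x) := by
  refine (isRep_cls (isRep_rep x).1.norm).of_sub ?_
  refine ((isRep_rep x).sub_negligible hx).mono (Eventually.of_forall fun ε => ?_)
  exact abs_norm_sub_norm_le _ _

lemma isRep_const (r : ℝ) : IsRep (fun _ => r) (const ρ r) := isRep_cls (moderate_const r)

lemma gabs_pos_iff {x : GenNum ρ R} {xs : I → R} (hx : IsRep xs x) :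
    0 < gabs x ↔ ∃ m : ℕ, ∀ᶠ ε in atBot, ρ ε ^ m ≤ ‖xs ε‖ := by
  have h := (isUnit_iff (isRep_zero.sub hx.norm))
  simp only [zero_sub, norm_neg, norm_norm] at h
  constructor
  · rintro ⟨-, h2⟩
    rw [zero_sub] at h2
    exact h.1 h2
  · intro h2
    refine ⟨le_of_eventually isRep_zero hx.norm (Eventually.of_forall fun ε => norm_nonneg _), ?_⟩
    rw [zero_sub]
    exact h.2 h2

lemma IsRepPt.moderate {x : Fin n → GenNum ρ ℝ} {xs : I → E n} (h : IsRepPt xs x) :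
    Moderate ρ xs := by
  have h1 : Moderate ρ fun ε => ∑ i, ‖xs ε i‖ := Moderate.sum fun i _ => (h i).1.norm
  refine h1.mono (Eventually.of_forall fun ε => ?_)
  rw [Real.norm_of_nonneg (Finset.sum_nonneg fun i _ => norm_nonneg _)]
  have := EuclideanSpace.norm_eq (xs ε)
  rw [this]
  refine Real.sqrt_le_iff.2 ⟨Finset.sum_nonneg fun i _ => norm_nonneg _, ?_⟩
  exact Finset.sum_sq_le_sq_sum_of_nonneg fun i _ => norm_nonneg _

lemma norm_apply_le {x : E n} (i : Fin n) : ‖x i‖ ≤ ‖x‖ := PiLp.norm_apply_le x i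

lemma norm_le_sum_norm (x : E n) : ‖x‖ ≤ ∑ i, ‖x i‖ := by
  rw [EuclideanSpace.norm_eq]
  refine Real.sqrt_le_iff.2 ⟨Finset.sum_nonneg fun i _ => norm_nonneg _, ?_⟩
  exact Finset.sum_sq_le_sq_sum_of_nonneg fun i _ => norm_nonneg _

lemma isRepPt_repPt (x : Fin n → GenNum ρ ℝ) : IsRepPt (repPt x) x := fun i => isRep_rep (x i)

lemma isRepPt_cls {xs : I → E n} (h : Moderate ρ xs) :
    IsRepPt xs (fun i => cls ρ fun ε => xs ε i) := fun i =>
  isRep_cls (h.mono (Eventually.of_forall fun _ => norm_apply_le i))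

lemma IsRepPt.sub_negligible {x : Fin n → GenNum ρ ℝ} {xs ys : I → E n} (h : IsRepPt xs x)
    (h' : IsRepPt ys x) : Negligible ρ fun ε => xs ε - ys ε := by
  have h1 : Negligible ρ fun ε => ∑ i, ‖xs ε i - ys ε i‖ :=
    Negligible.sum fun i _ => ((h i).sub_negligible (h' i)).norm
  refine h1.mono (Eventually.of_forall fun ε => ?_)
  exact (norm_le_sum_norm _).trans (le_abs_self _)

lemma IsRepPt.sub {x y : Fin n → GenNum ρ ℝ} {xs ys : I → E n} (h : IsRepPt xs x)
    (h' : IsRepPt ys y) : IsRepPt (fun ε => xs ε - ys ε) (x - y) := fun i => (h i).sub (h' i)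

lemma IsRepPt.norm {x : Fin n → GenNum ρ ℝ} {xs : I → E n} (h : IsRepPt xs x) :
    IsRep (fun ε => ‖xs ε‖) (gnorm x) := by
  refine (isRep_cls (isRepPt_repPt x).moderate.norm).of_sub ?_
  refine ((isRepPt_repPt x).sub_negligible h).mono (Eventually.of_forall fun ε => ?_)
  exact abs_norm_sub_norm_le _ _

lemma mem_gsupp_of_pos {f : (Fin n → GenNum ρ ℝ) → GenNum ρ ℂ} {x : Fin n → GenNum ρ ℝ}
    (h : 0 < gabs (f x)) : x ∈ gsupp f := by
  intro r hr
  refine ⟨x, h, ?_⟩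
  have h0 : gnorm (x - x) = 0 := by
    have h1 := ((isRepPt_repPt x).sub (isRepPt_repPt x)).norm
    simp only [sub_self, norm_zero] at h1
    rw [sub_self]
    exact h1.unique isRep_zero
  rw [h0]
  exact hr

end Representatives

/-! ### Seminorms, translations and derivatives of Schwartz functions -/

section Schwartz

open LineDeriv

variable {n : ℕ}

/-- Symmetry of the second derivative lets a directional derivative pass through each further
differential. The target space is generalized because the induction replaces f by its differential.
-/
lemma fderiv_iteratedFDeriv_apply {F : Type*} [NormedAddCommGroup F] [NormedSpace ℝ F]
    (l : ℕ) {f : E n → F} (hf : ContDiff ℝ ∞ f) (z v : E n) :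
    fderiv ℝ (iteratedFDeriv ℝ l f) z v = iteratedFDeriv ℝ l (fun y => fderiv ℝ f y v) z := by
  induction l generalizing F f z with
  | zero =>
    ext m
    have h : iteratedFDeriv ℝ 0 f = (continuousMultilinearCurryFin0 ℝ (E n) F).symm ∘ f := by
      rw [iteratedFDeriv_zero_eq_comp]
    rw [h, LinearIsometryEquiv.comp_fderiv]
    simp
  | succ l ih =>
    have hf1 : ContDiff ℝ ∞ (fderiv ℝ f) := hf.fderiv_right (m := ∞) (by simp)
    have hd : ∀ y, DifferentiableAt ℝ (fderiv ℝ f) y := fun y =>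
      (hf1.differentiable (by simp)) y
    have e1 : iteratedFDeriv ℝ (l + 1) f =
        (continuousMultilinearCurryRightEquiv' ℝ l (E n) F).symm ∘
          iteratedFDeriv ℝ l (fderiv ℝ f) := by
      ext1 x
      rw [iteratedFDeriv_succ_eq_comp_right]
    have e2 : (fderiv ℝ fun y => fderiv ℝ f y v) = fun y => fderiv ℝ (fderiv ℝ f) y v := by
      ext y u
      have hs : IsSymmSndFDerivAt ℝ f y := hf.contDiffAt.isSymmSndFDerivAt (by
        rw [minSmoothness_of_isRCLikeNormedField]
        exact WithTop.coe_le_coe.2 le_top)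
      rw [fderiv_clm_apply (hd y) (differentiableAt_const v)]
      simpa using hs.eq u v
    have e3 := (continuousMultilinearCurryRightEquiv' ℝ l (E n) F).symm.comp_fderiv
      (f := iteratedFDeriv ℝ l (fderiv ℝ f)) (x := z)
    rw [e1, iteratedFDeriv_succ_eq_comp_right, e2]
    refine (congrArg (fun L => L v) e3).trans ?_
    exact congrArg (continuousMultilinearCurryRightEquiv' ℝ l (E n) F).symm (ih hf1 z)

variable (φ : 𝓢(E n, ℂ))

local notation "sn" => SchwartzMap.seminorm ℂ (E := E n) (F := ℂ)

lemma pow_add_le_of_norm_le {a b c : ℝ} (ha : 0 ≤ a) (hb : 0 ≤ b) (hc : 0 ≤ c) (h : c ≤ a + b)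
    (k : ℕ) : c ^ k ≤ 2 ^ k * (1 + b) ^ k * (a ^ k + 1) := by
  have h1 : c ≤ 2 * (1 + b) * max a 1 := by
    have := le_max_left a 1
    have := le_max_right a 1
    nlinarith
  calc c ^ k ≤ (2 * (1 + b) * max a 1) ^ k := by gcongr
    _ = 2 ^ k * (1 + b) ^ k * max a 1 ^ k := by rw [mul_pow, mul_pow]
    _ ≤ 2 ^ k * (1 + b) ^ k * (a ^ k + 1) := by
      gcongr
      rcases max_cases a 1 with ⟨h, _⟩ | ⟨h, _⟩ <;> rw [h]
      · linarith
      · rw [one_pow]; linarith [pow_nonneg ha k]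

/-- Moves the polynomial weight from y to z at a cost polynomial in the displacement; all
translation estimates below rest on it. -/
lemma pow_norm_mul_le_seminorm (k l : ℕ) {x y z : E n} (h : ‖y‖ ≤ ‖z‖ + ‖x‖) :
    ‖y‖ ^ k * ‖iteratedFDeriv ℝ l φ z‖ ≤ 2 ^ k * (1 + ‖x‖) ^ k * (sn k l φ + sn 0 l φ) := by
  have h1 := φ.le_seminorm ℂ k l z
  have h0 := φ.le_seminorm ℂ 0 l z
  rw [pow_zero, one_mul] at h0
  calc ‖y‖ ^ k * ‖iteratedFDeriv ℝ l φ z‖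
      ≤ 2 ^ k * (1 + ‖x‖) ^ k * (‖z‖ ^ k + 1) * ‖iteratedFDeriv ℝ l φ z‖ := by
        gcongr
        exact pow_add_le_of_norm_le (norm_nonneg _) (norm_nonneg _) (norm_nonneg _) h k
    _ = 2 ^ k * (1 + ‖x‖) ^ k *
        (‖z‖ ^ k * ‖iteratedFDeriv ℝ l φ z‖ + ‖iteratedFDeriv ℝ l φ z‖) := by ring
    _ ≤ _ := by gcongr

/-- The translate `φ(· - x)`. -/
def trans (x : E n) : 𝓢(E n, ℂ) →L[ℂ] 𝓢(E n, ℂ) := SchwartzMap.compSubConstCLM ℂ x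

@[simp] lemma trans_apply (x y : E n) : trans x φ y = φ (y - x) := rfl

lemma iteratedFDeriv_trans (l : ℕ) (x y : E n) :
    iteratedFDeriv ℝ l (trans x φ) y = iteratedFDeriv ℝ l φ (y - x) :=
  iteratedFDeriv_comp_sub l x y

lemma trans_trans (x y : E n) : trans x (trans y φ) = trans (x + y) φ := by
  ext z
  simp only [trans_apply]
  congr 1
  abel

lemma seminorm_trans_le (k l : ℕ) (x : E n) :
    sn k l (trans x φ) ≤ 2 ^ k * (1 + ‖x‖) ^ k * (sn k l φ + sn 0 l φ) := by
  refine SchwartzMap.seminorm_le_bound ℂ k l _ (by positivity) fun y => ?_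
  rw [iteratedFDeriv_trans]
  refine pow_norm_mul_le_seminorm φ k l ?_
  simpa using norm_add_le (y - x) x

lemma iteratedFDeriv_lineDeriv (l : ℕ) (v z : E n) :
    iteratedFDeriv ℝ l (∂_{v} φ : 𝓢(E n, ℂ)) z = fderiv ℝ (iteratedFDeriv ℝ l φ) z v :=
  (fderiv_iteratedFDeriv_apply l (φ.smooth ⊤) z v).symm

lemma seminorm_lineDeriv_le (k l : ℕ) (v : E n) :
    sn k l (∂_{v} φ) ≤ ‖v‖ * sn k (l + 1) φ := by
  refine SchwartzMap.seminorm_le_bound ℂ k l _ (by positivity) fun y => ?_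
  rw [iteratedFDeriv_lineDeriv]
  calc _ ≤ ‖y‖ ^ k * (‖fderiv ℝ (iteratedFDeriv ℝ l φ) y‖ * ‖v‖) := by
        gcongr; exact ContinuousLinearMap.le_opNorm _ _
    _ = ‖v‖ * (‖y‖ ^ k * ‖iteratedFDeriv ℝ (l + 1) φ y‖) := by
        rw [norm_fderiv_iteratedFDeriv]; ring
    _ ≤ _ := by gcongr; exact φ.le_seminorm ℂ k (l + 1) y

lemma hasDerivAt_iteratedFDeriv_line (l : ℕ) (y x : E n) (t : ℝ) :
    HasDerivAt (fun t : ℝ => iteratedFDeriv ℝ l φ (y - t • x))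
      (-(iteratedFDeriv ℝ l (∂_{x} φ : 𝓢(E n, ℂ)) (y - t • x))) t := by
  have h1 : HasFDerivAt (iteratedFDeriv ℝ l φ) (fderiv ℝ (iteratedFDeriv ℝ l φ) (y - t • x))
      (y - t • x) :=
    (((φ.smooth ⊤).differentiable_iteratedFDeriv
      (mod_cast ENat.natCast_lt_top l)) _).hasFDerivAt
  have h2 : HasDerivAt (fun t : ℝ => y - t • x) (-x) t := by
    simpa using ((hasDerivAt_id t).smul_const x).const_sub y
  have h3 := h1.comp_hasDerivAt t h2
  rw [map_neg, ← iteratedFDeriv_lineDeriv] at h3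
  exact h3

lemma norm_smul_le_of_mem {x : E n} {t : ℝ} (h0 : 0 ≤ t) (h1 : t ≤ 1) : ‖t • x‖ ≤ ‖x‖ := by
  rw [norm_smul, Real.norm_of_nonneg h0]
  exact mul_le_of_le_one_left (norm_nonneg _) h1

/-- Mean value inequality along the segment t ↦ y - t x, with the weight |y|^k carried along. -/
lemma seminorm_trans_sub_le (k l : ℕ) (x : E n) :
    sn k l (trans x φ - φ) ≤
      ‖x‖ * (2 ^ k * (1 + ‖x‖) ^ k * (sn k (l + 1) φ + sn 0 (l + 1) φ)) := by
  refine SchwartzMap.seminorm_le_bound ℂ k l _ (by positivity) fun y => ?_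
  have hd : iteratedFDeriv ℝ l (trans x φ - φ : 𝓢(E n, ℂ)) y =
      iteratedFDeriv ℝ l φ (y - x) - iteratedFDeriv ℝ l φ y := by
    rw [← iteratedFDeriv_trans]
    exact iteratedFDeriv_sub_apply ((trans x φ).contDiffAt _) (φ.contDiffAt _)
  rw [hd]
  have key := norm_image_sub_le_of_norm_deriv_le_segment_01'
    (f := fun t : ℝ => (‖y‖ ^ k) • iteratedFDeriv ℝ l φ (y - t • x))
    (f' := fun t : ℝ => (‖y‖ ^ k) • -(iteratedFDeriv ℝ l (∂_{x} φ : 𝓢(E n, ℂ)) (y - t • x)))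
    (C := ‖x‖ * (2 ^ k * (1 + ‖x‖) ^ k * (sn k (l + 1) φ + sn 0 (l + 1) φ)))
    (fun t _ => ((hasDerivAt_iteratedFDeriv_line φ l y x t).const_smul (‖y‖ ^ k)).hasDerivWithinAt) ?_
  · simpa [← smul_sub, norm_smul] using key
  · rintro t ⟨h0, h1⟩
    rw [norm_smul, norm_neg, norm_pow, norm_norm, iteratedFDeriv_lineDeriv]
    calc _ ≤ ‖y‖ ^ k * (‖fderiv ℝ (iteratedFDeriv ℝ l φ) (y - t • x)‖ * ‖x‖) := by
          gcongr; exact ContinuousLinearMap.le_opNorm _ _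
      _ = ‖x‖ * (‖y‖ ^ k * ‖iteratedFDeriv ℝ (l + 1) φ (y - t • x)‖) := by
          rw [norm_fderiv_iteratedFDeriv]; ring
      _ ≤ _ := by
          refine mul_le_mul_of_nonneg_left ?_ (norm_nonneg _)
          refine pow_norm_mul_le_seminorm φ k (l + 1) ?_
          have := norm_add_le (y - t • x) (t • x)
          rw [sub_add_cancel] at this
          exact this.trans (by gcongr; exact norm_smul_le_of_mem h0 h1.le)

/-- Adding the linear term t ∂_x φ makes the derivative along the segment a translation difference
of ∂_x φ, already of order |x|; this gives the quadratic error needed for Fréchet differentiability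
of `reg`. -/
lemma seminorm_trans_sub_add_lineDeriv_le (k l : ℕ) (x : E n) :
    sn k l (trans x φ - φ + ∂_{x} φ) ≤
      ‖x‖ ^ 2 * (2 ^ k * (1 + ‖x‖) ^ k * (sn k (l + 2) φ + sn 0 (l + 2) φ)) := by
  refine SchwartzMap.seminorm_le_bound ℂ k l _ (by positivity) fun y => ?_
  have hd : iteratedFDeriv ℝ l (trans x φ - φ + ∂_{x} φ : 𝓢(E n, ℂ)) y =
      iteratedFDeriv ℝ l φ (y - x) - iteratedFDeriv ℝ l φ y +
        iteratedFDeriv ℝ l (∂_{x} φ : 𝓢(E n, ℂ)) y := by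
    rw [← iteratedFDeriv_trans]
    rw [← iteratedFDeriv_sub_apply ((trans x φ).contDiffAt _) (φ.contDiffAt _)]
    exact iteratedFDeriv_add_apply ((trans x φ - φ).contDiffAt _) ((∂_{x} φ).contDiffAt _)
  rw [hd]
  have key := norm_image_sub_le_of_norm_deriv_le_segment_01'
    (f := fun t : ℝ => (‖y‖ ^ k) • (iteratedFDeriv ℝ l φ (y - t • x) +
      t • iteratedFDeriv ℝ l (∂_{x} φ : 𝓢(E n, ℂ)) y))
    (f' := fun t : ℝ => (‖y‖ ^ k) • (-(iteratedFDeriv ℝ l (∂_{x} φ : 𝓢(E n, ℂ)) (y - t • x)) +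
      iteratedFDeriv ℝ l (∂_{x} φ : 𝓢(E n, ℂ)) y))
    (C := ‖x‖ ^ 2 * (2 ^ k * (1 + ‖x‖) ^ k * (sn k (l + 2) φ + sn 0 (l + 2) φ)))
    (fun t _ => (((hasDerivAt_iteratedFDeriv_line φ l y x t).add (by
      simpa using (hasDerivAt_id t).smul_const
        (iteratedFDeriv ℝ l (∂_{x} φ : 𝓢(E n, ℂ)) y))).const_smul (‖y‖ ^ k)).hasDerivWithinAt) ?_
  · simp only [one_smul, zero_smul, sub_zero, add_zero, ← smul_sub] at key
    rw [norm_smul, norm_pow, norm_norm] at key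
    rw [show ∀ a b c : ContinuousMultilinearMap ℝ (fun _ : Fin l => E n) ℂ,
      a - b + c = a + c - b from fun a b c => by abel]
    exact key
  · rintro t ⟨h0, h1⟩
    have h2 := (∂_{x} φ : 𝓢(E n, ℂ)).le_seminorm ℂ k l
    have e : -(iteratedFDeriv ℝ l (∂_{x} φ : 𝓢(E n, ℂ)) (y - t • x)) +
      iteratedFDeriv ℝ l (∂_{x} φ : 𝓢(E n, ℂ)) y = -iteratedFDeriv ℝ l
        (trans (t • x) (∂_{x} φ) - ∂_{x} φ : 𝓢(E n, ℂ)) y := by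
      have := iteratedFDeriv_sub_apply (𝕜 := ℝ) (i := l) (x := y)
        ((trans (t • x) (∂_{x} φ)).contDiffAt _) ((∂_{x} φ : 𝓢(E n, ℂ)).contDiffAt _)
      rw [iteratedFDeriv_trans] at this
      rw [neg_add_eq_sub, ← neg_sub]
      exact congrArg Neg.neg this.symm
    rw [e, norm_smul, norm_neg, norm_pow, norm_norm]
    refine (SchwartzMap.le_seminorm ℂ k l _ y).trans ((seminorm_trans_sub_le _ k l _).trans ?_)
    have h3 := norm_smul_le_of_mem (x := x) h0 h1.le
    calc _ ≤ ‖x‖ * (2 ^ k * (1 + ‖x‖) ^ k * (‖x‖ * sn k (l + 2) φ + ‖x‖ * sn 0 (l + 2) φ)) := by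
          gcongr
          · exact seminorm_lineDeriv_le φ k (l + 1) x
          · exact seminorm_lineDeriv_le φ 0 (l + 1) x
      _ = _ := by ring

/-- A continuous seminorm is bounded by a finite sum of Schwartz seminorms. -/
lemma exists_seminorm_le_sum (q : Seminorm ℂ 𝓢(E n, ℂ)) (hq : Continuous q) :
    ∃ (s : Finset (ℕ × ℕ)) (C : ℝ), 0 ≤ C ∧ ∀ φ, q φ ≤ C * ∑ i ∈ s, sn i.1 i.2 φ := by
  obtain ⟨s, C, -, h⟩ := Seminorm.bound_of_continuous (schwartz_withSeminorms ℂ (E n) ℂ) q hq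
  refine ⟨s, C, C.2, fun φ => (h φ).trans ?_⟩
  change C * (s.sup (schwartzSeminormFamily ℂ (E n) ℂ)) φ ≤ _
  refine mul_le_mul_of_nonneg_left ?_ C.2
  refine Seminorm.finset_sup_apply_le (Finset.sum_nonneg fun i _ => apply_nonneg _ _) fun i hi => ?_
  exact Finset.single_le_sum (f := fun i : ℕ × ℕ => sn i.1 i.2 φ)
    (fun i _ => apply_nonneg _ _) hi

/-- The seminorm `φ ↦ |⟨T, φ⟩|` of a tempered distribution. -/
def distSeminorm (T : 𝓢'(E n, ℂ)) : Seminorm ℂ 𝓢(E n, ℂ) :=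
  (normSeminorm ℂ ℂ).comp (T : 𝓢(E n, ℂ) →L[ℂ] ℂ).toLinearMap

lemma continuous_distSeminorm (T : 𝓢'(E n, ℂ)) : Continuous (distSeminorm T) :=
  (continuous_norm (E := ℂ)).comp (ContinuousLinearMap.continuous (T : 𝓢(E n, ℂ) →L[ℂ] ℂ))

end Schwartz

/-! ### Regularizations of tempered distributions -/

section Regularization

open LineDeriv

variable {n : ℕ}

local notation "sn" => SchwartzMap.seminorm ℂ (E := E n) (F := ℂ)

/-- The sum of all Schwartz seminorms up to order `N`. -/
def total (N : ℕ) (φ : 𝓢(E n, ℂ)) : ℝ :=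
  ∑ i ∈ Finset.range (N + 1) ×ˢ Finset.range (N + 1), sn i.1 i.2 φ

lemma total_nonneg (N : ℕ) (φ : 𝓢(E n, ℂ)) : 0 ≤ total N φ :=
  Finset.sum_nonneg fun _ _ => apply_nonneg _ _

lemma seminorm_le_total {N k l : ℕ} (hk : k ≤ N) (hl : l ≤ N) (φ : 𝓢(E n, ℂ)) :
    sn k l φ ≤ total N φ :=
  Finset.single_le_sum (f := fun i : ℕ × ℕ => sn i.1 i.2 φ) (a := (k, l))
    (s := Finset.range (N + 1) ×ˢ Finset.range (N + 1)) (fun i _ => apply_nonneg _ _)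
    (Finset.mem_product.2 ⟨Finset.mem_range.2 (by lia), Finset.mem_range.2 (by lia)⟩)

lemma total_le {N : ℕ} {φ : 𝓢(E n, ℂ)} {B : ℝ} (h : ∀ k ≤ N, ∀ l ≤ N, sn k l φ ≤ B) :
    total N φ ≤ (N + 1) ^ 2 * B := by
  have h1 : total N φ ≤ ∑ _i ∈ Finset.range (N + 1) ×ˢ Finset.range (N + 1), B := by
    refine Finset.sum_le_sum fun i hi => ?_
    rw [Finset.mem_product, Finset.mem_range, Finset.mem_range] at hi
    exact h _ (by lia) _ (by lia)
  refine h1.trans (le_of_eq ?_)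
  simp [pow_two]

lemma exists_le_total (q : Seminorm ℂ 𝓢(E n, ℂ)) (hq : Continuous q) :
    ∃ (N : ℕ) (C : ℝ), 0 ≤ C ∧ ∀ φ, q φ ≤ C * total N φ := by
  obtain ⟨s, C, hC, h⟩ := exists_seminorm_le_sum q hq
  -- Any number dominating all indices in `s` will do; their sum is one.
  refine ⟨∑ i ∈ s, (i.1 + i.2), C, hC, fun φ => (h φ).trans ?_⟩
  refine mul_le_mul_of_nonneg_left ?_ hC
  refine Finset.sum_le_sum_of_subset_of_nonneg (fun i hi => ?_) fun i _ _ => apply_nonneg _ _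
  have := Finset.single_le_sum (f := fun i : ℕ × ℕ => i.1 + i.2) (fun i _ => Nat.zero_le _) hi
  simp only [Finset.mem_product, Finset.mem_range]
  constructor <;> lia

lemma exists_dist_le_total (T : 𝓢'(E n, ℂ)) :
    ∃ (N : ℕ) (C : ℝ), 0 ≤ C ∧ ∀ φ, ‖T φ‖ ≤ C * total N φ :=
  exists_le_total (distSeminorm T) (continuous_distSeminorm T)

lemma total_le_of_seminorm_le {N M : ℕ} {φ ψ : 𝓢(E n, ℂ)} {x : E n} {A : ℝ} {j : ℕ} (hA : 0 ≤ A)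
    (hM : N + j ≤ M) (h : ∀ k l, sn k l ψ ≤
      A * (2 ^ k * (1 + ‖x‖) ^ k * (sn k (l + j) φ + sn 0 (l + j) φ))) :
    total N ψ ≤ (N + 1) ^ 2 * 2 ^ (N + 1) * A * (1 + ‖x‖) ^ N * total M φ := by
  have h1 : total N ψ ≤ (N + 1) ^ 2 *
      (A * (2 ^ N * (1 + ‖x‖) ^ N * (total M φ + total M φ))) := by
    refine total_le fun k hk l hl => (h k l).trans ?_
    have hx : 1 ≤ 1 + ‖x‖ := by linarith [norm_nonneg x]
    have := total_nonneg M φ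
    gcongr
    · norm_num
    · exact seminorm_le_total (by lia) (by lia) φ
    · exact seminorm_le_total (by lia) (by lia) φ
  refine h1.trans (le_of_eq ?_)
  ring

lemma total_trans_le (N : ℕ) (φ : 𝓢(E n, ℂ)) (x : E n) :
    total N (trans x φ) ≤ (N + 1) ^ 2 * 2 ^ (N + 1) * (1 + ‖x‖) ^ N * total N φ := by
  have := total_le_of_seminorm_le (N := N) (M := N) (φ := φ) (ψ := trans x φ) (x := x) (A := 1)
    (j := 0) zero_le_one le_rfl fun k l => by simpa using seminorm_trans_le φ k l x
  simpa using this

lemma total_trans_sub_le (N : ℕ) (φ : 𝓢(E n, ℂ)) (x : E n) :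
    total N (trans x φ - φ) ≤
      (N + 1) ^ 2 * 2 ^ (N + 1) * ‖x‖ * (1 + ‖x‖) ^ N * total (N + 1) φ :=
  total_le_of_seminorm_le (norm_nonneg x) le_rfl fun k l => seminorm_trans_sub_le φ k l x

lemma total_trans_sub_add_lineDeriv_le (N : ℕ) (φ : 𝓢(E n, ℂ)) (x : E n) :
    total N (trans x φ - φ + ∂_{x} φ) ≤
      (N + 1) ^ 2 * 2 ^ (N + 1) * ‖x‖ ^ 2 * (1 + ‖x‖) ^ N * total (N + 2) φ :=
  total_le_of_seminorm_le (by positivity) le_rfl fun k l =>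
    seminorm_trans_sub_add_lineDeriv_le φ k l x

lemma total_lineDeriv_le (N : ℕ) (φ : 𝓢(E n, ℂ)) (v : E n) :
    total N (∂_{v} φ) ≤ (N + 1) ^ 2 * (‖v‖ * total (N + 1) φ) := by
  refine total_le fun k hk l hl => (seminorm_lineDeriv_le φ k l v).trans ?_
  gcongr
  exact seminorm_le_total (by lia) (by lia) φ

/-- The function `x ↦ ⟨T, φ(· - x)⟩`. -/
def reg (T : 𝓢'(E n, ℂ)) (φ : 𝓢(E n, ℂ)) (x : E n) : ℂ := T (trans x φ)

/-- The differential of `reg T φ`. -/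
def regDeriv (T : 𝓢'(E n, ℂ)) (φ : 𝓢(E n, ℂ)) (x : E n) : E n →L[ℝ] ℂ :=
  LinearMap.toContinuousLinearMap
    { toFun := fun v => -T (trans x (∂_{v} φ))
      map_add' := fun v w => by
        rw [LineDerivAdd.lineDerivOp_left_add, map_add, map_add, neg_add]
      map_smul' := fun c v => by
        have h : (∂_{c • v} φ : 𝓢(E n, ℂ)) = (c : ℂ) • ∂_{v} φ := by
          rw [LineDerivLeftSMul.lineDerivOp_left_smul]
          ext x
          simp
        rw [h, map_smul, map_smul]
        simp }

lemma regDeriv_apply (T : 𝓢'(E n, ℂ)) (φ : 𝓢(E n, ℂ)) (x v : E n) :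
    regDeriv T φ x v = -reg T (∂_{v} φ) x := rfl

/-- The exponent and the constant depend on T alone, so along a net of test functions only `total N
φ` varies; moderateness of regularizations comes from this uniformity. -/
lemma exists_norm_reg_le (T : 𝓢'(E n, ℂ)) :
    ∃ (N : ℕ) (C : ℝ), 0 ≤ C ∧ ∀ φ x, ‖reg T φ x‖ ≤ C * (1 + ‖x‖) ^ N * total N φ := by
  obtain ⟨N, C, hC, h⟩ := exists_dist_le_total T
  refine ⟨N, C * ((N + 1) ^ 2 * 2 ^ (N + 1)), by positivity, fun φ x => (h _).trans ?_⟩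
  calc C * total N (trans x φ)
      ≤ C * ((N + 1) ^ 2 * 2 ^ (N + 1) * (1 + ‖x‖) ^ N * total N φ) := by
        gcongr; exact total_trans_le N φ x
    _ = _ := by ring

/-- The first order error is the regularization of trans v φ - φ + ∂_v φ, which is quadratic in v in
every Schwartz seminorm. -/
lemma hasFDerivAt_reg (T : 𝓢'(E n, ℂ)) (φ : 𝓢(E n, ℂ)) (x : E n) :
    HasFDerivAt (reg T φ) (regDeriv T φ x) x := by
  obtain ⟨N, C, hC, h⟩ := exists_norm_reg_le T
  rw [hasFDerivAt_iff_isLittleO_nhds_zero]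
  refine Asymptotics.IsBigO.trans_isLittleO (g := fun v : E n => ‖v‖ ^ 2)
    (Asymptotics.IsBigO.of_bound (C * (1 + ‖x‖) ^ N *
      ((N + 1) ^ 2 * 2 ^ (N + 1) * 2 ^ N * total (N + 2) φ)) ?_)
    (Asymptotics.isLittleO_norm_pow_id one_lt_two)
  filter_upwards [Metric.ball_mem_nhds (0 : E n) one_pos] with v hv
  have hv1 : ‖v‖ ≤ 1 := by simpa using (Metric.mem_ball.1 hv).le
  have e : reg T φ (x + v) - reg T φ x - regDeriv T φ x v =
      reg T (trans v φ - φ + ∂_{v} φ) x := by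
    rw [regDeriv_apply]
    simp only [reg, map_add, map_sub, trans_trans]
    ring
  rw [e, Real.norm_of_nonneg (by positivity)]
  calc _ ≤ C * (1 + ‖x‖) ^ N * total N (trans v φ - φ + ∂_{v} φ) := h _ _
    _ ≤ C * (1 + ‖x‖) ^ N * ((N + 1) ^ 2 * 2 ^ (N + 1) * ‖v‖ ^ 2 * (1 + ‖v‖) ^ N *
        total (N + 2) φ) := by gcongr; exact total_trans_sub_add_lineDeriv_le N φ v
    _ ≤ C * (1 + ‖x‖) ^ N * ((N + 1) ^ 2 * 2 ^ (N + 1) * ‖v‖ ^ 2 * 2 ^ N *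
        total (N + 2) φ) := by
        have := total_nonneg (N + 2) φ
        gcongr
        linarith
    _ = _ := by ring

lemma continuous_reg (T : 𝓢'(E n, ℂ)) (φ : 𝓢(E n, ℂ)) : Continuous (reg T φ) :=
  continuous_iff_continuousAt.2 fun x => (hasFDerivAt_reg T φ x).continuousAt

/-- The standard basis vectors. -/
def stdVec (i : Fin n) : E n := EuclideanSpace.single i 1

lemma norm_stdVec (i : Fin n) : ‖(stdVec i : E n)‖ = 1 := by simp [stdVec]

lemma sum_smul_stdVec (v : E n) : ∑ i, v i • (stdVec i : E n) = v := by
  ext j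
  simp [stdVec, Finset.sum_apply, Pi.single_apply]

/-- The linear map `z ↦ (v ↦ -v i * z)`. -/
def negCoord (i : Fin n) : ℂ →L[ℝ] E n →L[ℝ] ℂ :=
  -(ContinuousLinearMap.smulRightL ℝ (E n) ℂ (EuclideanSpace.proj i))

lemma negCoord_apply (i : Fin n) (z : ℂ) (v : E n) : negCoord i z v = -(v i • z) := by
  simp [negCoord]

/-- Derivatives fall on the test function, so the differential is again built from regularizations
of T; smoothness and the bounds on all orders follow by induction. -/
lemma fderiv_reg (T : 𝓢'(E n, ℂ)) (φ : 𝓢(E n, ℂ)) :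
    fderiv ℝ (reg T φ) = fun x => ∑ i, (negCoord i ∘ reg T (∂_{stdVec i} φ)) x := by
  ext x v
  rw [(hasFDerivAt_reg T φ x).fderiv]
  conv_lhs => rw [← sum_smul_stdVec v]
  simp only [map_sum, map_smul, regDeriv_apply, Function.comp_apply,
    sum_apply, negCoord_apply, smul_neg]

lemma contDiff_reg (T : 𝓢'(E n, ℂ)) (φ : 𝓢(E n, ℂ)) : ContDiff ℝ ∞ (reg T φ) := by
  rw [contDiff_infty]
  intro j
  induction j generalizing φ with
  | zero => exact contDiff_zero.2 (continuous_reg T φ)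
  | succ j ih =>
    rw [Nat.cast_succ, contDiff_succ_iff_fderiv]
    refine ⟨fun x => (hasFDerivAt_reg T φ x).differentiableAt, fun h => ?_, ?_⟩
    · exact absurd h (by simp)
    · rw [fderiv_reg]
      exact ContDiff.sum fun i _ => (negCoord i).contDiff.comp (ih _)

lemma exists_norm_iteratedFDeriv_reg_le (T : 𝓢'(E n, ℂ)) (j : ℕ) :
    ∃ (N : ℕ) (C : ℝ), 0 ≤ C ∧ ∀ φ x,
      ‖iteratedFDeriv ℝ j (reg T φ) x‖ ≤ C * (1 + ‖x‖) ^ N * total N φ := by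
  induction j with
  | zero => simpa only [norm_iteratedFDeriv_zero] using exists_norm_reg_le T
  | succ j ih =>
    obtain ⟨N, C, hC, h⟩ := ih
    refine ⟨N + 1, ∑ i : Fin n, ‖(negCoord i : ℂ →L[ℝ] E n →L[ℝ] ℂ)‖ * C * (N + 1) ^ 2,
      Finset.sum_nonneg fun i _ => by positivity, fun φ x => ?_⟩
    rw [← norm_iteratedFDeriv_fderiv, fderiv_reg]
    have hc : ∀ i : Fin n, ContDiff ℝ ∞ (negCoord i ∘ reg T (∂_{stdVec i} φ)) := fun i =>
      (negCoord i).contDiff.comp (contDiff_reg T _)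
    rw [iteratedFDeriv_fun_sum_apply fun i _ => ((hc i).of_le (mod_cast le_top)).contDiffAt,
      Finset.sum_mul, Finset.sum_mul]
    refine (norm_sum_le _ _).trans (Finset.sum_le_sum fun i _ => ?_)
    calc _ ≤ ‖(negCoord i : ℂ →L[ℝ] E n →L[ℝ] ℂ)‖ *
          ‖iteratedFDeriv ℝ j (reg T (∂_{stdVec i} φ)) x‖ :=
          ContinuousLinearMap.norm_iteratedFDeriv_comp_left _
            (contDiff_reg T _).contDiffAt (mod_cast le_top)
      _ ≤ ‖(negCoord i : ℂ →L[ℝ] E n →L[ℝ] ℂ)‖ * (C * (1 + ‖x‖) ^ (N + 1) *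
          ((N + 1) ^ 2 * (‖(stdVec i : E n)‖ * total (N + 1) φ))) := by
          have := total_nonneg N (∂_{(stdVec i : E n)} φ)
          have hL : 0 ≤ ‖(negCoord i : ℂ →L[ℝ] E n →L[ℝ] ℂ)‖ :=
            ContinuousLinearMap.opNorm_nonneg _
          refine mul_le_mul_of_nonneg_left ((h _ x).trans ?_) hL
          gcongr
          · linarith [norm_nonneg x]
          · lia
          · exact total_lineDeriv_le N φ _
      _ = _ := by rw [norm_stdVec]; ring

end Regularization

/-! ### Tempered distributions commute with integrals of Schwartz functions -/

section Interchange

open LineDeriv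

variable {n : ℕ}

local notation "sn" => SchwartzMap.seminorm ℂ (E := E n) (F := ℂ)

lemma multilinear_apply_eq_sum {l : ℕ} (A : ContinuousMultilinearMap ℝ (fun _ : Fin l => E n) ℂ)
    (v : Fin l → E n) :
    A v = ∑ m : Fin l → Fin n, (∏ a, v a (m a)) • A fun a => stdVec (m a) := by
  classical
  conv_lhs => rw [show v = fun a => ∑ i, v a i • (stdVec i : E n) from
    funext fun a => (sum_smul_stdVec (v a)).symm]
  rw [A.map_sum]
  exact Finset.sum_congr rfl fun m _ => A.map_smul_univ _ _

lemma multilinear_norm_le_sum {l : ℕ} (A : ContinuousMultilinearMap ℝ (fun _ : Fin l => E n) ℂ) :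
    ‖A‖ ≤ ∑ m : Fin l → Fin n, ‖A fun a => stdVec (m a)‖ := by
  refine ContinuousMultilinearMap.opNorm_le_bound
    (Finset.sum_nonneg fun m _ => norm_nonneg _) fun v => ?_
  rw [multilinear_apply_eq_sum, Finset.sum_mul]
  refine (norm_sum_le _ _).trans (Finset.sum_le_sum fun m _ => ?_)
  rw [norm_smul, mul_comm, norm_prod]
  gcongr with a
  exact norm_apply_le _

/-- The bounded continuous function `x ↦ |x|^k φ(x)`. -/
def weighted (k : ℕ) (φ : 𝓢(E n, ℂ)) : BoundedContinuousFunction (E n) ℂ :=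
  BoundedContinuousFunction.ofNormedAddCommGroup (fun x => ((‖x‖ ^ k : ℝ) : ℂ) * φ x)
    ((Complex.continuous_ofReal.comp (continuous_norm.pow k)).mul φ.continuous) (sn k 0 φ)
    (fun x => by
      rw [norm_mul, Complex.norm_real, norm_pow, norm_norm]
      exact φ.norm_pow_mul_le_seminorm ℂ k x)

/-- The Banach space into which the Schwartz space is mapped by its seminorms up to order `N`. -/
abbrev SchwartzBanach (n N : ℕ) : Type :=
  (Fin (N + 1) × (Σ l : Fin (N + 1), (Fin l → Fin n))) → BoundedContinuousFunction (E n) ℂ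

/-- The map of the Schwartz space into `SchwartzBanach n N`. -/
def toBanach (N : ℕ) : 𝓢(E n, ℂ) →ₗ[ℂ] SchwartzBanach n N where
  toFun φ i := weighted i.1 (∂^{fun a => (stdVec (i.2.2 a) : E n)} φ)
  map_add' φ ψ := by
    ext1 i
    refine BoundedContinuousFunction.ext fun x => ?_
    rw [iteratedLineDerivOp_add]
    exact mul_add _ _ _
  map_smul' c φ := by
    ext1 i
    refine BoundedContinuousFunction.ext fun x => ?_
    rw [iteratedLineDerivOp_smul]
    exact mul_left_comm _ _ _

lemma toBanach_apply (N : ℕ) (φ : 𝓢(E n, ℂ))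
    (i : Fin (N + 1) × (Σ l : Fin (N + 1), (Fin l → Fin n))) (x : E n) :
    toBanach N φ i x =
      ((‖x‖ ^ (i.1 : ℕ) : ℝ) : ℂ) * (∂^{fun a => (stdVec (i.2.2 a) : E n)} φ : 𝓢(E n, ℂ)) x :=
  rfl

lemma norm_iteratedLineDeriv_le {l : ℕ} (m : Fin l → Fin n) (φ : 𝓢(E n, ℂ)) (x : E n) :
    ‖(∂^{fun a => (stdVec (m a) : E n)} φ : 𝓢(E n, ℂ)) x‖ ≤ ‖iteratedFDeriv ℝ l φ x‖ := by
  rw [SchwartzMap.iteratedLineDerivOp_eq_iteratedFDeriv]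
  refine (ContinuousMultilinearMap.le_opNorm _ _).trans (le_of_eq ?_)
  simp [norm_stdVec]

lemma norm_toBanach_le (N : ℕ) (φ : 𝓢(E n, ℂ)) : ‖toBanach N φ‖ ≤ total N φ := by
  refine (pi_norm_le_iff_of_nonneg (total_nonneg N φ)).2 fun i => ?_
  refine (BoundedContinuousFunction.norm_le (total_nonneg N φ)).2 fun x => ?_
  rw [toBanach_apply, norm_mul, Complex.norm_real, norm_pow, norm_norm]
  calc _ ≤ ‖x‖ ^ (i.1 : ℕ) * ‖iteratedFDeriv ℝ i.2.1 φ x‖ := by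
        gcongr; exact norm_iteratedLineDeriv_le _ _ _
    _ ≤ sn i.1 i.2.1 φ := φ.le_seminorm ℂ _ _ x
    _ ≤ _ := seminorm_le_total (by lia) (by lia) φ

/-- The partial derivatives along basis vectors control a whole differential. With this bound a
distribution of order N is continuous for the norm induced by the Banach space. -/
lemma total_le_norm_toBanach (N : ℕ) (φ : 𝓢(E n, ℂ)) :
    total N φ ≤ (N + 1) ^ 2 * (((n : ℝ) + 1) ^ N * ‖toBanach N φ‖) := by
  refine total_le fun k hk l hl => SchwartzMap.seminorm_le_bound ℂ k l _ (by positivity) fun x => ?_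
  have h1 : ∀ m : Fin l → Fin n, ‖x‖ ^ k *
      ‖iteratedFDeriv ℝ l φ x fun a => stdVec (m a)‖ ≤ ‖toBanach N φ‖ := fun m => by
    have h2 := (BoundedContinuousFunction.norm_coe_le_norm _ x).trans
      (norm_le_pi_norm (toBanach N φ) (⟨k, by lia⟩, ⟨⟨l, by lia⟩, m⟩))
    rw [toBanach_apply, norm_mul, Complex.norm_real, norm_pow, norm_norm,
      SchwartzMap.iteratedLineDerivOp_eq_iteratedFDeriv] at h2
    exact h2
  calc ‖x‖ ^ k * ‖iteratedFDeriv ℝ l φ x‖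
      ≤ ‖x‖ ^ k * ∑ m : Fin l → Fin n, ‖iteratedFDeriv ℝ l φ x fun a => stdVec (m a)‖ := by
        gcongr; exact multilinear_norm_le_sum _
    _ ≤ ∑ _m : Fin l → Fin n, ‖toBanach N φ‖ := by
        rw [Finset.mul_sum]
        exact Finset.sum_le_sum fun m _ => h1 m
    _ = (n : ℝ) ^ l * ‖toBanach N φ‖ := by simp
    -- The base n + 1 is at least 1, so its powers increase with the exponent even when n = 0.
    _ ≤ ((n : ℝ) + 1) ^ N * ‖toBanach N φ‖ := by
        gcongr
        calc (n : ℝ) ^ l ≤ ((n : ℝ) + 1) ^ l := by gcongr; linarith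
          _ ≤ _ := by gcongr; linarith

lemma toBanach_injective (N : ℕ) : Function.Injective (toBanach (n := n) N) := by
  intro φ ψ h
  ext x
  have h1 := congrArg (fun F : SchwartzBanach n N => F (0, ⟨0, Fin.elim0⟩) x) h
  simpa [toBanach_apply] using h1

/-- Hahn–Banach on the range of `toBanach N`: T becomes a bounded functional on a Banach space,
where Bochner integrals commute with continuous linear maps. -/
lemma exists_extension_toBanach (T : 𝓢'(E n, ℂ)) :
    ∃ (N : ℕ) (g : StrongDual ℂ (SchwartzBanach n N)), ∀ φ, g (toBanach N φ) = T φ := by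
  obtain ⟨N, C, hC, h⟩ := exists_dist_le_total T
  let p : Submodule ℂ (SchwartzBanach n N) := LinearMap.range (toBanach (n := n) N)
  let e : 𝓢(E n, ℂ) ≃ₗ[ℂ] p := LinearEquiv.ofInjective (toBanach (n := n) N) (toBanach_injective N)
  let f : p →ₗ[ℂ] ℂ := (T : 𝓢(E n, ℂ) →L[ℂ] ℂ).toLinearMap ∘ₗ e.symm.toLinearMap
  have hf : ∀ φ, f (e φ) = T φ := fun φ => by
    change T (e.symm (e φ)) = T φ
    rw [e.symm_apply_apply]
  have hb : ∀ x, ‖f x‖ ≤ C * ((N + 1) ^ 2 * ((n : ℝ) + 1) ^ N) * ‖x‖ := by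
    intro x
    obtain ⟨φ, rfl⟩ := e.surjective x
    rw [hf]
    calc ‖T φ‖ ≤ C * total N φ := h φ
      _ ≤ C * ((N + 1) ^ 2 * (((n : ℝ) + 1) ^ N * ‖toBanach N φ‖)) := by
        gcongr; exact total_le_norm_toBanach N φ
      _ = C * ((N + 1) ^ 2 * ((n : ℝ) + 1) ^ N) * ‖toBanach N φ‖ := by ring
      _ = _ := rfl
  obtain ⟨g, hg, -⟩ := exists_extension_norm_eq p (f.mkContinuous _ hb)
  exact ⟨N, g, fun φ => (hg (e φ)).trans (hf φ)⟩

/-- A family of Schwartz functions that is continuous and absolutely integrable for all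
seminorms. -/
structure IntegrableFamily (Φ : E n → 𝓢(E n, ℂ)) : Prop where
  tendsto : ∀ N x, Tendsto (fun y => total N (Φ y - Φ x)) (𝓝 x) (𝓝 0)
  integrable : ∀ N, Integrable fun x => total N (Φ x)

variable {Φ : E n → 𝓢(E n, ℂ)}

lemma norm_apply_le_total (φ : 𝓢(E n, ℂ)) (y : E n) : ‖φ y‖ ≤ total 0 φ :=
  (φ.norm_le_seminorm ℂ y).trans (seminorm_le_total le_rfl le_rfl φ)

lemma IntegrableFamily.continuous_toBanach (h : IntegrableFamily Φ) (N : ℕ) :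
    Continuous fun x => toBanach N (Φ x) := by
  refine continuous_iff_continuousAt.2 fun x => ?_
  refine tendsto_iff_norm_sub_tendsto_zero.2 ?_
  refine squeeze_zero (fun y => norm_nonneg _) (fun y => ?_) (h.tendsto N x)
  rw [← map_sub]
  exact norm_toBanach_le N _

lemma IntegrableFamily.integrable_toBanach (h : IntegrableFamily Φ) (N : ℕ) :
    Integrable fun x => toBanach N (Φ x) :=
  -- The Banach space of bounded functions is not assumed separable; strong measurability of a
  -- continuous map comes from second countability of the source.
  haveI : SecondCountableTopologyEither (E n) (SchwartzBanach n N) :=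
    secondCountableTopologyEither_of_left _ _
  (h.integrable N).mono' (h.continuous_toBanach N).aestronglyMeasurable
    (Eventually.of_forall fun _ => norm_toBanach_le N _)

lemma IntegrableFamily.continuous_apply (h : IntegrableFamily Φ) (y : E n) :
    Continuous fun x => Φ x y := by
  refine continuous_iff_continuousAt.2 fun x => ?_
  refine tendsto_iff_norm_sub_tendsto_zero.2 ?_
  exact squeeze_zero (fun z => norm_nonneg _)
    (fun z => norm_apply_le_total (Φ z - Φ x) y) (h.tendsto 0 x)

lemma IntegrableFamily.integrable_apply (h : IntegrableFamily Φ) (y : E n) :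
    Integrable fun x => Φ x y :=
  (h.integrable 0).mono' (h.continuous_apply y).aestronglyMeasurable
    (Eventually.of_forall fun _ => norm_apply_le_total _ y)

lemma continuous_total_comp (h : ∀ N x, Tendsto (fun y => total N (Φ y - Φ x)) (𝓝 x) (𝓝 0))
    (N : ℕ) : Continuous fun x => total N (Φ x) := by
  refine continuous_finsetSum _ fun i hi => continuous_iff_continuousAt.2 fun x => ?_
  refine tendsto_iff_norm_sub_tendsto_zero.2 ?_
  refine squeeze_zero (fun y => norm_nonneg _) (fun y => ?_) (h N x)
  rw [Finset.mem_product, Finset.mem_range, Finset.mem_range] at hi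
  exact (abs_sub_map_le_sub (sn i.1 i.2) _ _).trans (seminorm_le_total (by lia) (by lia) _)

lemma IntegrableFamily.lineDeriv (h : IntegrableFamily Φ) (v : E n) :
    IntegrableFamily fun x => (∂_{v} (Φ x) : 𝓢(E n, ℂ)) := by
  have ht : ∀ N x, Tendsto (fun y => total N ((∂_{v} (Φ y) : 𝓢(E n, ℂ)) - ∂_{v} (Φ x)))
      (𝓝 x) (𝓝 0) := fun N x => by
    have h1 := (h.tendsto (N + 1) x).const_mul (((N : ℝ) + 1) ^ 2 * ‖v‖)
    rw [mul_zero] at h1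
    refine squeeze_zero (fun y => total_nonneg _ _) (fun y => ?_) h1
    rw [mul_assoc, ← lineDerivOpCLM_apply (R := ℂ), ← lineDerivOpCLM_apply (R := ℂ), ← map_sub]
    exact total_lineDeriv_le N _ v
  refine ⟨ht, fun N => ?_⟩
  refine ((h.integrable (N + 1)).const_mul (((N : ℝ) + 1) ^ 2 * ‖v‖)).mono'
    (continuous_total_comp ht N).aestronglyMeasurable (Eventually.of_forall fun x => ?_)
  rw [Real.norm_of_nonneg (total_nonneg _ _), mul_assoc]
  exact total_lineDeriv_le N _ v

/-- Differentiation under the integral sign; the supremum bound of ∂_v Φ_x is an integrable majorant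
independent of the evaluation point. -/
lemma lineDeriv_integral (h : IntegrableFamily Φ) {Ξ : 𝓢(E n, ℂ)} (hΞ : ∀ y, Ξ y = ∫ x, Φ x y)
    (v y : E n) : (∂_{v} Ξ : 𝓢(E n, ℂ)) y = ∫ x, (∂_{v} (Φ x) : 𝓢(E n, ℂ)) y := by
  have h3 : ∀ x (t : ℝ), HasDerivAt (fun t : ℝ => Φ x (y + t • v))
      ((∂_{v} (Φ x) : 𝓢(E n, ℂ)) (y + t • v)) t := fun x t => by
    have h4 : HasDerivAt (fun t : ℝ => y + t • v) v t := by
      simpa using ((hasDerivAt_id t).smul_const v).const_add y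
    rw [SchwartzMap.lineDerivOp_apply_eq_fderiv]
    exact ((Φ x).hasFDerivAt (y + t • v)).comp_hasDerivAt t h4
  have h1 : HasDerivAt (fun t : ℝ => ∫ x, Φ x (y + t • v))
      (∫ x, (∂_{v} (Φ x) : 𝓢(E n, ℂ)) (y + (0 : ℝ) • v)) 0 :=
    (hasDerivAt_integral_of_dominated_loc_of_deriv_le (s := Set.univ)
      (bound := fun x => total 0 (∂_{v} (Φ x) : 𝓢(E n, ℂ)))
      (F' := fun t x => (∂_{v} (Φ x) : 𝓢(E n, ℂ)) (y + t • v)) Filter.univ_mem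
      (Eventually.of_forall fun t => (h.continuous_apply _).aestronglyMeasurable)
      (h.integrable_apply _) ((h.lineDeriv v).continuous_apply _).aestronglyMeasurable
      (Eventually.of_forall fun x t _ => norm_apply_le_total _ _) ((h.lineDeriv v).integrable 0)
      (Eventually.of_forall fun x t _ => h3 x t)).2
  rw [SchwartzMap.lineDerivOp_apply]
  simp only [lineDeriv, hΞ]
  rw [h1.deriv]
  simp

lemma iteratedLineDeriv_integral {l : ℕ} (m : Fin l → E n) (h : IntegrableFamily Φ)
    {Ξ : 𝓢(E n, ℂ)} (hΞ : ∀ y, Ξ y = ∫ x, Φ x y) (y : E n) :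
    (∂^{m} Ξ : 𝓢(E n, ℂ)) y = ∫ x, (∂^{m} (Φ x) : 𝓢(E n, ℂ)) y := by
  induction l generalizing Φ Ξ with
  | zero => simpa using hΞ y
  | succ l ih =>
    simp only [iteratedLineDerivOp_succ_right]
    exact ih _ (h.lineDeriv _) fun z => lineDeriv_integral h hΞ _ z

/-- A tempered distribution commutes with the integral of a family of Schwartz functions. -/
theorem dist_integral (T : 𝓢'(E n, ℂ)) (h : IntegrableFamily Φ) {Ξ : 𝓢(E n, ℂ)}
    (hΞ : ∀ y, Ξ y = ∫ x, Φ x y) : T Ξ = ∫ x, T (Φ x) := by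
  obtain ⟨N, g, hg⟩ := exists_extension_toBanach T
  -- Equality with the Bochner integral is tested on coordinates and point evaluations, which are
  -- continuous functionals; there it is differentiation under the integral.
  have h1 : toBanach N Ξ = ∫ x, toBanach N (Φ x) := by
    ext1 i
    refine BoundedContinuousFunction.ext fun y => ?_
    let L : SchwartzBanach n N →L[ℂ] ℂ :=
      (BoundedContinuousFunction.evalCLM ℂ y).comp (ContinuousLinearMap.proj i)
    have h2 := L.integral_comp_comm (h.integrable_toBanach N)
    change _ = L (∫ x, toBanach N (Φ x))
    rw [← h2]
    change _ = ∫ x, ((‖y‖ ^ (i.1 : ℕ) : ℝ) : ℂ) *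
      (∂^{fun a => (stdVec (i.2.2 a) : E n)} (Φ x) : 𝓢(E n, ℂ)) y
    rw [integral_const_mul, ← iteratedLineDeriv_integral _ h hΞ]
    rfl
  rw [← hg, h1, ← g.integral_comp_comm (h.integrable_toBanach N)]
  simp only [hg]

end Interchange

/-! ### Pairing a regularization with a Fourier transform -/

section Pairing

variable {n : ℕ}

lemma total_add_le (N : ℕ) (φ ψ : 𝓢(E n, ℂ)) : total N (φ + ψ) ≤ total N φ + total N ψ := by
  rw [total, total, total, ← Finset.sum_add_distrib]
  exact Finset.sum_le_sum fun i _ => map_add_le_add _ _ _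

lemma total_smul (N : ℕ) (c : ℂ) (φ : 𝓢(E n, ℂ)) : total N (c • φ) = ‖c‖ * total N φ := by
  rw [total, total, Finset.mul_sum]
  exact Finset.sum_congr rfl fun i _ => map_smul_eq_mul _ _ _

lemma integrable_one_add_pow_mul (N : ℕ) (φ : 𝓢(E n, ℂ)) :
    Integrable fun x => (1 + ‖x‖) ^ N * ‖φ x‖ := by
  have h1 := (φ.integrable.norm (μ := volume)).add (φ.integrable_pow_mul volume N)
  refine (h1.const_mul (2 ^ N)).mono' (Continuous.aestronglyMeasurable (by fun_prop))
    (Eventually.of_forall fun x => ?_)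
  rw [Real.norm_of_nonneg (by positivity), Pi.add_apply]
  calc (1 + ‖x‖) ^ N * ‖φ x‖ ≤ (2 ^ N * (1 + ‖x‖ ^ N)) * ‖φ x‖ := by
        gcongr
        have h3 := add_pow_le zero_le_one (norm_nonneg x) N
        rw [one_pow] at h3
        refine h3.trans ?_
        gcongr
        · norm_num
        · lia
    _ = _ := by ring

/-- Seminorms of the translates of P grow only polynomially, which the decay of G compensates. -/
lemma integrableFamily_smul_trans (G P : 𝓢(E n, ℂ)) :
    IntegrableFamily fun x => G x • trans x P := by
  have ht : ∀ N x, Tendsto (fun y => total N (G y • trans y P - G x • trans x P))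
      (𝓝 x) (𝓝 0) := fun N x => by
    have hb : Tendsto (fun y => ‖G y - G x‖ *
        ((N + 1) ^ 2 * 2 ^ (N + 1) * (1 + ‖y‖) ^ N * total N P) +
        ‖G x‖ * ((N + 1) ^ 2 * 2 ^ (N + 1) * (1 + ‖x‖) ^ N *
        ((N + 1) ^ 2 * 2 ^ (N + 1) * ‖y - x‖ * (1 + ‖y - x‖) ^ N * total (N + 1) P)))
        (𝓝 x) (𝓝 0) := by
      refine Continuous.tendsto' ?_ x 0 (by simp)
      have := G.continuous
      fun_prop
    refine squeeze_zero (fun y => total_nonneg _ _) (fun y => ?_) hb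
    have e : G y • trans y P - G x • trans x P =
        (G y - G x) • trans y P + G x • trans x (trans (y - x) P - P) := by
      rw [map_sub, trans_trans, add_sub_cancel, sub_smul, smul_sub]
      abel
    rw [e]
    refine (total_add_le N _ _).trans ?_
    rw [total_smul, total_smul]
    gcongr
    · exact total_trans_le N P y
    · refine (total_trans_le N _ x).trans ?_
      gcongr
      exact total_trans_sub_le N P (y - x)
  refine ⟨ht, fun N => ?_⟩
  refine ((integrable_one_add_pow_mul N G).const_mul
    ((N + 1) ^ 2 * 2 ^ (N + 1) * total N P)).mono'
    (continuous_total_comp ht N).aestronglyMeasurable (Eventually.of_forall fun x => ?_)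
  rw [Real.norm_of_nonneg (total_nonneg _ _), total_smul]
  calc ‖G x‖ * total N (trans x P)
      ≤ ‖G x‖ * ((N + 1) ^ 2 * 2 ^ (N + 1) * (1 + ‖x‖) ^ N * total N P) := by
        gcongr; exact total_trans_le N P x
    _ = _ := by ring

/-- The character `e^{-i x·w}`. -/
def wave (w x : E n) : ℂ := Complex.exp (-Complex.I * (inner ℝ x w : ℝ))

lemma norm_wave (w x : E n) : ‖wave w x‖ = 1 := by
  rw [wave, show -Complex.I * ((inner ℝ x w : ℝ) : ℂ) = ((-inner ℝ x w : ℝ) : ℂ) * Complex.I by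
    push_cast; ring]
  exact Complex.norm_exp_ofReal_mul_I _

lemma wave_comm (w x : E n) : wave w x = wave x w := by
  rw [wave, wave, real_inner_comm]

lemma wave_add (w v x : E n) : wave (w + v) x = wave w x * wave v x := by
  rw [wave, wave, wave, ← Complex.exp_add, inner_add_right]
  congr 1
  push_cast
  ring

lemma continuous_wave_prod : Continuous fun p : E n × E n => wave p.1 p.2 := by
  unfold wave
  fun_prop

lemma continuous_wave (w : E n) : Continuous (wave w) := by
  unfold wave
  fun_prop

lemma schwartzFT_apply' (φ : 𝓢(E n, ℂ)) (w : E n) : schwartzFT n φ w = ∫ x, φ x * wave w x :=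
  schwartzFT_apply φ w

/-- The product of Schwartz functions. -/
def schwartzMul (φ ψ : 𝓢(E n, ℂ)) : 𝓢(E n, ℂ) :=
  SchwartzMap.pairing (ContinuousLinearMap.mul ℂ ℂ) φ ψ

@[simp] lemma schwartzMul_apply (φ ψ : 𝓢(E n, ℂ)) (x : E n) :
    schwartzMul φ ψ x = φ x * ψ x := rfl

/-- Exchange of the order of integration for the Fourier kernel. -/
lemma integral_integral_wave_swap {μ ν : Measure (E n)} [SFinite μ] [SFinite ν] {f g : E n → ℂ}
    (hf : Integrable f μ) (hg : Integrable g ν) :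
    ∫ x, f x * ∫ y, g y * wave x y ∂ν ∂μ = ∫ y, g y * ∫ x, f x * wave x y ∂μ ∂ν := by
  have h1 : Integrable (fun p : E n × E n => f p.1 * g p.2 * wave p.1 p.2) (μ.prod ν) :=
    (hf.mul_prod hg).mul_bdd (c := 1) continuous_wave_prod.aestronglyMeasurable
      (Eventually.of_forall fun p => (norm_wave _ _).le)
  have h2 := integral_integral_swap (f := fun x y => f x * g y * wave x y) h1
  calc _ = ∫ x, ∫ y, f x * g y * wave x y ∂ν ∂μ := by
        simp only [mul_assoc, integral_const_mul]
    _ = _ := h2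
    _ = _ := by
        simp only [mul_comm (f _) (g _), mul_assoc, integral_const_mul]

/-- Expanding P̂ and exchanging integrals gives the convolution of ĝ with the reflection of P, which
is P by evenness. Fourier inversion is not used, so no factor (2π)^n appears. -/
lemma schwartzFT_schwartzMul_apply {P : 𝓢(E n, ℂ)} (hP : ∀ x, P (-x) = P x) (g : 𝓢(E n, ℂ))
    (y : E n) : schwartzFT n (schwartzMul g (schwartzFT n P)) y =
      ∫ x, schwartzFT n g x * P (y - x) := by
  have hg : Integrable fun x => g x * wave y x :=
    g.integrable.mul_bdd (c := 1) (continuous_wave y).aestronglyMeasurable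
      (Eventually.of_forall fun p => (norm_wave _ _).le)
  have h1 := integral_integral_wave_swap hg (P.integrable (μ := volume))
  have h2 : ∀ u, ∫ x, g x * wave y x * wave x u = schwartzFT n g (u + y) := fun u => by
    rw [schwartzFT_apply']
    refine integral_congr_ae (Eventually.of_forall fun x => ?_)
    change g x * wave y x * wave x u = g x * wave (u + y) x
    rw [wave_add, wave_comm x u]
    ring
  simp only [h2] at h1
  rw [schwartzFT_apply']
  calc _ = ∫ x, g x * wave y x * ∫ u, P u * wave x u := by
        refine integral_congr_ae (Eventually.of_forall fun x => ?_)
        change schwartzMul g (schwartzFT n P) x * wave y x = _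
        rw [schwartzMul_apply, schwartzFT_apply']
        ring
    _ = ∫ u, P u * schwartzFT n g (u + y) := h1
    _ = ∫ x, P (x - y) * schwartzFT n g x := by
        rw [← integral_sub_right_eq_self (fun u => P u * schwartzFT n g (u + y)) y]
        simp
    _ = _ := by
        refine integral_congr_ae (Eventually.of_forall fun x => ?_)
        change P (x - y) * _ = _ * P (y - x)
        rw [← hP (x - y), neg_sub, mul_comm]

/-- `∫ (T * P) ĝ = ⟨T, (g P̂)^⟩` for even `P`. -/
theorem integral_reg_mul_schwartzFT (T : 𝓢'(E n, ℂ)) {P : 𝓢(E n, ℂ)} (hP : ∀ x, P (-x) = P x)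
    (g : 𝓢(E n, ℂ)) :
    ∫ x, reg T P x * schwartzFT n g x =
      T (schwartzFT n (schwartzMul g (schwartzFT n P))) := by
  -- The transform of g P̂ is the integral of the Schwartz functions ĝ(x) P(· - x), and T applied to
  -- each is ĝ(x) (T * P)(x).
  rw [dist_integral T (integrableFamily_smul_trans (schwartzFT n g) P) fun y => ?_]
  · refine integral_congr_ae (Eventually.of_forall fun x => ?_)
    change T (trans x P) * _ = T (_ • _)
    rw [map_smul, smul_eq_mul, mul_comm]
  · rw [schwartzFT_schwartzMul_apply hP]
    rfl

end Pairing

/-! ### The Fourier transform of a mollifier near the origin -/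

section Mollifier

variable {n : ℕ}

/-- An even function with integral `1` that is supported in the ball of radius `β`. -/
structure IsMollifier (P : 𝓢(E n, ℂ)) (β : ℝ) : Prop where
  even : ∀ x, P (-x) = P x
  zero_of_le : ∀ x, β ≤ ‖x‖ → P x = 0
  integral_eq_one : ∫ x, P x = 1
  integral_norm_le : ∫ x, ‖P x‖ ≤ 2

/-- All moments of order between `1` and `J` vanish. -/
def VanishingMoments (P : 𝓢(E n, ℂ)) (J : ℕ) : Prop :=
  ∀ α : Fin n → ℕ, 1 ≤ ∑ i, α i → ∑ i, α i ≤ J → ∫ x : E n, ((∏ i, x i ^ α i : ℝ) : ℂ) * P x = 0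

lemma iteratedFDeriv_schwartzFT_apply (φ : 𝓢(E n, ℂ)) (l : ℕ) (ξ : E n) (v : Fin l → E n) :
    iteratedFDeriv ℝ l (schwartzFT n φ) ξ v =
      (-Complex.I) ^ l * ∫ x, ((∏ a, inner ℝ x (v a) : ℝ) : ℂ) * φ x * wave ξ x := by
  have hi : ∀ k : ℕ, Integrable fun x => ‖x‖ ^ k * ‖φ x‖ := fun k => φ.integrable_pow_mul volume k
  have h0 : ∀ w, schwartzFT n φ w = 𝓕 (φ : E n → ℂ) (((2 * Real.pi)⁻¹ : ℝ) • w) := fun w => by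
    rw [← SchwartzMap.fourier_coe]
    rfl
  have h1 : (schwartzFT n φ : E n → ℂ) = fun w => 𝓕 (φ : E n → ℂ) (((2 * Real.pi)⁻¹ : ℝ) • w) :=
    funext h0
  have hsm : ContDiff ℝ l (𝓕 (φ : E n → ℂ)) := by
    rw [← SchwartzMap.fourier_coe]
    exact (𝓕 φ).smooth _
  have hint : Integrable (fun x => VectorFourier.fourierPowSMulRight (innerSL ℝ) φ x l) :=
    VectorFourier.integrable_fourierPowSMulRight _ (hi l) φ.continuous.aestronglyMeasurable
  rw [h1, iteratedFDeriv_comp_const_smul _ hsm]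
  simp only
  rw [smul_apply,
    Real.iteratedFDeriv_fourier (N := ⊤) (fun k _ => hi k) φ.continuous.aestronglyMeasurable
    (by exact_mod_cast le_top), Real.fourier_continuousMultilinearMap_apply hint,
    Real.fourier_eq', ← integral_smul, ← integral_const_mul]
  refine integral_congr_ae (Eventually.of_forall fun x => ?_)
  simp only [VectorFourier.fourierPowSMulRight_apply, smul_eq_mul,
    inner_smul_right, Complex.real_smul, wave]
  have hp : (Real.pi : ℝ) ≠ 0 := Real.pi_ne_zero
  have hpc : (Real.pi : ℂ) ≠ 0 := by exact_mod_cast hp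
  have e : -2 * Real.pi * ((2 * Real.pi)⁻¹ * inner ℝ x ξ) = -inner ℝ x ξ := by field_simp
  -- The l-th power of the dilation factor cancels the powers of 2π from the normalization with
  -- e^{-2πi x·w}.
  have e2 : (((2 * Real.pi)⁻¹ ^ l : ℝ) : ℂ) * (-(2 * (Real.pi : ℂ) * Complex.I)) ^ l =
      (-Complex.I) ^ l := by
    push_cast
    rw [← mul_pow]
    congr 1
    field_simp
  rw [e, ← e2]
  have e3 : (((-inner ℝ x ξ : ℝ) : ℂ)) * Complex.I = -Complex.I * (inner ℝ x ξ : ℝ) := by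
    push_cast
    ring
  rw [e3]
  have e4 : ∀ i, innerSL ℝ x (v i) = inner ℝ x (v i) := fun _ => rfl
  simp only [e4]
  push_cast
  ring

variable {P : 𝓢(E n, ℂ)} {β : ℝ}

lemma IsMollifier.hasCompactSupport (h : IsMollifier P β) : HasCompactSupport P :=
  HasCompactSupport.intro (isCompact_closedBall (0 : E n) β) fun x hx => by
    refine h.zero_of_le x ?_
    simpa using (not_le.1 (fun hh => hx (mem_closedBall_zero_iff.2 hh))).le

lemma IsMollifier.integrable_mul (h : IsMollifier P β) {g : E n → ℂ} (hg : Continuous g) :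
    Integrable fun x => g x * P x :=
  (hg.mul P.continuous).integrable_of_hasCompactSupport h.hasCompactSupport.mul_left

/-- The integral of `g P` is at most twice the supremum of `|g|` on the support of `P`. -/
lemma IsMollifier.norm_integral_mul_le (h : IsMollifier P β) {g : E n → ℂ} {C : ℝ}
    (hC : ∀ x, ‖x‖ ≤ β → ‖g x‖ ≤ C) (hC0 : 0 ≤ C) : ‖∫ x, g x * P x‖ ≤ C * 2 := by
  calc ‖∫ x, g x * P x‖ ≤ ∫ x, C * ‖P x‖ := by
        refine norm_integral_le_of_norm_le (P.integrable.norm.const_mul C)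
          (Eventually.of_forall fun x => ?_)
        rw [norm_mul]
        rcases le_total ‖x‖ β with hx | hx
        · gcongr; exact hC x hx
        · rw [h.zero_of_le x hx]; simp
    _ = C * ∫ x, ‖P x‖ := integral_const_mul _ _
    _ ≤ C * 2 := by gcongr; exact h.integral_norm_le

/-- A product of coordinates indexed by ι is a monomial whose exponents count the fibres of k; their
sum is the cardinality of ι. -/
lemma VanishingMoments.integral_prod {J : ℕ} (hm : VanishingMoments P J) {ι : Type*} [Fintype ι]
    (h1 : 1 ≤ Fintype.card ι) (hJ : Fintype.card ι ≤ J) (k : ι → Fin n) :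
    ∫ x : E n, ((∏ a, x (k a) : ℝ) : ℂ) * P x = 0 := by
  classical
  have e : ∀ x : E n, ∏ a, x (k a) = ∏ i, x i ^ (Finset.univ.filter fun a => k a = i).card := by
    intro x
    rw [← Finset.prod_fiberwise Finset.univ k]
    refine Finset.prod_congr rfl fun i _ => ?_
    rw [← Finset.prod_const]
    exact Finset.prod_congr rfl fun a ha => by rw [(Finset.mem_filter.1 ha).2]
  have hs : ∑ i, (Finset.univ.filter fun a => k a = i).card = Fintype.card ι := by
    rw [← Finset.card_eq_sum_card_fiberwise (f := k) (s := Finset.univ) (t := Finset.univ)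
      (fun a _ => Finset.mem_coe.2 (Finset.mem_univ _))]
    rfl
  simp only [e]
  exact hm _ (by rw [hs]; exact h1) (by rw [hs]; exact hJ)

lemma VanishingMoments.integral_prod_inner {J : ℕ} (hm : VanishingMoments P J)
    (h : IsMollifier P β) {ι : Type*} [Fintype ι] (h1 : 1 ≤ Fintype.card ι)
    (hJ : Fintype.card ι ≤ J) (u : ι → E n) :
    ∫ x : E n, ((∏ a, inner ℝ x (u a) : ℝ) : ℂ) * P x = 0 := by
  classical
  have e : ∀ x : E n, ((∏ a, inner ℝ x (u a) : ℝ) : ℂ) * P x =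
      ∑ k : ι → Fin n, ((∏ a, u a (k a) : ℝ) : ℂ) * (((∏ a, x (k a) : ℝ) : ℂ) * P x) := by
    intro x
    have : ∏ a, inner ℝ x (u a) = ∑ k : ι → Fin n, (∏ a, u a (k a)) * ∏ a, x (k a) := by
      simp only [PiLp.inner_apply, RCLike.inner_apply, conj_trivial]
      rw [Finset.prod_univ_sum, Fintype.piFinset_univ]
      simp only [Finset.prod_mul_distrib]
    rw [this, Complex.ofReal_sum, Finset.sum_mul]
    refine Finset.sum_congr rfl fun k _ => ?_
    rw [Complex.ofReal_mul, mul_assoc]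
  simp only [e]
  rw [integral_finsetSum _ fun k _ => (h.integrable_mul (by fun_prop)).const_mul _]
  refine Finset.sum_eq_zero fun k _ => ?_
  rw [integral_const_mul, hm.integral_prod h1 hJ, mul_zero]

lemma VanishingMoments.integral_multilinear {J l : ℕ} (hm : VanishingMoments P J)
    (h : IsMollifier P β) (h1 : 1 ≤ l) (hJ : l ≤ J)
    (A : ContinuousMultilinearMap ℝ (fun _ : Fin l => E n) ℂ) :
    ∫ x : E n, (A fun _ => x) * P x = 0 := by
  have e : ∀ x : E n, (A fun _ => x) * P x = ∑ k : Fin l → Fin n,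
      (A fun a => stdVec (k a)) * (((∏ a, x (k a) : ℝ) : ℂ) * P x) := by
    intro x
    rw [multilinear_apply_eq_sum, Finset.sum_mul]
    refine Finset.sum_congr rfl fun k _ => ?_
    rw [Complex.real_smul]
    ring
  simp only [e]
  rw [integral_finsetSum _ fun k _ => (h.integrable_mul (by fun_prop)).const_mul _]
  refine Finset.sum_eq_zero fun k _ => ?_
  rw [integral_const_mul, hm.integral_prod (by simpa using h1) (by simpa using hJ), mul_zero]

lemma abs_prod_inner_le {l : ℕ} {x : E n} (hx : ‖x‖ ≤ β) (v : Fin l → E n) :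
    ‖((∏ a, inner ℝ x (v a) : ℝ) : ℂ)‖ ≤ β ^ l * ∏ a, ‖v a‖ := by
  rw [Complex.norm_real, norm_prod]
  calc ∏ a, ‖inner ℝ x (v a)‖ ≤ ∏ a, (β * ‖v a‖) := by
        gcongr with a
        exact (norm_inner_le_norm _ _).trans (by gcongr)
    _ = _ := by rw [Finset.prod_mul_distrib]; simp

lemma IsMollifier.norm_iteratedFDeriv_le (h : IsMollifier P β) (hβ : 0 ≤ β) (l : ℕ) (ξ : E n) :
    ‖iteratedFDeriv ℝ l (schwartzFT n P) ξ‖ ≤ β ^ l * 2 := by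
  refine ContinuousMultilinearMap.opNorm_le_bound (by positivity) fun v => ?_
  rw [iteratedFDeriv_schwartzFT_apply, norm_mul, norm_pow, norm_neg, Complex.norm_I, one_pow,
    one_mul]
  have h1 := h.norm_integral_mul_le (g := fun x => ((∏ a, inner ℝ x (v a) : ℝ) : ℂ) * wave ξ x)
    (C := β ^ l * ∏ a, ‖v a‖) (fun x hx => by
      rw [norm_mul, norm_wave, mul_one]
      exact abs_prod_inner_le hx v) (by positivity)
  calc _ = ‖∫ x, ((∏ a, inner ℝ x (v a) : ℝ) : ℂ) * wave ξ x * P x‖ := by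
        congr 2; ext x; ring
    _ ≤ _ := h1
    _ = _ := by ring

/-- Only total mass 1 and |e^{is} - 1| ≤ |s| enter. This first order bound suffices wherever mere
convergence or nonvanishing is wanted. -/
lemma IsMollifier.norm_sub_one_le (h : IsMollifier P β) (hβ : 0 ≤ β) (ξ : E n) :
    ‖schwartzFT n P ξ - 1‖ ≤ ‖ξ‖ * β * 2 := by
  have e : schwartzFT n P ξ - 1 = ∫ x, (wave ξ x - 1) * P x := by
    simp only [sub_mul, one_mul]
    rw [integral_sub (h.integrable_mul (continuous_wave ξ)) P.integrable, h.integral_eq_one,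
      schwartzFT_apply']
    congr 2
    ext x
    ring
  rw [e]
  refine h.norm_integral_mul_le (fun x hx => ?_) (by positivity)
  have h1 := Real.norm_exp_I_mul_ofReal_sub_one_le (x := -inner ℝ x ξ)
  have h2 : wave ξ x = Complex.exp (Complex.I * ((-inner ℝ x ξ : ℝ) : ℂ)) := by
    rw [wave]; congr 1; push_cast; ring
  rw [← h2, norm_neg] at h1
  refine h1.trans ((norm_inner_le_norm _ _).trans ?_)
  rw [mul_comm]
  gcongr

/-- With many vanishing moments, `P̂ - 1` and its derivatives are small on balls of radius much
smaller than `1 / β`. -/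
lemma IsMollifier.norm_iteratedFDeriv_sub_one_le (h : IsMollifier P β) (hβ : 0 ≤ β) {J l N : ℕ}
    (hm : VanishingMoments P J) (hJ : l + N ≤ J) {ξ : E n} (hξ : ‖ξ‖ * β ≤ 1 / 2) :
    ‖iteratedFDeriv ℝ l (fun η => schwartzFT n P η - 1) ξ‖ ≤ β ^ l * (‖ξ‖ * β) ^ (N + 1) * 4 := by
  -- The remainder of the exponential series after degree N; it is of order N + 1 in |ξ|β on the
  -- support of P.
  set R : E n → ℂ := fun x => wave ξ x -
    ∑ j ∈ Finset.range (N + 1), (-Complex.I * (inner ℝ x ξ : ℝ)) ^ j / (j.factorial : ℂ) with hR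
  have hRb : ∀ x, ‖x‖ ≤ β → ‖R x‖ ≤ (‖ξ‖ * β) ^ (N + 1) * 2 := by
    intro x hx
    have h0 : ‖-Complex.I * ((inner ℝ x ξ : ℝ) : ℂ)‖ ≤ ‖ξ‖ * β := by
      rw [norm_mul, norm_neg, Complex.norm_I, one_mul, Complex.norm_real]
      refine (norm_inner_le_norm _ _).trans ?_
      rw [mul_comm]
      gcongr
    have h1 := Complex.exp_bound' (x := -Complex.I * ((inner ℝ x ξ : ℝ) : ℂ)) (n := N + 1) (by
      refine (div_le_self (norm_nonneg _) ?_).trans (h0.trans hξ)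
      push_cast
      linarith [(N.cast_nonneg : (0 : ℝ) ≤ N)])
    refine h1.trans ?_
    gcongr
    refine (div_le_self (by positivity) ?_).trans (by gcongr)
    exact_mod_cast Nat.one_le_iff_ne_zero.2 (Nat.factorial_ne_zero _)
  have key : ∀ v : Fin l → E n, iteratedFDeriv ℝ l (fun η => schwartzFT n P η - 1) ξ v =
      (-Complex.I) ^ l * ∫ x, ((∏ a, inner ℝ x (v a) : ℝ) : ℂ) * R x * P x := by
    intro v
    -- The j-th series term times the l directional factors is a product of l + j inner products,
    -- with the directions v and j copies of ξ; it has order at most l + N ≤ J.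
    have hterm : ∀ j ∈ Finset.range (N + 1), Integrable fun x =>
        ((-Complex.I) ^ j / (j.factorial : ℂ)) *
          (((∏ a : Fin l ⊕ Fin j, inner ℝ x (Sum.elim v (fun _ => ξ) a) : ℝ) : ℂ) * P x) :=
      fun j _ => (h.integrable_mul (by fun_prop)).const_mul _
    have e1 : ∫ x, ((∏ a, inner ℝ x (v a) : ℝ) : ℂ) * R x * P x =
        (∫ x, ((∏ a, inner ℝ x (v a) : ℝ) : ℂ) * P x * wave ξ x) -
        ∑ j ∈ Finset.range (N + 1), ((-Complex.I) ^ j / (j.factorial : ℂ)) *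
          ∫ x, ((∏ a : Fin l ⊕ Fin j, inner ℝ x (Sum.elim v (fun _ => ξ) a) : ℝ) : ℂ) * P x := by
      have hw : Integrable fun x => ((∏ a, inner ℝ x (v a) : ℝ) : ℂ) * P x * wave ξ x :=
        (h.integrable_mul (g := fun x => ((∏ a, inner ℝ x (v a) : ℝ) : ℂ) * wave ξ x)
          (Continuous.mul (by fun_prop) (continuous_wave ξ))).congr
          (Eventually.of_forall fun x => by ring)
      simp only [← integral_const_mul]
      rw [← integral_finsetSum _ hterm, ← integral_sub hw (integrable_finsetSum _ hterm)]
      refine integral_congr_ae (Eventually.of_forall fun x => ?_)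
      simp only [hR, mul_sub, sub_mul, Finset.mul_sum, Finset.sum_mul]
      congr 1
      · ring
      · refine Finset.sum_congr rfl fun j _ => ?_
        rw [Fintype.prod_sum_type]
        simp only [Sum.elim_inl, Sum.elim_inr, Finset.prod_const, Finset.card_univ,
          Fintype.card_fin]
        push_cast
        ring
    -- For l = 0 the term j = 0 survives and is the integral of P, matching the subtracted 1. For l
    -- > 0 every term is a vanishing moment, and the constant 1 has no derivative.
    rcases Nat.eq_zero_or_pos l with rfl | hl
    · have e2 : ∑ j ∈ Finset.range (N + 1), ((-Complex.I) ^ j / (j.factorial : ℂ)) *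
          ∫ x, ((∏ a : Fin 0 ⊕ Fin j, inner ℝ x (Sum.elim v (fun _ => ξ) a) : ℝ) : ℂ) * P x = 1 := by
        rw [Finset.sum_range_succ', Finset.sum_eq_zero fun j hj => ?_]
        · simp [h.integral_eq_one]
        · rw [Finset.mem_range] at hj
          rw [hm.integral_prod_inner h (by simp) (by simp; lia), mul_zero]
      rw [e1, e2, iteratedFDeriv_zero_apply, schwartzFT_apply']
      simp
    · have e2 : ∑ j ∈ Finset.range (N + 1), ((-Complex.I) ^ j / (j.factorial : ℂ)) *
          ∫ x, ((∏ a : Fin l ⊕ Fin j, inner ℝ x (Sum.elim v (fun _ => ξ) a) : ℝ) : ℂ) * P x = 0 :=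
        Finset.sum_eq_zero fun j hj => by
          rw [Finset.mem_range] at hj
          rw [hm.integral_prod_inner h (by simp; lia) (by simp; lia), mul_zero]
      have e3 : iteratedFDeriv ℝ l (fun η => schwartzFT n P η - 1) ξ =
          iteratedFDeriv ℝ l (schwartzFT n P) ξ := by
        have := iteratedFDeriv_sub_apply (𝕜 := ℝ) (i := l) (x := ξ)
          ((schwartzFT n P).contDiffAt _) (contDiffAt_const (c := (1 : ℂ)))
        rw [iteratedFDeriv_const_of_ne (by lia), Pi.zero_apply, sub_zero] at this
        exact this
      rw [e1, e2, sub_zero, e3, iteratedFDeriv_schwartzFT_apply]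
  refine ContinuousMultilinearMap.opNorm_le_bound (by positivity) fun v => ?_
  rw [key, norm_mul, norm_pow, norm_neg, Complex.norm_I, one_pow, one_mul]
  have h1 := h.norm_integral_mul_le (g := fun x => ((∏ a, inner ℝ x (v a) : ℝ) : ℂ) * R x)
    (C := (β ^ l * ∏ a, ‖v a‖) * ((‖ξ‖ * β) ^ (N + 1) * 2)) (fun x hx => by
      rw [norm_mul]
      have := hRb x hx
      have := abs_prod_inner_le hx v
      gcongr) (by positivity)
  refine h1.trans (le_of_eq ?_)
  ring

end Mollifier

/-! ### Nets of mollifiers -/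

section MollifierNets

variable {n : ℕ} {ρ : Gauge} {b : I → ℝ}

lemma moderate_rpow (s : ℝ) : Moderate ρ fun ε => ρ ε ^ s := by
  refine ⟨⌈-s⌉₊, Eventually.of_forall fun ε => ?_⟩
  rw [Real.norm_eq_abs, abs_of_pos (Real.rpow_pos_of_pos (ρ.pos ε) _), ← Real.rpow_natCast,
    ← Real.rpow_neg (ρ.pos ε).le]
  exact Real.rpow_le_rpow_of_exponent_ge (ρ.pos ε) (ρ.le_one ε) (by linarith [Nat.le_ceil (-s)])

lemma isRep_dRho (s : ℝ) : IsRep (fun ε => ρ ε ^ s) (dRho ρ s) := isRep_cls (moderate_rpow s)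

lemma eventually_rpow_le {s : ℝ} (hs : 0 < s) {c : ℝ} (hc : 0 < c) :
    ∀ᶠ ε in atBot, ρ ε ^ s ≤ c := by
  have h := ρ.tendsto.rpow_const (p := s) (Or.inr hs.le)
  rw [Real.zero_rpow hs.ne'] at h
  exact h.eventually (Iic_mem_nhds hc)

/-- A net with a large infinite class is bounded below by some `ρ⁻ˢ`. -/
lemma IsLargeInfinite.exists_rpow_le {x : GenNum ρ ℝ} (h : IsLargeInfinite x) {xs : I → ℝ}
    (hx : IsRep xs x) : ∃ s : ℝ, 0 < s ∧ ∀ᶠ ε in atBot, ρ ε ^ (-s) ≤ |xs ε| := by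
  obtain ⟨s, hs, h⟩ := h
  rw [le_iff (isRep_dRho (-s)) hx.norm] at h
  -- Passing to a given representative costs an additive 1; half of the exponent absorbs it, since
  -- x² - 1 ≥ x for x = ρ^{-s/2} ≥ 2.
  refine ⟨s / 2, by positivity, ?_⟩
  filter_upwards [h 0, eventually_rpow_le (ρ := ρ) (s := s / 2) (by positivity)
    (c := 1 / 2) (by norm_num)] with ε h1 h2
  have hp := Real.rpow_pos_of_pos (ρ.pos ε) (s / 2)
  have e1 : ρ ε ^ (-s) = ρ ε ^ (-(s / 2)) * ρ ε ^ (-(s / 2)) := by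
    rw [← Real.rpow_add (ρ.pos ε)]; congr 1; ring
  have h3 : 2 ≤ ρ ε ^ (-(s / 2)) := by
    rw [Real.rpow_neg (ρ.pos ε).le, le_inv_comm₀ (by norm_num) hp]
    linarith
  rw [e1, pow_zero, Real.norm_eq_abs] at h1
  nlinarith

/-- A net of Schwartz functions all of whose seminorms are moderate. -/
def SModerate (ρ : Gauge) (φ : I → 𝓢(E n, ℂ)) : Prop := ∀ N, Moderate ρ fun ε => total N (φ ε)

lemma moderate_of_nonneg_le {x y : I → ℝ} (hy : Moderate ρ y)
    (h : ∀ᶠ ε in atBot, 0 ≤ x ε ∧ x ε ≤ y ε) : Moderate ρ x :=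
  hy.mono (by
    filter_upwards [h] with ε h
    rw [Real.norm_of_nonneg h.1]
    exact h.2.trans (le_abs_self _))

lemma Moderate.of_norm_le {V : Type*} [NormedAddCommGroup V] {x : I → V} {y : I → ℝ}
    (hy : Moderate ρ y) (h : ∀ᶠ ε in atBot, ‖x ε‖ ≤ y ε) : Moderate ρ x :=
  hy.mono (h.mono fun _ h => h.trans (le_abs_self _))

lemma SModerate.map (L : 𝓢(E n, ℂ) →L[ℂ] 𝓢(E n, ℂ)) {φ : I → 𝓢(E n, ℂ)} (h : SModerate ρ φ) :
    SModerate ρ fun ε => L (φ ε) := fun N => by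
  refine Moderate.sum fun i _ => ?_
  obtain ⟨M, C, -, hM⟩ := exists_le_total
    ((SchwartzMap.seminorm ℂ i.1 i.2 : Seminorm ℂ 𝓢(E n, ℂ)).comp L.toLinearMap)
    (((schwartz_withSeminorms ℂ (E n) ℂ).continuous_seminorm i).comp L.continuous)
  exact moderate_of_nonneg_le ((moderate_const C).fun_mul (h M))
    (Eventually.of_forall fun ε => ⟨apply_nonneg _ _, hM (φ ε)⟩)

lemma SModerate.trans {φ : I → 𝓢(E n, ℂ)} (h : SModerate ρ φ) {xs : I → E n}
    (hx : Moderate ρ xs) : SModerate ρ fun ε => trans (xs ε) (φ ε) := fun N =>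
  moderate_of_nonneg_le (((moderate_const (((N : ℝ) + 1) ^ 2 * 2 ^ (N + 1))).fun_mul
    (((moderate_const 1).fun_add hx.norm).fun_pow N)).fun_mul (h N))
    (Eventually.of_forall fun _ => ⟨total_nonneg _ _, total_trans_le N _ _⟩)

lemma toSchwartz_apply {f : E n → ℂ} (h : HasCompactSupport f) (h' : ContDiff ℝ ∞ f) (x : E n) :
    toSchwartz f x = f x := by
  rw [toSchwartz, dif_pos ⟨h, h'⟩]
  rfl

variable (m : MollifierNet n b)

/-- The rescaled mollifier as a Schwartz function. -/
def MollifierNet.mol (ε : I) : 𝓢(E n, ℂ) := toSchwartz fun y => (m.scaled ε y : ℂ)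

lemma MollifierNet.scaled_neg (ε : I) (x : E n) : m.scaled ε (-x) = m.scaled ε x := by
  rw [scaled, scaled, smul_neg, m.even]

lemma MollifierNet.contDiff_scaled (ε : I) : ContDiff ℝ ∞ fun y => (m.scaled ε y : ℂ) :=
  Complex.ofRealCLM.contDiff.comp
    (contDiff_const.mul ((m.smooth ε).comp (contDiff_const_smul (b ε))))

lemma MollifierNet.scaled_eq_zero {ε : I} (hb : 0 < b ε) {x : E n} (hx : (b ε)⁻¹ ≤ ‖x‖) :
    m.scaled ε x = 0 := by
  rw [scaled, mul_eq_zero]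
  right
  by_contra h
  have h1 := m.supp ε (subset_tsupport _ h)
  rw [mem_ball_zero_iff, norm_smul, Real.norm_of_nonneg hb.le] at h1
  rw [inv_le_iff_one_le_mul₀ hb] at hx
  linarith

lemma MollifierNet.hasCompactSupport_scaled {ε : I} (hb : 0 < b ε) :
    HasCompactSupport fun y => (m.scaled ε y : ℂ) :=
  HasCompactSupport.intro (isCompact_closedBall (0 : E n) (b ε)⁻¹) fun x hx => by
    rw [m.scaled_eq_zero hb, Complex.ofReal_zero]
    rw [mem_closedBall_zero_iff] at hx
    exact (not_le.1 hx).le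

lemma MollifierNet.mol_apply {ε : I} (hb : 0 < b ε) (x : E n) : m.mol ε x = m.scaled ε x :=
  toSchwartz_apply (m.hasCompactSupport_scaled hb) (m.contDiff_scaled ε) x

/-- By evenness the reflected kernel in the convolution is a plain translate, so the embedding of T
is given by `reg T`. -/
lemma MollifierNet.toSchwartz_scaled_sub {ε : I} (hb : 0 < b ε) (x : E n) :
    toSchwartz (fun y => (m.scaled ε (x - y) : ℂ)) = HFT.trans x (m.mol ε) := by
  have h : (fun y => (m.scaled ε (x - y) : ℂ)) = fun y => (m.scaled ε (y - x) : ℂ) := by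
    ext y
    rw [← neg_sub, m.scaled_neg]
  rw [h]
  ext y
  rw [toSchwartz_apply, trans_apply, m.mol_apply hb]
  · exact (m.hasCompactSupport_scaled hb).comp_homeomorph (Homeomorph.subRight x)
  · exact (m.contDiff_scaled ε).comp (contDiff_id.sub contDiff_const)

lemma MollifierNet.integral_smul_comp {ε : I} (hb : 0 < b ε) (f : E n → ℝ) :
    ∫ x, b ε ^ n * f (b ε • x) = ∫ x, f x := by
  rw [integral_const_mul, Measure.integral_comp_smul, finrank_euclideanSpace_fin, smul_eq_mul,
    abs_of_pos (by positivity)]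
  field_simp

lemma MollifierNet.isMollifier (hb : ∀ ε, 0 < b ε) :
    ∀ᶠ ε in atBot, IsMollifier (m.mol ε) (b ε)⁻¹ := by
  filter_upwards [m.abs_integral_le 1 one_pos] with ε h
  refine ⟨fun x => ?_, fun x hx => ?_, ?_, ?_⟩
  · rw [m.mol_apply (hb ε), m.mol_apply (hb ε), m.scaled_neg]
  · rw [m.mol_apply (hb ε), m.scaled_eq_zero (hb ε) hx, Complex.ofReal_zero]
  · simp only [m.mol_apply (hb ε)]
    rw [integral_complex_ofReal]
    simp only [scaled]
    rw [integral_smul_comp (hb ε), m.integral_eq_one, Complex.ofReal_one]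
  · simp only [m.mol_apply (hb ε), Complex.norm_real, scaled, norm_mul, norm_pow,
      Real.norm_of_nonneg (hb ε).le]
    rw [integral_smul_comp (hb ε) fun x => ‖m.ψ ε x‖]
    exact h.trans (by norm_num)

lemma MollifierNet.vanishingMoments (hb : ∀ ε, 0 < b ε) (J : ℕ) :
    ∀ᶠ ε in atBot, VanishingMoments (m.mol ε) J := by
  filter_upwards [m.moments J] with ε h α h1 hJ
  have e : ∀ x : E n, ((∏ i, x i ^ α i : ℝ) : ℂ) * m.mol ε x =
      (((b ε ^ ∑ i, α i)⁻¹ * (b ε ^ n * ((∏ i, (b ε • x) i ^ α i) * m.ψ ε (b ε • x))) : ℝ) : ℂ) := by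
    intro x
    have e1 : ∏ i, (b ε • x) i ^ α i = (b ε ^ ∑ i, α i) * ∏ i, x i ^ α i := by
      simp only [PiLp.smul_apply, smul_eq_mul, mul_pow, Finset.prod_mul_distrib,
        Finset.prod_pow_eq_pow_sum]
    have := (pow_pos (hb ε) (∑ i, α i)).ne'
    rw [m.mol_apply (hb ε), scaled, e1, ← Complex.ofReal_mul]
    congr 1
    field_simp
  simp only [e]
  rw [integral_complex_ofReal, integral_const_mul,
    integral_smul_comp (hb ε) fun x => (∏ i, x i ^ α i) * m.ψ ε x, h α h1 hJ]
  simp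

lemma IsMollifier.iteratedFDeriv_eq_zero {P : 𝓢(E n, ℂ)} {β : ℝ} (h : IsMollifier P β) (l : ℕ)
    {x : E n} (hx : β < ‖x‖) : iteratedFDeriv ℝ l P x = 0 := by
  by_contra hne
  have h1 := support_iteratedFDeriv_subset (𝕜 := ℝ) l hne
  have h2 : tsupport P ⊆ Metric.closedBall 0 β :=
    closure_minimal (fun y hy => by
      rw [mem_closedBall_zero_iff]
      exact (not_le.1 fun hh => hy (h.zero_of_le y hh)).le) Metric.isClosed_closedBall
  have := mem_closedBall_zero_iff.1 (h2 h1)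
  linarith

lemma MollifierNet.norm_iteratedFDeriv_mol {ε : I} (hb : 0 < b ε) (l : ℕ) (x : E n) :
    ‖iteratedFDeriv ℝ l (m.mol ε) x‖ =
      b ε ^ n * (b ε ^ l * ‖iteratedFDeriv ℝ l (m.ψ ε) (b ε • x)‖) := by
  have h : (m.mol ε : E n → ℂ) = Complex.ofRealLI ∘
      fun x => (b ε ^ n) • (fun y => m.ψ ε (b ε • y)) x := by
    ext x
    rw [m.mol_apply hb]
    rfl
  have hs : ContDiff ℝ l fun y => m.ψ ε (b ε • y) :=
    ((m.smooth ε).comp (contDiff_const_smul (b ε))).of_le (by exact_mod_cast le_top)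
  have hs' : ContDiff ℝ l fun x => (b ε ^ n) • (fun y => m.ψ ε (b ε • y)) x :=
    hs.const_smul _
  rw [h, LinearIsometry.norm_iteratedFDeriv_comp_left _ hs'.contDiffAt le_rfl,
    iteratedFDeriv_const_smul_apply' hs.contDiffAt, norm_smul,
    iteratedFDeriv_comp_const_smul _ ((m.smooth ε).of_le (by exact_mod_cast le_top))]
  simp only [norm_smul, norm_pow, Real.norm_of_nonneg hb.le]

/-- Once b ≥ 1 the support lies in the unit ball, so the weights |x|^k cost nothing; the derivatives
cost a power of b, which is moderate. -/
lemma MollifierNet.sModerate_mol (hb : ∀ ε, 0 < b ε) (hmod : Moderate ρ b)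
    (h1 : ∀ᶠ ε in atBot, 1 ≤ b ε) : SModerate ρ m.mol := by
  have key : ∀ l, ∃ y : I → ℝ, Moderate ρ y ∧ ∀ᶠ ε in atBot, ∀ k,
      SchwartzMap.seminorm ℂ k l (m.mol ε) ≤ |y ε| := by
    intro l
    obtain ⟨p, C, hC⟩ := m.deriv_bound l
    refine ⟨fun ε => b ε ^ n * (b ε ^ l * (C * b ε ^ p)), (hmod.fun_pow n).fun_mul
      ((hmod.fun_pow l).fun_mul ((moderate_const C).fun_mul (hmod.fun_pow p))), ?_⟩
    filter_upwards [hC, h1, m.isMollifier hb] with ε hC h1 hM k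
    refine SchwartzMap.seminorm_le_bound ℂ k l _ (abs_nonneg _) fun x => ?_
    have := hb ε
    rcases le_or_gt ‖x‖ (b ε)⁻¹ with hx | hx
    · have hx1 : ‖x‖ ^ k ≤ 1 := pow_le_one₀ (norm_nonneg _) (hx.trans (inv_le_one_of_one_le₀ h1))
      refine le_trans ?_ (le_abs_self _)
      refine (mul_le_of_le_one_left (norm_nonneg _) hx1).trans ?_
      rw [m.norm_iteratedFDeriv_mol this]
      gcongr
      exact hC _
    · rw [hM.iteratedFDeriv_eq_zero l hx, norm_zero, mul_zero]
      exact abs_nonneg _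
  choose y hy hk using key
  intro N
  refine moderate_of_nonneg_le (Moderate.sum (s := Finset.range (N + 1) ×ˢ Finset.range (N + 1))
    (x := fun i ε => ‖y i.2 ε‖) fun i _ => (hy i.2).norm) ?_
  filter_upwards [(Finset.eventually_all (Finset.range (N + 1) ×ˢ Finset.range (N + 1))).2
    fun i _ => hk i.2] with ε h
  exact ⟨total_nonneg _ _, Finset.sum_le_sum fun i hi => h i hi i.1⟩

end MollifierNets

/-! ### Multiplication by the Fourier transform of a mollifier -/

section Multiplier

variable {n : ℕ} {ρ : Gauge} {b : I → ℝ}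

/-- Leibniz's rule for g(Q - 1). At each point either g vanishes to order N or Q - 1 is small; the
permitted growth 1 + |ξ| is paid for by one more weight on g, whence N + 1. -/
lemma total_schwartzMul_sub_le (N : ℕ) (g Q : 𝓢(E n, ℂ)) {A : ℝ} (hA : 0 ≤ A)
    (h : ∀ ξ, (∀ l ≤ N, iteratedFDeriv ℝ l g ξ = 0) ∨
      ∀ l ≤ N, ‖iteratedFDeriv ℝ l (fun η => Q η - 1) ξ‖ ≤ A * (1 + ‖ξ‖)) :
    total N (schwartzMul g Q - g) ≤ (N + 1) ^ 2 * (2 ^ (N + 1) * A * total (N + 1) g) := by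
  have ht := total_nonneg (N + 1) g
  refine total_le fun k hk l hl => SchwartzMap.seminorm_le_bound ℂ k l _ (by positivity) fun x => ?_
  have e : ((schwartzMul g Q - g : 𝓢(E n, ℂ)) : E n → ℂ) = fun y => g y * (Q y - 1) := by
    ext y
    simp [mul_sub]
  have hQ : ContDiff ℝ ∞ fun η => Q η - 1 := (Q.smooth ⊤).sub contDiff_const
  have h1 := norm_iteratedFDeriv_mul_le (g.smooth ⊤) hQ x (n := l) (by exact_mod_cast le_top)
  rw [e]
  have h2 : ∀ i ∈ Finset.range (l + 1), ‖x‖ ^ k * ((l.choose i : ℝ) * ‖iteratedFDeriv ℝ i g x‖ *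
      ‖iteratedFDeriv ℝ (l - i) (fun η => Q η - 1) x‖) ≤
      l.choose i * (A * (2 * total (N + 1) g)) := by
    intro i hi
    rw [Finset.mem_range] at hi
    rcases h x with h | h
    · rw [h i (by lia), norm_zero, mul_zero, zero_mul, mul_zero]
      positivity
    · have a1 := (SchwartzMap.le_seminorm ℂ k i g x).trans
        (seminorm_le_total (N := N + 1) (by lia) (by lia) g)
      have a2 := (SchwartzMap.le_seminorm ℂ (k + 1) i g x).trans
        (seminorm_le_total (N := N + 1) (by lia) (by lia) g)
      have a3 := h (l - i) (by lia)
      calc _ = (l.choose i : ℝ) * (‖x‖ ^ k * ‖iteratedFDeriv ℝ i g x‖ *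
            ‖iteratedFDeriv ℝ (l - i) (fun η => Q η - 1) x‖) := by ring
        _ ≤ (l.choose i : ℝ) * (‖x‖ ^ k * ‖iteratedFDeriv ℝ i g x‖ * (A * (1 + ‖x‖))) := by gcongr
        _ = (l.choose i : ℝ) * (A * (‖x‖ ^ k * ‖iteratedFDeriv ℝ i g x‖ +
            ‖x‖ ^ (k + 1) * ‖iteratedFDeriv ℝ i g x‖)) := by ring
        _ ≤ _ := by gcongr; linarith
  calc _ ≤ ‖x‖ ^ k * ∑ i ∈ Finset.range (l + 1), (l.choose i : ℝ) * ‖iteratedFDeriv ℝ i g x‖ *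
      ‖iteratedFDeriv ℝ (l - i) (fun η => Q η - 1) x‖ := by gcongr
    _ ≤ ∑ i ∈ Finset.range (l + 1), l.choose i * (A * (2 * total (N + 1) g)) := by
      rw [Finset.mul_sum]
      exact Finset.sum_le_sum h2
    _ = 2 ^ l * (A * (2 * total (N + 1) g)) := by
      rw [← Finset.sum_mul]
      congr 1
      exact_mod_cast Nat.sum_range_choose l
    _ ≤ 2 ^ N * (A * (2 * total (N + 1) g)) := by gcongr; norm_num
    _ = _ := by ring

/-- On test functions near points of norm much smaller than `b`, multiplication by the Fourier
transform of the mollifier is the identity up to negligible errors. -/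
lemma negligible_total_schwartzMul_sub {P : I → 𝓢(E n, ℂ)} (hb : ∀ ε, 0 < b ε)
    (hP : ∀ᶠ ε in atBot, IsMollifier (P ε) (b ε)⁻¹)
    (hm : ∀ J, ∀ᶠ ε in atBot, VanishingMoments (P ε) J) (hPm : SModerate ρ P)
    {s : ℝ} (hs : 0 < s) (hbs : ∀ᶠ ε in atBot, ρ ε ^ (-s) ≤ b ε) {ws : I → E n}
    (hws : Moderate ρ ws) (hw : ∀ᶠ ε in atBot, ‖ws ε‖ * (b ε)⁻¹ ≤ ρ ε ^ s) (N : ℕ) :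
    Negligible ρ fun ε => total N
      (schwartzMul (trans (ws ε) (P ε)) (schwartzFT n (P ε)) - trans (ws ε) (P ε)) := by
  refine negligible_of_le_mul (((moderate_const (((N : ℝ) + 1) ^ 2 * (2 ^ (N + 1) * 4))).fun_mul
    (hPm.trans hws (N + 1)))) fun m => ?_
  -- So that (ρ^{s/2})^{J+1} ≤ ρ^m; half of s is spent on constants. Moments up to N + J leave J + 1
  -- powers after N derivatives.
  obtain ⟨J, hJ⟩ := exists_nat_ge ((m : ℝ) / (s / 2))
  filter_upwards [hP, hm (N + J), hbs, hw, eventually_rpow_le (ρ := ρ) (s := s / 2) (by positivity)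
    (c := 1 / 2) (by norm_num)] with ε hP hm hbs hw h2
  have hb0 := hb ε
  have hβ : 0 ≤ (b ε)⁻¹ := by positivity
  have hp := Real.rpow_pos_of_pos (ρ.pos ε) (s / 2)
  have e1 : ρ ε ^ s = ρ ε ^ (s / 2) * ρ ε ^ (s / 2) := by
    rw [← Real.rpow_add (ρ.pos ε)]; congr 1; ring
  have hβs : (b ε)⁻¹ ≤ ρ ε ^ s := by
    rw [Real.rpow_neg (ρ.pos ε).le] at hbs
    exact inv_le_of_inv_le₀ (Real.rpow_pos_of_pos (ρ.pos ε) _) hbs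
  have hβ1 : (b ε)⁻¹ ≤ 1 := hβs.trans (Real.rpow_le_one (ρ.pos ε).le (ρ.le_one ε) hs.le)
  have hJm : (ρ ε ^ (s / 2)) ^ (J + 1) ≤ ρ ε ^ m := by
    rw [← Real.rpow_natCast, ← Real.rpow_natCast, ← Real.rpow_mul (ρ.pos ε).le]
    refine Real.rpow_le_rpow_of_exponent_ge (ρ.pos ε) (ρ.le_one ε) ?_
    rw [div_le_iff₀ (by positivity)] at hJ
    push_cast
    nlinarith
  rw [Real.norm_of_nonneg (total_nonneg _ _)]
  refine (total_schwartzMul_sub_le N _ _ (A := 4 * ρ ε ^ m)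
    (by have := ρ.pos ε; positivity) fun ξ => ?_).trans (le_of_eq (by ring))
  -- Off the ball of radius 1/b around `ws ε` the translate vanishes to all orders; inside it |ξ|/b
  -- ≤ ρ^{s/2}.
  rcases lt_or_ge (b ε)⁻¹ ‖ξ - ws ε‖ with hξ | hξ
  · left
    intro l _
    rw [iteratedFDeriv_trans, hP.iteratedFDeriv_eq_zero l hξ]
  · right
    intro l hl
    have h3 : ‖ξ‖ ≤ ‖ws ε‖ + (b ε)⁻¹ := by
      calc ‖ξ‖ = ‖ws ε + (ξ - ws ε)‖ := by congr 1; abel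
        _ ≤ _ := (norm_add_le _ _).trans (by gcongr)
    have h4 : ‖ξ‖ * (b ε)⁻¹ ≤ ρ ε ^ (s / 2) := by
      calc ‖ξ‖ * (b ε)⁻¹ ≤ (‖ws ε‖ + (b ε)⁻¹) * (b ε)⁻¹ := by gcongr
        _ ≤ ρ ε ^ s + ρ ε ^ s := by nlinarith
        _ ≤ _ := by rw [e1]; nlinarith
    refine (hP.norm_iteratedFDeriv_sub_one_le hβ hm (N := J) (by lia) (h4.trans h2)).trans ?_
    have h5 : ‖ξ‖ * (b ε)⁻¹ ≥ 0 := by positivity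
    calc _ ≤ 1 * (ρ ε ^ (s / 2)) ^ (J + 1) * 4 := by
          gcongr
          exact pow_le_one₀ hβ hβ1
      _ ≤ 4 * ρ ε ^ m * 1 := by linarith
      _ ≤ _ := by
          have := ρ.pos ε
          gcongr
          linarith [norm_nonneg ξ]

/-- For a fixed g the estimate is global: P̂ - 1 is at most of order |ξ|/b and its derivatives of
order 1/b, so no vanishing moments are required. -/
lemma tendsto_apply_schwartzMul {P : I → 𝓢(E n, ℂ)} (hb : ∀ ε, 0 < b ε)
    (hP : ∀ᶠ ε in atBot, IsMollifier (P ε) (b ε)⁻¹)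
    (hbt : Tendsto (fun ε => (b ε)⁻¹) atBot (𝓝 0)) (T : 𝓢'(E n, ℂ)) (g : 𝓢(E n, ℂ)) :
    Tendsto (fun ε => T (schwartzMul g (schwartzFT n (P ε)))) atBot (𝓝 (T g)) := by
  obtain ⟨N, C, hC, hT⟩ := exists_dist_le_total T
  rw [tendsto_iff_norm_sub_tendsto_zero]
  have hlim : Tendsto (fun ε => C * ((N + 1) ^ 2 * (2 ^ (N + 1) * ((b ε)⁻¹ * 2) *
      total (N + 1) g))) atBot (𝓝 0) := by
    have := ((((hbt.mul_const 2).const_mul ((2 : ℝ) ^ (N + 1))).mul_const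
      (total (N + 1) g)).const_mul (((N : ℝ) + 1) ^ 2)).const_mul C
    simpa using this
  refine squeeze_zero' (Eventually.of_forall fun _ => norm_nonneg _) ?_ hlim
  filter_upwards [hP, hbt.eventually (Iic_mem_nhds one_pos)] with ε hP h1
  have hβ : 0 ≤ (b ε)⁻¹ := by have := hb ε; positivity
  rw [← map_sub]
  refine (hT _).trans ?_
  gcongr
  refine total_schwartzMul_sub_le N _ _ (by positivity) fun ξ => Or.inr fun l _ => ?_
  rcases Nat.eq_zero_or_pos l with rfl | hl
  · rw [norm_iteratedFDeriv_zero]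
    refine (hP.norm_sub_one_le hβ ξ).trans ?_
    nlinarith [norm_nonneg ξ]
  · have h2 : iteratedFDeriv ℝ l (fun η => schwartzFT n (P ε) η - 1) ξ =
        iteratedFDeriv ℝ l (schwartzFT n (P ε)) ξ := by
      have := iteratedFDeriv_sub_apply (𝕜 := ℝ) (i := l) (x := ξ)
        ((schwartzFT n (P ε)).contDiffAt _) (contDiffAt_const (c := (1 : ℂ)))
      rw [iteratedFDeriv_const_of_ne (by lia), Pi.zero_apply, sub_zero] at this
      exact this
    rw [h2]
    refine (hP.norm_iteratedFDeriv_le hβ l ξ).trans ?_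
    have h3 : (b ε)⁻¹ ^ l ≤ (b ε)⁻¹ := pow_le_of_le_one hβ h1 (by lia)
    nlinarith [norm_nonneg ξ, mul_nonneg hβ (norm_nonneg ξ)]

end Multiplier

/-! ### Nets with polynomially bounded derivatives -/

section PolyModerate

variable {n : ℕ} {ρ : Gauge} {b : I → ℝ}

/-- A net of smooth functions on `ℝⁿ` whose derivatives grow at most polynomially, with moderate
constants. -/
structure PolyModerate (ρ : Gauge) (u : I → E n → ℂ) : Prop where
  smooth : ∀ ε, ContDiff ℝ ∞ (u ε)
  bound : ∀ j : ℕ, ∃ (N : ℕ) (C : I → ℝ), Moderate ρ C ∧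
    ∀ᶠ ε in atBot, 0 ≤ C ε ∧ ∀ x, ‖iteratedFDeriv ℝ j (u ε) x‖ ≤ C ε * (1 + ‖x‖) ^ N

lemma polyModerate_reg (T : 𝓢'(E n, ℂ)) {P : I → 𝓢(E n, ℂ)} (hP : SModerate ρ P) :
    PolyModerate ρ fun ε => reg T (P ε) := by
  refine ⟨fun ε => contDiff_reg T (P ε), fun j => ?_⟩
  obtain ⟨N, C, hC, h⟩ := exists_norm_iteratedFDeriv_reg_le T j
  refine ⟨N, fun ε => C * total N (P ε), (moderate_const C).fun_mul (hP N),
    Eventually.of_forall fun ε => ⟨mul_nonneg hC (total_nonneg _ _), fun x => ?_⟩⟩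
  exact (h (P ε) x).trans (le_of_eq (by ring))

lemma polyModerate_schwartz {Q : I → 𝓢(E n, ℂ)} (hQ : SModerate ρ Q) :
    PolyModerate ρ fun ε => Q ε := by
  refine ⟨fun ε => (Q ε).smooth ⊤, fun j => ⟨0, fun ε => total j (Q ε), hQ j,
    Eventually.of_forall fun ε => ⟨total_nonneg _ _, fun x => ?_⟩⟩⟩
  have := (SchwartzMap.le_seminorm ℂ 0 j (Q ε) x).trans
    (seminorm_le_total (Nat.zero_le j) le_rfl (Q ε))
  simpa using this

lemma PolyModerate.mul {u v : I → E n → ℂ} (hu : PolyModerate ρ u) (hv : PolyModerate ρ v) :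
    PolyModerate ρ fun ε x => u ε x * v ε x := by
  refine ⟨fun ε => (hu.smooth ε).mul (hv.smooth ε), fun j => ?_⟩
  choose N C hC hCb using hu.bound
  choose M D hD hDb using hv.bound
  refine ⟨∑ i ∈ Finset.range (j + 1), (N i + M (j - i)),
    fun ε => ∑ i ∈ Finset.range (j + 1), (j.choose i : ℝ) * C i ε * D (j - i) ε,
    Moderate.sum fun i _ => ((moderate_const _).fun_mul (hC i)).fun_mul (hD (j - i)), ?_⟩
  filter_upwards [(Finset.eventually_all (Finset.range (j + 1))).2 fun i _ => hCb i,
    (Finset.eventually_all (Finset.range (j + 1))).2 fun i _ => hDb (j - i)] with ε h1 h2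
  refine ⟨Finset.sum_nonneg fun i hi => ?_, fun x => ?_⟩
  · have := (h1 i hi).1
    have := (h2 i hi).1
    positivity
  refine (norm_iteratedFDeriv_mul_le (hu.smooth ε) (hv.smooth ε) x (n := j)
    (by exact_mod_cast le_top)).trans ?_
  rw [Finset.sum_mul]
  refine Finset.sum_le_sum fun i hi => ?_
  have a1 := (h1 i hi).1
  have a2 := (h2 i hi).1
  have a3 := (h1 i hi).2 x
  have a4 := (h2 i hi).2 x
  calc _ ≤ (j.choose i : ℝ) * (C i ε * (1 + ‖x‖) ^ N i) * (D (j - i) ε * (1 + ‖x‖) ^ M (j - i)) := by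
        gcongr
    _ = (j.choose i : ℝ) * C i ε * D (j - i) ε * (1 + ‖x‖) ^ (N i + M (j - i)) := by
        rw [pow_add]; ring
    _ ≤ _ := by
        gcongr
        · linarith [norm_nonneg x]
        · exact Finset.single_le_sum (f := fun i => N i + M (j - i)) (fun i _ => Nat.zero_le _) hi

lemma PolyModerate.moderate {u : I → E n → ℂ} (hu : PolyModerate ρ u) {xs : I → E n}
    (hx : Moderate ρ xs) (j : ℕ) : Moderate ρ fun ε => iteratedFDeriv ℝ j (u ε) (xs ε) := by
  obtain ⟨N, C, hC, h⟩ := hu.bound j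
  exact Moderate.of_norm_le (hC.fun_mul (((moderate_const 1).fun_add hx.norm).fun_pow N))
    (h.mono fun ε h => h.2 _)

lemma PolyModerate.moderate_apply {u : I → E n → ℂ} (hu : PolyModerate ρ u) {xs : I → E n}
    (hx : Moderate ρ xs) : Moderate ρ fun ε => u ε (xs ε) :=
  (hu.moderate hx 0).mono (Eventually.of_forall fun ε => by rw [norm_iteratedFDeriv_zero])

lemma PolyModerate.norm_sub_le {u : I → E n → ℂ} (hu : PolyModerate ρ u) :
    ∃ (N : ℕ) (C : I → ℝ), Moderate ρ C ∧ ∀ᶠ ε in atBot, 0 ≤ C ε ∧ ∀ x y,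
      ‖u ε x - u ε y‖ ≤ C ε * (1 + ‖x‖ + ‖y‖) ^ N * ‖x - y‖ := by
  obtain ⟨N, C, hC, h⟩ := hu.bound 1
  refine ⟨N, C, hC, h.mono fun ε h => ⟨h.1, fun x y => ?_⟩⟩
  have h0 := h.1
  refine (convex_closedBall (0 : E n) (‖x‖ + ‖y‖)).norm_image_sub_le_of_norm_fderiv_le (𝕜 := ℝ)
    (fun z _ => ((hu.smooth ε).differentiable (by simp)).differentiableAt) (fun z hz => ?_)
    (by simp) (by simp)
  rw [← norm_iteratedFDeriv_one]
  refine (h.2 z).trans ?_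
  rw [mem_closedBall_zero_iff] at hz
  rw [add_assoc]
  gcongr

lemma PolyModerate.negligible_sub {u : I → E n → ℂ} (hu : PolyModerate ρ u) {xs ys : I → E n}
    (hx : Moderate ρ xs) (h : Negligible ρ fun ε => xs ε - ys ε) :
    Negligible ρ fun ε => u ε (xs ε) - u ε (ys ε) := by
  obtain ⟨N, C, hC, hb⟩ := hu.norm_sub_le
  refine (h.norm.mul_moderate (hC.fun_mul ((((moderate_const 1).fun_add hx.norm).fun_add
    (hx.of_sub h).norm).fun_pow N))).mono (hb.mono fun ε hb => ?_)
  refine ((hb.2 _ _).trans (le_of_eq (mul_comm _ _))).trans (le_abs_self _)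

/-- Polynomial bounds give moderateness at every moderate net of points, and the mean value
inequality gives independence of the representative. -/
lemma PolyModerate.defines {u : I → E n → ℂ} (hu : PolyModerate ρ u)
    (X : Set (Fin n → GenNum ρ ℝ)) {f : (Fin n → GenNum ρ ℝ) → GenNum ρ ℂ}
    (hf : ∀ x, f x = cls ρ fun ε => u ε (repPt x ε)) :
    Defines X (fun _ => Set.univ) u f where
  isOpen _ := isOpen_univ
  smooth ε := (hu.smooth ε).contDiffOn
  subset _ _ _ _ := Eventually.of_forall fun _ => Set.mem_univ _
  moderate _ _ _ hx j := hu.moderate hx.moderate j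
  value x _ xs hx := by
    rw [hf]
    exact (isRep_cls (hu.moderate_apply (isRepPt_repPt x).moderate)).of_sub
      (hu.negligible_sub (isRepPt_repPt x).moderate ((isRepPt_repPt x).sub_negligible hx))

end PolyModerate

/-! ### The hyperfinite Fourier transform of a net -/

section Box

variable {n : ℕ} {ρ : Gauge}

/-- The classical box `[-r,r]ⁿ`. -/
def box (n : ℕ) (r : ℝ) : Set (E n) := {x | ∀ i, |x i| ≤ r}

lemma norm_le_of_mem_box {r : ℝ} {x : E n} (hx : x ∈ box n r) : ‖x‖ ≤ n * r :=
  (norm_le_sum_norm x).trans ((Finset.sum_le_sum fun i _ => hx i).trans (by simp))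

lemma isCompact_box (r : ℝ) : IsCompact (box n r) := by
  refine (isCompact_closedBall (0 : E n) (n * r)).of_isClosed_subset ?_ fun x hx =>
    mem_closedBall_zero_iff.2 (norm_le_of_mem_box hx)
  simp only [box, Set.ofPred_forall]
  exact isClosed_iInter fun i => isClosed_le (by fun_prop) continuous_const

lemma measureReal_box_le {r : ℝ} (hr : 0 ≤ r) :
    (volume : Measure (E n)).real (box n r) ≤
      (n * r) ^ n * (volume : Measure (E n)).real (Metric.ball 0 1) := by
  refine (measureReal_mono (fun x hx => mem_closedBall_zero_iff.2 (norm_le_of_mem_box hx))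
    (isCompact_closedBall (0 : E n) (n * r)).measure_lt_top.ne).trans (le_of_eq ?_)
  rw [Measure.addHaar_real_closedBall _ _ (by positivity), finrank_euclideanSpace_fin]

/-- Invertibility puts |h_ε| above ρ^m, while h ≥ 0 allows negative values only down to -ρ^{m+1}. -/
lemma eventually_rep_pos {h : GenNum ρ ℝ} (hh : 0 < h) : ∀ᶠ ε in atBot, 0 < rep h ε := by
  obtain ⟨h1, h2⟩ := hh
  obtain ⟨m, hm⟩ := (isUnit_iff (isRep_zero.sub (isRep_rep h))).1 h2
  have h3 := (le_iff isRep_zero (isRep_rep h)).1 h1 (m + 1)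
  filter_upwards [hm, h3, eventually_le ρ (1 / 2) (by norm_num)] with ε h4 h5 h6
  have := pow_pos (ρ.pos ε) m
  rw [zero_sub, norm_neg, Real.norm_eq_abs] at h4
  rw [pow_succ] at h5
  by_contra h7
  rw [abs_of_nonpos (not_lt.1 h7)] at h4
  nlinarith

lemma mem_cube_cls {h : GenNum ρ ℝ} {xs : I → E n} (hx : Moderate ρ xs)
    (hbox : ∀ᶠ ε in atBot, xs ε ∈ box n (rep h ε)) :
    (fun i => cls ρ fun ε => xs ε i) ∈ cube n h := fun i =>
  ⟨le_of_eventually (isRep_rep h).neg (isRepPt_cls hx i)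
    (hbox.mono fun _ hb => (abs_le.1 (hb i)).1),
  le_of_eventually (isRepPt_cls hx i) (isRep_rep h) (hbox.mono fun _ hb => (abs_le.1 (hb i)).2)⟩

lemma moderate_of_mem_box {h : GenNum ρ ℝ} {xs : I → E n}
    (hbox : ∀ᶠ ε in atBot, xs ε ∈ box n (rep h ε)) : Moderate ρ xs :=
  Moderate.of_norm_le ((moderate_const (n : ℝ)).fun_mul (isRep_rep h).1)
    (hbox.mono fun _ hb => norm_le_of_mem_box hb)

/-- The hyperfinite Fourier transform can be computed with any net of continuous functions that
has the right values on the box. -/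
lemma hftOn_eq {h : GenNum ρ ℝ} (hh : 0 < h) {f : (Fin n → GenNum ρ ℝ) → GenNum ρ ℂ}
    {u : I → E n → ℂ} (hu : PolyModerate ρ u) (hf : ∀ x, f x = cls ρ fun ε => u ε (repPt x ε))
    (w : Fin n → GenNum ρ ℝ) :
    hftOn h f w = cls ρ fun ε => ∫ x in box n (rep h ε), u ε x * wave (repPt w ε) x := by
  have hG : IsGSF (cube n h) f := ⟨u, _, hu.defines (cube n h) hf⟩
  -- The chosen net is known only through its values at generalized points of the cube; agreement
  -- with `u` must be made uniform over the classical boxes.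
  obtain ⟨Ω, hv⟩ := hG.choose_spec
  have hnet : netOf (cube n h) f = hG.choose := dif_pos hG
  rw [← hnet] at hv
  set v := netOf (cube n h) f with hvdef
  have hu' := hu.defines (cube n h) hf
  have hpos := eventually_rep_pos hh
  have key : ∀ P : I → E n → Prop,
      (∀ xs : I → E n, (∀ᶠ ε in atBot, xs ε ∈ box n (rep h ε)) → ∀ᶠ ε in atBot, P ε (xs ε)) →
      ∀ᶠ ε in atBot, ∀ x ∈ box n (rep h ε), P ε x := by
    intro P hP
    -- The absolute value keeps the box nonempty for every ε; it is harmless for small ε.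
    have := eventually_forall_mem_of_forall_net (S := fun ε => box n |rep h ε|) (P := P)
      (fun ε => ⟨0, fun i => by simp⟩) fun xs hxs => hP xs (hpos.mono fun ε h1 => by
        have := hxs ε
        rwa [abs_of_pos h1] at this)
    filter_upwards [this, hpos] with ε h1 h2
    rwa [abs_of_pos h2] at h1
  have hΩ : ∀ᶠ ε in atBot, ∀ x ∈ box n (rep h ε), x ∈ Ω ε := key _ fun xs hxs =>
    hv.subset (mem_cube_cls (moderate_of_mem_box hxs) hxs) xs
      (isRepPt_cls (moderate_of_mem_box hxs))
  have hdiff : ∀ m : ℕ, ∀ᶠ ε in atBot, ∀ x ∈ box n (rep h ε), ‖v ε x - u ε x‖ ≤ ρ ε ^ m :=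
    fun m => key _ fun xs hxs => by
      have h1 := isRepPt_cls (moderate_of_mem_box hxs)
      have h2 := mem_cube_cls (moderate_of_mem_box hxs) hxs
      exact (hv.value _ h2 xs h1).sub_negligible (hu'.value _ h2 xs h1) m
  refine cls_eq_of_sub (negligible_of_le_mul (((((moderate_const (n : ℝ)).fun_mul
    (isRep_rep h).1).fun_pow n).fun_mul (moderate_const
      ((volume : Measure (E n)).real (Metric.ball 0 1))))) fun m => ?_)
  filter_upwards [hΩ, hdiff m, hpos] with ε h1 h2 h3
  have hw := continuous_wave (repPt w ε)
  have i1 : IntegrableOn (fun x => v ε x * wave (repPt w ε) x) (box n (rep h ε)) :=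
    (((hv.smooth ε).continuousOn.mono h1).mul hw.continuousOn).integrableOn_compact
      (isCompact_box _)
  have i2 : IntegrableOn (fun x => u ε x * wave (repPt w ε) x) (box n (rep h ε)) :=
    (((hu.smooth ε).continuous.mul hw).continuousOn).integrableOn_compact (isCompact_box _)
  change ‖(∫ x in box n (rep h ε), v ε x * wave (repPt w ε) x) - _‖ ≤ _
  rw [← integral_sub i1 i2]
  have hρ := pow_pos (ρ.pos ε) m
  refine (norm_setIntegral_le_of_norm_le_const (C := ρ ε ^ m) (isCompact_box _).measure_lt_top
    fun x hx => ?_).trans ?_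
  · rw [← sub_mul, norm_mul, norm_wave, mul_one]
    exact h2 x hx
  · rw [mul_comm]
    gcongr
    exact measureReal_box_le h3.le

end Box

/-! ### Supports of nets and the Fourier integral -/

section Support

variable {n : ℕ} {ρ : Gauge} {b : I → ℝ}

/-- A point just outside a box may represent the same generalized point as one inside; pushing it
outwards gives a margin that inequalities modulo negligible nets can detect. -/
lemma exists_shift {r δ : ℝ} (hδ : 0 < δ) {x : E n} (hx : x ∉ box n r) :
    ∃ z : E n, ‖z - x‖ ≤ δ ∧ ∃ i, r + δ < |z i| := by
  simp only [box, Set.mem_ofPred_eq, not_forall, not_le] at hx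
  obtain ⟨i, hi⟩ := hx
  refine ⟨x + (if 0 ≤ x i then δ else -δ) • (stdVec i : E n), ?_, i, ?_⟩
  · rw [add_sub_cancel_left, norm_smul, norm_stdVec, mul_one]
    split_ifs
    · rw [Real.norm_of_nonneg hδ.le]
    · rw [norm_neg, Real.norm_of_nonneg hδ.le]
  · have e : (stdVec i : E n) i = 1 := by simp [stdVec]
    rw [PiLp.add_apply, PiLp.smul_apply, e, smul_eq_mul, mul_one]
    split_ifs with h
    · rw [abs_of_nonneg h] at hi
      rw [abs_of_nonneg (by linarith)]
      linarith
    · rw [abs_of_neg (not_le.1 h)] at hi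
      rw [abs_of_neg (by linarith)]
      linarith

/-- A net that is not small somewhere is small outside of every box that contains the support of
the generalized function it defines. -/
lemma PolyModerate.small_outside {u : I → E n → ℂ} (hu : PolyModerate ρ u)
    {f : (Fin n → GenNum ρ ℝ) → GenNum ρ ℂ} (hf : ∀ x, f x = cls ρ fun ε => u ε (repPt x ε))
    {ys : I → E n} (hys : Moderate ρ ys) {c : ℝ} (hc : 0 < c)
    (hlow : ∀ᶠ ε in atBot, c ≤ ‖u ε (ys ε)‖) {h : GenNum ρ ℝ} (hh : gsupp f ⊆ cube n h)
    (N m : ℕ) : ∀ᶠ ε in atBot, ∀ x : E n, ‖x‖ ≤ (ρ ε ^ N)⁻¹ → x ∉ box n (rep h ε) →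
      ‖u ε x‖ ≤ ρ ε ^ m := by
  obtain ⟨K, C, hC, hL⟩ := hu.norm_sub_le
  obtain ⟨p, hp⟩ := hC.fun_mul ((((moderate_const (2 : ℝ)).fun_add (moderate_inv_pow N)).fun_add
    (moderate_inv_pow N)).fun_pow K)
  -- On the ball in question the Lipschitz constant is at most ρ^{-p}, so a shift by ρ^q changes the
  -- value by at most ρ^{m+1} ≤ ρ^m / 2.
  set q := p + m + 1 with hq
  refine eventually_forall_mem_of_forall_net (S := fun ε => {x : E n | ‖x‖ ≤ (ρ ε ^ N)⁻¹})
    (P := fun ε x => x ∉ box n (rep h ε) → ‖u ε x‖ ≤ ρ ε ^ m)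
    (fun ε => ⟨0, by simpa using (pow_pos (ρ.pos ε) N).le⟩) fun xs hxs => ?_
  by_contra hcon
  have hz : ∀ ε, ∃ z : E n, (xs ε ∉ box n (rep h ε) → ‖z - xs ε‖ ≤ ρ ε ^ q ∧
      ∃ i, rep h ε + ρ ε ^ q < |z i|) := fun ε => by
    by_cases hx : xs ε ∈ box n (rep h ε)
    · exact ⟨0, fun h => absurd hx h⟩
    · obtain ⟨z, hz⟩ := exists_shift (pow_pos (ρ.pos ε) q) hx
      exact ⟨z, fun _ => hz⟩
  choose z hz using hz
  classical
  -- The spliced net: the shifted bad point when the bound fails at ε, and otherwise a point where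
  -- u_ε is at least c. Its value is bounded below for all small ε, hence invertible.
  set zs : I → E n := fun ε =>
    if xs ε ∉ box n (rep h ε) ∧ ρ ε ^ m < ‖u ε (xs ε)‖ then z ε else ys ε with hzs
  have hmod : Moderate ρ zs := by
    refine Moderate.of_norm_le ((hys.norm.fun_add (moderate_inv_pow N)).fun_add (moderate_const 1))
      (Eventually.of_forall fun ε => ?_)
    have h0 := inv_pos.2 (pow_pos (ρ.pos ε) N)
    simp only [hzs]
    split_ifs with hbad
    · have h1 := (hz ε hbad.1).1
      have h2 : ‖xs ε‖ ≤ _ := hxs ε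
      have h3 : ρ ε ^ q ≤ 1 := pow_le_one₀ (ρ.pos ε).le (ρ.le_one ε)
      have h4 := norm_add_le (z ε - xs ε) (xs ε)
      rw [sub_add_cancel] at h4
      linarith [norm_nonneg (ys ε)]
    · linarith
  have hval := ((hu.defines Set.univ hf).value _ (Set.mem_univ _) zs (isRepPt_cls hmod))
  have hpos : 0 < gabs (f fun i => cls ρ fun ε => zs ε i) := by
    rw [gabs_pos_iff hval]
    refine ⟨m + 1, ?_⟩
    filter_upwards [hlow, hL, hp, eventually_le ρ (1 / 2) (by norm_num),
      eventually_le ρ c hc] with ε h1 h2 h3 h4 h5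
    simp only [hzs]
    have hρ := ρ.pos ε
    split_ifs with hbad
    · have h6 := (hz ε hbad.1).1
      have h7 : ‖xs ε‖ ≤ _ := hxs ε
      have h8 : ρ ε ^ q ≤ 1 := pow_le_one₀ (ρ.pos ε).le (ρ.le_one ε)
      have h9 := norm_add_le (z ε - xs ε) (xs ε)
      rw [sub_add_cancel] at h9
      have h10 := h2.1
      have hle : 1 + ‖z ε‖ + ‖xs ε‖ ≤ 2 + (ρ ε ^ N)⁻¹ + (ρ ε ^ N)⁻¹ := by linarith
      have h11 : ‖u ε (z ε) - u ε (xs ε)‖ ≤ ρ ε ^ (m + 1) := by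
        calc _ ≤ C ε * (1 + ‖z ε‖ + ‖xs ε‖) ^ K * ‖z ε - xs ε‖ := h2.2 _ _
          _ ≤ C ε * (2 + (ρ ε ^ N)⁻¹ + (ρ ε ^ N)⁻¹) ^ K * ρ ε ^ q := by
            gcongr
          _ ≤ (ρ ε ^ p)⁻¹ * ρ ε ^ q := by
            gcongr
            exact (le_abs_self _).trans h3
          _ = ρ ε ^ (m + 1) := by rw [hq, add_assoc, pow_add]; field_simp
      have h12 := norm_sub_norm_le (u ε (xs ε)) (u ε (z ε))
      rw [norm_sub_rev] at h12
      have h13 := hbad.2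
      have h14 : ρ ε ^ (m + 1) ≤ ρ ε ^ m * (1 / 2) := by rw [pow_succ]; gcongr
      linarith
    · refine le_trans ?_ (h5.trans h1)
      exact pow_le_of_le_one hρ.le (ρ.le_one ε) (by lia)
  -- The spliced point lies in the support, so its coordinates exceed `rep h` by at most ρ^q, which
  -- excludes the shifted bad points.
  have hcube := hh (mem_gsupp_of_pos hpos)
  have hall : ∀ᶠ ε in atBot, ∀ i, |zs ε i| ≤ rep h ε + ρ ε ^ q := by
    refine eventually_all.2 fun i => ?_
    filter_upwards [(le_iff (isRep_rep h).neg (isRepPt_cls hmod i)).1 (hcube i).1 q,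
      (le_iff (isRepPt_cls hmod i) (isRep_rep h)).1 (hcube i).2 q] with ε h1 h2
    rw [abs_le]
    constructor <;> linarith
  refine hcon (hall.mono fun ε h1 hx => ?_)
  by_contra hb
  have hbad : xs ε ∉ box n (rep h ε) ∧ ρ ε ^ m < ‖u ε (xs ε)‖ := ⟨hx, not_le.1 hb⟩
  obtain ⟨i, hi⟩ := (hz ε hx).2
  have := h1 i
  simp only [hzs] at this
  rw [if_pos hbad] at this
  linarith

/-- A net that decays rapidly, with moderate constants. -/
def RapidDecay (ρ : Gauge) (u : I → E n → ℂ) : Prop :=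
  ∀ k : ℕ, ∃ C : I → ℝ, Moderate ρ C ∧ ∀ᶠ ε in atBot, ∀ x, (1 + ‖x‖) ^ k * ‖u ε x‖ ≤ C ε

lemma integrable_inv_one_add_norm_pow : Integrable fun x : E n => ((1 + ‖x‖) ^ (n + 1))⁻¹ := by
  have h := integrable_one_add_norm (E := E n) (μ := volume) (r := n + 1) (by simp)
  refine h.congr (Eventually.of_forall fun x => ?_)
  have : 0 < 1 + ‖x‖ := by positivity
  simp only
  rw [Real.rpow_neg this.le, ← Real.rpow_natCast]
  push_cast
  rfl

lemma RapidDecay.integrable {u : I → E n → ℂ} (hd : RapidDecay ρ u)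
    (hc : ∀ ε, Continuous (u ε)) : ∀ᶠ ε in atBot, Integrable (u ε) := by
  obtain ⟨C, -, h⟩ := hd (n + 1)
  filter_upwards [h] with ε h
  refine (integrable_inv_one_add_norm_pow.const_mul (C ε)).mono' (hc ε).aestronglyMeasurable
    (Eventually.of_forall fun x => ?_)
  rw [← div_eq_mul_inv, le_div_iff₀ (by positivity), mul_comm]
  exact h x

/-- Rapid decay settles all x beyond some moderate radius ρ^{-p}; within it the weight is moderate
and is absorbed by asking for a higher power in `hs`. The weight makes the bound integrable. -/
lemma small_outside_weighted {u : I → E n → ℂ} (hd : RapidDecay ρ u) {h : GenNum ρ ℝ}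
    (hs : ∀ N m : ℕ, ∀ᶠ ε in atBot, ∀ x : E n, ‖x‖ ≤ (ρ ε ^ N)⁻¹ → x ∉ box n (rep h ε) →
      ‖u ε x‖ ≤ ρ ε ^ m) (m : ℕ) :
    ∀ᶠ ε in atBot, ∀ x ∉ box n (rep h ε), ‖u ε x‖ ≤ ρ ε ^ m * ((1 + ‖x‖) ^ (n + 1))⁻¹ := by
  have h1 : ∃ p : ℕ, ∀ᶠ ε in atBot, ∀ x, ρ ε ^ m < ‖u ε x‖ * (1 + ‖x‖) ^ (n + 1) →
      ‖x‖ ≤ (ρ ε ^ p)⁻¹ := by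
    obtain ⟨C, ⟨p, hp⟩, hC⟩ := hd (n + 2)
    refine ⟨p + m, ?_⟩
    filter_upwards [hp, hC] with ε h1 h2 x hx
    have hρ := ρ.pos ε
    have h3 : ρ ε ^ m * (1 + ‖x‖) ≤ (ρ ε ^ p)⁻¹ := by
      calc ρ ε ^ m * (1 + ‖x‖) ≤ ‖u ε x‖ * (1 + ‖x‖) ^ (n + 1) * (1 + ‖x‖) := by gcongr
        _ = (1 + ‖x‖) ^ (n + 2) * ‖u ε x‖ := by ring
        _ ≤ C ε := h2 x
        _ ≤ _ := (le_abs_self _).trans h1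
    rw [pow_add, mul_inv]
    calc ‖x‖ ≤ 1 + ‖x‖ := by linarith
      _ = (ρ ε ^ m * (1 + ‖x‖)) * (ρ ε ^ m)⁻¹ := by field_simp
      _ ≤ _ := by gcongr
  obtain ⟨p, hp⟩ := h1
  filter_upwards [hp, hs p (m + (p + 1) * (n + 1)), eventually_le ρ (1 / 2) (by norm_num)]
    with ε h1 h2 h3 x hx
  have hρ := ρ.pos ε
  rw [← div_eq_mul_inv, le_div_iff₀ (by positivity)]
  by_contra hcon
  have h4 := h1 x (not_le.1 hcon)
  have h5 := h2 x h4 hx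
  refine hcon ?_
  have h6 : 1 + ‖x‖ ≤ (ρ ε ^ (p + 1))⁻¹ := by
    have h7 : 1 ≤ (ρ ε ^ p)⁻¹ := (one_le_inv₀ (pow_pos hρ p)).2 (pow_le_one₀ hρ.le (ρ.le_one ε))
    have h8 : 2 ≤ (ρ ε)⁻¹ := by
      rw [le_inv_comm₀ (by norm_num) hρ]
      linarith
    rw [pow_succ, mul_inv]
    nlinarith
  calc ‖u ε x‖ * (1 + ‖x‖) ^ (n + 1)
      ≤ ρ ε ^ (m + (p + 1) * (n + 1)) * ((ρ ε ^ (p + 1))⁻¹) ^ (n + 1) := by gcongr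
    _ = ρ ε ^ m := by
      rw [pow_add, pow_mul, inv_pow, mul_assoc, mul_inv_cancel₀ (by positivity), mul_one]

/-- The Fourier integral over a box that contains the support is the one over the whole space. -/
lemma negligible_setIntegral_box_sub_integral {u : I → E n → ℂ} (hu : PolyModerate ρ u)
    (hd : RapidDecay ρ u) {h : GenNum ρ ℝ}
    (hs : ∀ N m : ℕ, ∀ᶠ ε in atBot, ∀ x : E n, ‖x‖ ≤ (ρ ε ^ N)⁻¹ → x ∉ box n (rep h ε) →
      ‖u ε x‖ ≤ ρ ε ^ m) (ws : I → E n) :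
    Negligible ρ fun ε => (∫ x in box n (rep h ε), u ε x * wave (ws ε) x) -
      ∫ x, u ε x * wave (ws ε) x := by
  refine negligible_of_le_mul
    (moderate_const (∫ x : E n, ((1 + ‖x‖) ^ (n + 1))⁻¹)) fun m => ?_
  filter_upwards [small_outside_weighted hd hs m, hd.integrable fun ε => (hu.smooth ε).continuous]
    with ε h1 h2
  have hi : Integrable fun x => u ε x * wave (ws ε) x :=
    h2.norm.mono' ((hu.smooth ε).continuous.mul (continuous_wave _)).aestronglyMeasurable
      (Eventually.of_forall fun x => by rw [norm_mul, norm_wave, mul_one])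
  rw [← integral_add_compl (isCompact_box (rep h ε)).measurableSet hi, sub_add_cancel_left,
    norm_neg]
  have hi2 := (integrable_inv_one_add_norm_pow (n := n)).const_mul (ρ ε ^ m)
  calc _ ≤ ∫ x in (box n (rep h ε))ᶜ, ρ ε ^ m * ((1 + ‖x‖) ^ (n + 1))⁻¹ := by
        refine norm_integral_le_of_norm_le hi2.integrableOn ?_
        refine (ae_restrict_iff' (isCompact_box (rep h ε)).measurableSet.compl).2
          (Eventually.of_forall fun x hx => ?_)
        rw [norm_mul, norm_wave, mul_one]
        exact h1 x hx
    _ ≤ ∫ x, ρ ε ^ m * ((1 + ‖x‖) ^ (n + 1))⁻¹ := by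
        refine setIntegral_le_integral hi2 (Eventually.of_forall fun x => ?_)
        have := ρ.pos ε
        simp only [Pi.zero_apply]
        positivity
    _ = _ := by rw [integral_const_mul, mul_comm]

lemma schwartzFT_surjective : Function.Surjective (schwartzFT n) := by
  intro φ
  obtain ⟨ψ, hψ⟩ := (FourierTransform.fourierCLE ℂ 𝓢(E n, ℂ)).surjective
    (SchwartzMap.compCLMOfContinuousLinearEquiv ℂ (dilation n).symm φ)
  refine ⟨ψ, ?_⟩
  ext x
  have h1 : schwartzFT n ψ x = (FourierTransform.fourierCLE ℂ 𝓢(E n, ℂ) ψ) (dilation n x) := rfl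
  rw [h1, hψ]
  simp

/-- If `T ≠ 0`, then its regularizations are not small on some moderate ball. -/
lemma exists_le_norm_reg {P : I → 𝓢(E n, ℂ)} (hb : ∀ ε, 0 < b ε)
    (hP : ∀ᶠ ε in atBot, IsMollifier (P ε) (b ε)⁻¹) (hPm : SModerate ρ P)
    (hbt : Tendsto (fun ε => (b ε)⁻¹) atBot (𝓝 0)) {T : 𝓢'(E n, ℂ)} (hT : T ≠ 0)
    {a : ℝ} (ha : 0 < a) :
    ∃ c : ℝ, 0 < c ∧ ∀ᶠ ε in atBot, ∃ y, ‖y‖ ≤ ρ ε ^ (-a) ∧ c ≤ ‖reg T (P ε) y‖ := by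
  obtain ⟨φ, hφ⟩ : ∃ φ, T φ ≠ 0 := by
    by_contra hcon
    push Not at hcon
    exact hT (by ext φ; exact hcon φ)
  -- Test functions are written as ĝ because the pairing formula `integral_reg_mul_schwartzFT` has
  -- that form.
  obtain ⟨g, rfl⟩ := schwartzFT_surjective φ
  obtain ⟨N, C, hC, hF⟩ := exists_norm_reg_le T
  obtain ⟨p, hp⟩ := (moderate_const C).fun_mul (hPm N)
  -- With k a ≥ p + 1, the moderate constant ρ^{-p} is at most ρ (1 + |x|)^k outside the ball of
  -- radius ρ^{-a}.
  obtain ⟨k, hk⟩ := exists_nat_ge ((p + 1 : ℝ) / a)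
  set φ := schwartzFT n g with hφdef
  set τ := ‖T φ‖ with hτ
  have hτ0 : 0 < τ := norm_pos_iff.2 hφ
  set I0 := ∫ x, ‖φ x‖ with hI0
  set I1 := ∫ x, (1 + ‖x‖) ^ (N + k) * ‖φ x‖ with hI1
  have hI0p : 0 ≤ I0 := integral_nonneg fun x => norm_nonneg _
  have hI1p : 0 ≤ I1 := integral_nonneg fun x => by positivity
  refine ⟨τ / (8 * (1 + I0)), by positivity, ?_⟩
  have hlim := (tendsto_apply_schwartzMul hb hP hbt (distribFT T) g).norm
  have h8 : τ / 2 < ‖distribFT T g‖ := by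
    change τ / 2 < τ
    linarith
  filter_upwards [hP, hlim.eventually (lt_mem_nhds h8), hp,
    eventually_le ρ (τ / (8 * (1 + I1))) (by positivity)] with ε hP h1 h2 h3
  rw [distribFT_apply, ← integral_reg_mul_schwartzFT T hP.even] at h1
  by_contra hcon
  push Not at hcon
  have hρ := ρ.pos ε
  set c := τ / (8 * (1 + I0)) with hc
  -- If the regularization stayed below c on the ball, the first term would handle the ball and the
  -- second its complement; both integrals are at most τ/8, against a pairing larger than τ/2.
  have hpt : ∀ x, ‖reg T (P ε) x * φ x‖ ≤ c * ‖φ x‖ + ρ ε * ((1 + ‖x‖) ^ (N + k) * ‖φ x‖) := by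
    intro x
    rw [norm_mul]
    rcases le_or_gt ‖x‖ (ρ ε ^ (-a)) with hx | hx
    · have := (hcon x hx).le
      have h4 : 0 ≤ ρ ε * ((1 + ‖x‖) ^ (N + k) * ‖φ x‖) := by positivity
      nlinarith [norm_nonneg (φ x)]
    · have h4 : (ρ ε ^ p)⁻¹ ≤ ρ ε * (1 + ‖x‖) ^ k := by
        have h5 : (ρ ε ^ (p + 1))⁻¹ ≤ (ρ ε ^ (-a)) ^ k := by
          rw [← Real.rpow_natCast, ← Real.rpow_natCast, ← Real.rpow_neg hρ.le,
            ← Real.rpow_mul hρ.le]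
          refine Real.rpow_le_rpow_of_exponent_ge hρ (ρ.le_one ε) ?_
          rw [div_le_iff₀ ha] at hk
          push_cast
          linarith
        have h6 : (ρ ε ^ (-a)) ^ k ≤ (1 + ‖x‖) ^ k := by
          have := Real.rpow_pos_of_pos hρ (-a)
          gcongr
          linarith
        calc (ρ ε ^ p)⁻¹ = ρ ε * (ρ ε ^ (p + 1))⁻¹ := by rw [pow_succ]; field_simp
          _ ≤ _ := by gcongr; exact h5.trans h6
      have h7 : 0 ≤ c * ‖φ x‖ := by positivity
      have h8 : C * total N (P ε) ≤ (ρ ε ^ p)⁻¹ := (le_abs_self _).trans h2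
      calc ‖reg T (P ε) x‖ * ‖φ x‖ ≤ (C * (1 + ‖x‖) ^ N * total N (P ε)) * ‖φ x‖ := by
            gcongr; exact hF _ _
        _ = (C * total N (P ε)) * ((1 + ‖x‖) ^ N * ‖φ x‖) := by ring
        _ ≤ (ρ ε * (1 + ‖x‖) ^ k) * ((1 + ‖x‖) ^ N * ‖φ x‖) :=
            mul_le_mul_of_nonneg_right (h8.trans h4) (by positivity)
        _ = ρ ε * ((1 + ‖x‖) ^ (N + k) * ‖φ x‖) := by rw [pow_add]; ring
        _ ≤ _ := by linarith
  have hint := norm_integral_le_of_norm_le ((φ.integrable.norm.const_mul c).add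
    ((integrable_one_add_pow_mul (N + k) φ).const_mul (ρ ε))) (Eventually.of_forall hpt)
  have hsum : ∫ x, (c * ‖φ x‖ + ρ ε * ((1 + ‖x‖) ^ (N + k) * ‖φ x‖)) = c * I0 + ρ ε * I1 := by
    rw [integral_add (φ.integrable.norm.const_mul c)
      ((integrable_one_add_pow_mul (N + k) φ).const_mul (ρ ε)), integral_const_mul,
      integral_const_mul]
  have h4 : c * I0 ≤ τ / 8 := by
    rw [hc, div_mul_eq_mul_div, div_le_div_iff₀ (by positivity) (by norm_num)]
    nlinarith
  have h5 : ρ ε * I1 ≤ τ / 8 := by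
    calc ρ ε * I1 ≤ τ / (8 * (1 + I1)) * I1 := by gcongr
      _ ≤ τ / 8 := by
        rw [div_mul_eq_mul_div, div_le_div_iff₀ (by positivity) (by norm_num)]
        nlinarith
  have h6 : ‖∫ x, reg T (P ε) x * φ x‖ ≤ c * I0 + ρ ε * I1 := hsum ▸ hint
  linarith

end Support

/-! ### The embedding, the function `𝟙` and their product -/

section Embedding

variable {n : ℕ} {ρ : Gauge} {b : I → ℝ}

lemma exists_rpow_neg_le (hb_pos : ∀ ε, 0 < b ε) (hb_mod : Moderate ρ b)
    (hb : IsLargeInfinite (cls ρ b)) : ∃ t : ℝ, 0 < t ∧ ∀ᶠ ε in atBot, ρ ε ^ (-t) ≤ b ε := by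
  obtain ⟨t, ht, h⟩ := hb.exists_rpow_le (isRep_cls hb_mod)
  exact ⟨t, ht, h.mono fun ε h => by rwa [abs_of_pos (hb_pos ε)] at h⟩

lemma inv_le_rpow {t : ℝ} {ε : I} (h : ρ ε ^ (-t) ≤ b ε) : (b ε)⁻¹ ≤ ρ ε ^ t := by
  rw [Real.rpow_neg (ρ.pos ε).le] at h
  exact inv_le_of_inv_le₀ (Real.rpow_pos_of_pos (ρ.pos ε) _) h

lemma one_le_of_rpow_neg_le {t : ℝ} (ht : 0 < t) (h : ∀ᶠ ε in atBot, ρ ε ^ (-t) ≤ b ε) :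
    ∀ᶠ ε in atBot, 1 ≤ b ε :=
  h.mono fun ε h => (Real.one_le_rpow_of_pos_of_le_one_of_nonpos (ρ.pos ε) (ρ.le_one ε)
    (by linarith)).trans h

lemma tendsto_inv_of_rpow_neg_le (hb_pos : ∀ ε, 0 < b ε) {t : ℝ} (ht : 0 < t)
    (h : ∀ᶠ ε in atBot, ρ ε ^ (-t) ≤ b ε) : Tendsto (fun ε => (b ε)⁻¹) atBot (𝓝 0) := by
  have h0 := ρ.tendsto.rpow_const (p := t) (Or.inr ht.le)
  rw [Real.zero_rpow ht.ne'] at h0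
  exact squeeze_zero' (Eventually.of_forall fun ε => (inv_pos.2 (hb_pos ε)).le)
    (h.mono fun ε h => inv_le_rpow h) h0

lemma embed_eq (hb_pos : ∀ ε, 0 < b ε) (m : MollifierNet n b) (T : 𝓢'(E n, ℂ))
    (x : Fin n → GenNum ρ ℝ) :
    embed ρ m T x = cls ρ fun ε => reg T (m.mol ε) (repPt x ε) := by
  simp only [embed, m.toSchwartz_scaled_sub (hb_pos _)]
  rfl

lemma sModerate_mol' (hb_pos : ∀ ε, 0 < b ε) (hb_mod : Moderate ρ b)
    (hb : IsLargeInfinite (cls ρ b)) (m : MollifierNet n b) : SModerate ρ m.mol := by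
  obtain ⟨t, ht, h⟩ := exists_rpow_neg_le hb_pos hb_mod hb
  exact m.sModerate_mol hb_pos hb_mod (one_le_of_rpow_neg_le ht h)

lemma eventually_le_rep {h : GenNum ρ ℝ} (hh : 0 < h) (hi : IsInfinite h) {r : ℝ} (hr : 0 < r) :
    ∀ᶠ ε in atBot, r ≤ rep h ε := by
  filter_upwards [(le_iff (isRep_const (r + 1)) (isRep_rep h).norm).1 (hi (r + 1) (by linarith)) 0,
    eventually_rep_pos hh] with ε h1 h2
  rw [pow_zero, Real.norm_of_nonneg h2.le] at h1
  linarith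

lemma reg_delta (hb_pos : ∀ ε, 0 < b ε) (m : MollifierNet n b) (ε : I) :
    reg (TemperedDistribution.delta 0) (m.mol ε) = m.mol ε := by
  ext x
  change m.mol ε (0 - x) = _
  rw [zero_sub, m.mol_apply (hb_pos ε), m.mol_apply (hb_pos ε), m.scaled_neg]

/-- A support point is within distance 1 of a point where the mollifier is nonzero, hence is finite,
and every infinite box contains it. -/
lemma gsupp_embed_delta_subset (hb_pos : ∀ ε, 0 < b ε) (hb_mod : Moderate ρ b)
    (hb : IsLargeInfinite (cls ρ b)) (m : MollifierNet n b) {h : GenNum ρ ℝ} (hh : 0 < h)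
    (hi : IsInfinite h) : gsupp (embed ρ m (TemperedDistribution.delta 0)) ⊆ cube n h := by
  intro x hx
  obtain ⟨t, ht, hbt⟩ := exists_rpow_neg_le hb_pos hb_mod hb
  have h01 : (0 : GenNum ρ ℝ) < const ρ 1 := by
    refine ⟨le_of_eventually isRep_zero (isRep_const 1) (Eventually.of_forall fun _ => zero_le_one),
      (isUnit_iff (isRep_zero.sub (isRep_const 1))).2 ⟨0, Eventually.of_forall fun _ => by simp⟩⟩
  obtain ⟨y, hy, hxy⟩ := hx _ h01
  have hdef := (polyModerate_reg (TemperedDistribution.delta 0)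
    (sModerate_mol' hb_pos hb_mod hb m)).defines Set.univ
    (embed_eq (ρ := ρ) hb_pos m (TemperedDistribution.delta 0))
  obtain ⟨q, hq⟩ := (gabs_pos_iff (hdef.value y (Set.mem_univ _) _ (isRepPt_repPt y))).1 hy
  have hxy' := (le_iff ((isRepPt_repPt x).sub (isRepPt_repPt y)).norm (isRep_const 1)).1 hxy.1 0
  have hle : ∀ᶠ ε in atBot, ‖repPt x ε‖ ≤ rep h ε := by
    -- The bound 3 is 1 for y, plus 1 for the distance, plus 1 for the error in comparing
    -- representatives.
    filter_upwards [hq, hxy', eventually_le_rep hh hi (r := 3) (by norm_num),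
      one_le_of_rpow_neg_le ht hbt, m.isMollifier hb_pos] with ε h1 h2 h3 h4 h5
    have h6 : ‖repPt y ε‖ ≤ 1 := by
      by_contra hcon
      have h7 : m.mol ε (repPt y ε) = 0 :=
        h5.zero_of_le _ ((inv_le_one_of_one_le₀ h4).trans (not_le.1 hcon).le)
      rw [reg_delta hb_pos, h7, norm_zero] at h1
      exact absurd h1 (not_le.2 (pow_pos (ρ.pos ε) q))
    have h7 := norm_add_le (repPt x ε - repPt y ε) (repPt y ε)
    rw [sub_add_cancel] at h7
    rw [pow_zero] at h2
    linarith
  intro i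
  have hi' : ∀ᶠ ε in atBot, |repPt x ε i| ≤ rep h ε :=
    hle.mono fun ε h => (norm_apply_le i).trans h
  exact ⟨le_of_eventually (isRep_rep h).neg (isRepPt_repPt x i)
      (hi'.mono fun _ hb => (abs_le.1 hb).1),
    le_of_eventually (isRepPt_repPt x i) (isRep_rep h) (hi'.mono fun _ hb => (abs_le.1 hb).2)⟩

/-- The number k only witnesses that an admissible box exists; for the chosen one, the mollifier
eventually lives inside it, so the box integral is the full transform. -/
lemma oneHat_eq (hb_pos : ∀ ε, 0 < b ε) (hb_mod : Moderate ρ b)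
    (hb : IsLargeInfinite (cls ρ b)) (m : MollifierNet n b) {k : GenNum ρ ℝ} (hk_pos : 0 < k)
    (hk : IsInfinite k) (x : Fin n → GenNum ρ ℝ) :
    oneHat ρ m x = cls ρ fun ε => schwartzFT n (m.mol ε) (repPt x ε) := by
  have hf : ∃ h : GenNum ρ ℝ, 0 < h ∧ IsInfinite h ∧
      gsupp (embed ρ m (TemperedDistribution.delta 0)) ⊆ cube n h :=
    ⟨k, hk_pos, hk, gsupp_embed_delta_subset hb_pos hb_mod hb m hk_pos hk⟩
  obtain ⟨t, ht, hbt⟩ := exists_rpow_neg_le hb_pos hb_mod hb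
  have hspec := hf.choose_spec
  rw [oneHat, hft, dif_pos hf, hftOn_eq hspec.1 (polyModerate_reg (TemperedDistribution.delta 0)
    (sModerate_mol' hb_pos hb_mod hb m)) (embed_eq hb_pos m _)]
  refine cls_eq_of_sub fun q => ?_
  filter_upwards [eventually_le_rep hspec.1 hspec.2.1 one_pos, one_le_of_rpow_neg_le ht hbt,
    m.isMollifier hb_pos] with ε h1 h2 h3
  rw [reg_delta hb_pos, schwartzFT_apply', setIntegral_eq_integral_of_forall_compl_eq_zero, sub_self,
    norm_zero]
  · exact (pow_pos (ρ.pos ε) q).le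
  · intro y hy
    rw [h3.zero_of_le y, zero_mul]
    by_contra hcon
    refine hy fun i => ?_
    exact (norm_apply_le i).trans ((not_le.1 hcon).le.trans ((inv_le_one_of_one_le₀ h2).trans h1))

/-- The net that defines `ι(T)·𝟙`. -/
def prodNet (m : MollifierNet n b) (T : 𝓢'(E n, ℂ)) (ε : I) (x : E n) : ℂ :=
  reg T (m.mol ε) x * schwartzFT n (m.mol ε) x

lemma polyModerate_prodNet (hb_pos : ∀ ε, 0 < b ε) (hb_mod : Moderate ρ b)
    (hb : IsLargeInfinite (cls ρ b)) (m : MollifierNet n b) (T : 𝓢'(E n, ℂ)) :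
    PolyModerate ρ (prodNet m T) :=
  (polyModerate_reg T (sModerate_mol' hb_pos hb_mod hb m)).mul
    (polyModerate_schwartz ((sModerate_mol' hb_pos hb_mod hb m).map (schwartzFT n)))

lemma embed_mul_oneHat_eq (hb_pos : ∀ ε, 0 < b ε) (hb_mod : Moderate ρ b)
    (hb : IsLargeInfinite (cls ρ b)) (m : MollifierNet n b) {k : GenNum ρ ℝ} (hk_pos : 0 < k)
    (hk : IsInfinite k) (T : 𝓢'(E n, ℂ)) (x : Fin n → GenNum ρ ℝ) :
    embed ρ m T x * oneHat ρ m x = cls ρ fun ε => prodNet m T ε (repPt x ε) := by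
  have hm := sModerate_mol' hb_pos hb_mod hb m
  have hx := (isRepPt_repPt x).moderate
  rw [embed_eq hb_pos, oneHat_eq hb_pos hb_mod hb m hk_pos hk]
  exact ((isRep_cls ((polyModerate_reg T hm).moderate_apply hx)).mul
    (isRep_cls ((polyModerate_schwartz (hm.map (schwartzFT n))).moderate_apply hx))).2.symm

lemma one_add_pow_mul_le_total (M : ℕ) (φ : 𝓢(E n, ℂ)) (x : E n) :
    (1 + ‖x‖) ^ M * ‖φ x‖ ≤ 2 ^ M * (2 * total M φ) := by
  have h1 : (1 + ‖x‖) ^ M ≤ 2 ^ M * (1 + ‖x‖ ^ M) := by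
    refine (add_pow_le zero_le_one (norm_nonneg x) M).trans ?_
    rw [one_pow]
    gcongr
    · norm_num
    · lia
  have h2 := (SchwartzMap.norm_le_seminorm ℂ φ x).trans
    (seminorm_le_total (Nat.zero_le M) (Nat.zero_le M) φ)
  have h3 := (SchwartzMap.norm_pow_mul_le_seminorm ℂ φ M x).trans
    (seminorm_le_total le_rfl (Nat.zero_le M) φ)
  calc (1 + ‖x‖) ^ M * ‖φ x‖ ≤ 2 ^ M * (1 + ‖x‖ ^ M) * ‖φ x‖ := by gcongr
    _ = 2 ^ M * (‖φ x‖ + ‖x‖ ^ M * ‖φ x‖) := by ring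
    _ ≤ _ := by gcongr; linarith

/-- The degree of growth of T * P_ε does not depend on ε, so the Schwartz decay of P̂_ε, with
moderate seminorms, outweighs it. -/
lemma rapidDecay_prodNet (hb_pos : ∀ ε, 0 < b ε) (hb_mod : Moderate ρ b)
    (hb : IsLargeInfinite (cls ρ b)) (m : MollifierNet n b) (T : 𝓢'(E n, ℂ)) :
    RapidDecay ρ (prodNet m T) := by
  have hm := sModerate_mol' hb_pos hb_mod hb m
  intro k
  obtain ⟨N, C, hC, h⟩ := exists_norm_reg_le T
  refine ⟨fun ε => C * total N (m.mol ε) * (2 ^ (N + k) *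
    (2 * total (N + k) (schwartzFT n (m.mol ε)))), ((moderate_const C).fun_mul (hm N)).fun_mul
      ((moderate_const _).fun_mul ((moderate_const _).fun_mul (hm.map (schwartzFT n) (N + k)))),
    Eventually.of_forall fun ε x => ?_⟩
  have h0 := total_nonneg N (m.mol ε)
  rw [prodNet, norm_mul]
  calc _ ≤ (1 + ‖x‖) ^ k * ((C * (1 + ‖x‖) ^ N * total N (m.mol ε)) *
        ‖schwartzFT n (m.mol ε) x‖) := by gcongr; exact h _ _
    _ = C * total N (m.mol ε) * ((1 + ‖x‖) ^ (N + k) * ‖schwartzFT n (m.mol ε) x‖) := by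
        rw [pow_add]; ring
    _ ≤ _ := mul_le_mul_of_nonneg_left (one_add_pow_mul_le_total _ _ _) (by positivity)

lemma exists_le_norm_prodNet (hb_pos : ∀ ε, 0 < b ε) (hb_mod : Moderate ρ b)
    (hb : IsLargeInfinite (cls ρ b)) (m : MollifierNet n b) {T : 𝓢'(E n, ℂ)} (hT : T ≠ 0) :
    ∃ ys : I → E n, Moderate ρ ys ∧ ∃ c : ℝ, 0 < c ∧
      ∀ᶠ ε in atBot, c ≤ ‖prodNet m T ε (ys ε)‖ := by
  obtain ⟨t, ht, hbt⟩ := exists_rpow_neg_le hb_pos hb_mod hb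
  -- The radius ρ^{-t/2} is much smaller than b ≥ ρ^{-t}, so on that ball |P̂ - 1| ≤ 1/2.
  have ht2 : 0 < t / 2 := by positivity
  obtain ⟨c, hc, h⟩ := exists_le_norm_reg hb_pos (m.isMollifier hb_pos)
    (sModerate_mol' hb_pos hb_mod hb m) (tendsto_inv_of_rpow_neg_le hb_pos ht hbt) hT ht2
  have hex : ∀ ε, ∃ y, (∃ y, ‖y‖ ≤ ρ ε ^ (-(t / 2)) ∧ c ≤ ‖reg T (m.mol ε) y‖) →
      ‖y‖ ≤ ρ ε ^ (-(t / 2)) ∧ c ≤ ‖reg T (m.mol ε) y‖ := fun ε => by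
    by_cases hy : ∃ y, ‖y‖ ≤ ρ ε ^ (-(t / 2)) ∧ c ≤ ‖reg T (m.mol ε) y‖
    · exact ⟨hy.choose, fun _ => hy.choose_spec⟩
    · exact ⟨0, fun h => absurd h hy⟩
  choose ys hys using hex
  refine ⟨ys, Moderate.of_norm_le (moderate_rpow (-(t / 2))) (h.mono fun ε h => (hys ε h).1),
    c / 2, by positivity, ?_⟩
  filter_upwards [h, hbt, m.isMollifier hb_pos, eventually_rpow_le (ρ := ρ) ht2
    (c := 1 / 4) (by norm_num)] with ε h hbt hM h4
  obtain ⟨h1, h2⟩ := hys ε h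
  have hρ := ρ.pos ε
  have hβ0 := (inv_pos.2 (hb_pos ε)).le
  have h5 : ‖ys ε‖ * (b ε)⁻¹ ≤ 1 / 4 := by
    calc ‖ys ε‖ * (b ε)⁻¹ ≤ ρ ε ^ (-(t / 2)) * ρ ε ^ t := by
          gcongr
          exact inv_le_rpow hbt
      _ = ρ ε ^ (t / 2) := by rw [← Real.rpow_add hρ]; congr 1; ring
      _ ≤ _ := h4
  have h6 := hM.norm_sub_one_le hβ0 (ys ε)
  have h7 : 1 / 2 ≤ ‖schwartzFT n (m.mol ε) (ys ε)‖ := by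
    have := norm_sub_norm_le (1 : ℂ) (1 - schwartzFT n (m.mol ε) (ys ε))
    rw [norm_one, sub_sub_cancel, norm_sub_rev] at this
    linarith
  rw [prodNet, norm_mul]
  nlinarith

lemma small_outside_prodNet (hb_pos : ∀ ε, 0 < b ε) (hb_mod : Moderate ρ b)
    (hb : IsLargeInfinite (cls ρ b)) (m : MollifierNet n b) {k : GenNum ρ ℝ} (hk_pos : 0 < k)
    (hk : IsInfinite k) (T : 𝓢'(E n, ℂ)) {h : GenNum ρ ℝ}
    (hh : gsupp (fun x => embed ρ m T x * oneHat ρ m x) ⊆ cube n h) (N q : ℕ) :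
    ∀ᶠ ε in atBot, ∀ x : E n, ‖x‖ ≤ (ρ ε ^ N)⁻¹ → x ∉ box n (rep h ε) →
      ‖prodNet m T ε x‖ ≤ ρ ε ^ q := by
  -- The splicing argument needs points where the net stays away from 0; for T = 0 there are none,
  -- but the net vanishes identically.
  rcases eq_or_ne T 0 with rfl | hT
  · refine Eventually.of_forall fun ε x _ _ => ?_
    have : prodNet m 0 ε x = 0 := by
      rw [prodNet]
      exact zero_mul _
    rw [this, norm_zero]
    exact (pow_pos (ρ.pos ε) q).le
  · obtain ⟨ys, hys, c, hc, hlow⟩ := exists_le_norm_prodNet (ρ := ρ) hb_pos hb_mod hb m hT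
    exact (polyModerate_prodNet hb_pos hb_mod hb m T).small_outside
      (embed_mul_oneHat_eq hb_pos hb_mod hb m hk_pos hk T) hys hc hlow hh N q

/-- The Fourier transform of `ι(T)·𝟙` is given by an integral over the whole space. -/
theorem hft_embed_mul_oneHat_eq (hb_pos : ∀ ε, 0 < b ε) (hb_mod : Moderate ρ b)
    (hb : IsLargeInfinite (cls ρ b)) (m : MollifierNet n b) {k : GenNum ρ ℝ} (hk_pos : 0 < k)
    (hk : IsInfinite k) (T : 𝓢'(E n, ℂ))
    (hh : gsupp (fun x => embed ρ m T x * oneHat ρ m x) ⊆ cube n k)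
    (w : Fin n → GenNum ρ ℝ) :
    hft (fun x => embed ρ m T x * oneHat ρ m x) w =
      cls ρ fun ε => ∫ x, prodNet m T ε x * wave (repPt w ε) x := by
  have hf : ∃ h : GenNum ρ ℝ, 0 < h ∧ IsInfinite h ∧
      gsupp (fun x => embed ρ m T x * oneHat ρ m x) ⊆ cube n h := ⟨k, hk_pos, hk, hh⟩
  have hspec := hf.choose_spec
  have hu := polyModerate_prodNet (ρ := ρ) hb_pos hb_mod hb m T
  rw [hft, dif_pos hf, hftOn_eq hspec.1 hu (embed_mul_oneHat_eq hb_pos hb_mod hb m hk_pos hk T)]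
  exact cls_eq_of_sub (negligible_setIntegral_box_sub_integral hu
    (rapidDecay_prodNet hb_pos hb_mod hb m T)
    (small_outside_prodNet hb_pos hb_mod hb m hk_pos hk T hspec.2.2) _)

lemma schwartzFT_trans (w x : E n) (φ : 𝓢(E n, ℂ)) :
    schwartzFT n (trans w φ) x = schwartzFT n φ x * wave w x := by
  rw [schwartzFT_apply', schwartzFT_apply', ← integral_add_right_eq_self _ w, ← integral_mul_const]
  refine integral_congr_ae (Eventually.of_forall fun y => ?_)
  simp only [trans_apply, add_sub_cancel_right]
  rw [wave_comm x (y + w), wave_add, wave_comm y x, mul_assoc]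

/-- At points much smaller than `b`, the Fourier transform of `ι(T)·𝟙` is the embedding of the
classical Fourier transform of `T`. -/
theorem hft_embed_mul_oneHat_eq_embed_distribFT (hb_pos : ∀ ε, 0 < b ε) (hb_mod : Moderate ρ b)
    (hb : IsLargeInfinite (cls ρ b)) (m : MollifierNet n b) {k : GenNum ρ ℝ} (hk_pos : 0 < k)
    (hk : IsInfinite k) (T : 𝓢'(E n, ℂ))
    (hh : gsupp (fun x => embed ρ m T x * oneHat ρ m x) ⊆ cube n k)
    (w : Fin n → GenNum ρ ℝ) {s : ℝ} (hs : 0 < s) (hw : gnorm w ≤ dRho ρ s * cls ρ b) :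
    hft (fun x => embed ρ m T x * oneHat ρ m x) w = embed ρ m (distribFT T) w := by
  rw [hft_embed_mul_oneHat_eq hb_pos hb_mod hb m hk_pos hk T hh, embed_eq hb_pos]
  obtain ⟨t, ht, hbt⟩ := exists_rpow_neg_le hb_pos hb_mod hb
  -- Comparing representatives gives |w|/b ≤ ρ^s + 1/b ≤ ρ^s + ρ^t ≤ 2ρ^{2r}, and halving the
  -- exponent absorbs the 2.
  set r := min s t / 2 with hr
  have hr0 : 0 < r := by positivity
  have hrt : r ≤ t := by linarith [min_le_right s t]
  have hbr : ∀ᶠ ε in atBot, ρ ε ^ (-r) ≤ b ε := hbt.mono fun ε h =>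
    (Real.rpow_le_rpow_of_exponent_ge (ρ.pos ε) (ρ.le_one ε) (by linarith)).trans h
  have hwr : ∀ᶠ ε in atBot, ‖repPt w ε‖ * (b ε)⁻¹ ≤ ρ ε ^ r := by
    filter_upwards [(le_iff (isRepPt_repPt w).norm ((isRep_dRho s).mul (isRep_cls hb_mod))).1 hw 0,
      hbt, eventually_rpow_le (ρ := ρ) hr0 (c := 1 / 2) (by norm_num)] with ε h1 h2 h3
    have hb0 := hb_pos ε
    have hρ := ρ.pos ε
    have h4 := inv_le_rpow h2
    have h5 : ∀ q : ℝ, min s t ≤ q → ρ ε ^ q ≤ ρ ε ^ r * ρ ε ^ r := fun q hq => by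
      rw [← Real.rpow_add hρ]
      exact Real.rpow_le_rpow_of_exponent_ge hρ (ρ.le_one ε) (by linarith)
    have h6 := Real.rpow_pos_of_pos hρ r
    calc ‖repPt w ε‖ * (b ε)⁻¹ ≤ (ρ ε ^ s * b ε + 1) * (b ε)⁻¹ := by
          rw [pow_zero] at h1
          gcongr
      _ = ρ ε ^ s + (b ε)⁻¹ := by field_simp
      _ ≤ ρ ε ^ r * ρ ε ^ r + ρ ε ^ r * ρ ε ^ r :=
          add_le_add (h5 s (min_le_left _ _)) (h4.trans (h5 t (min_le_right _ _)))
      _ ≤ ρ ε ^ r := by nlinarith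
  obtain ⟨N, C, hC, hT⟩ := exists_dist_le_total (distribFT T)
  have hneg := negligible_total_schwartzMul_sub hb_pos (m.isMollifier hb_pos)
    (m.vanishingMoments hb_pos) (sModerate_mol' hb_pos hb_mod hb m) hr0 hbr
    (isRepPt_repPt w).moderate hwr N
  refine cls_eq_of_sub ((hneg.mul_moderate (moderate_const C)).mono ?_)
  filter_upwards [m.isMollifier hb_pos] with ε hM
  -- The factor P̂(x) e^{-ix·w} is the transform of the translate of P by w, so the integral is a
  -- pairing with T̂.
  have e : ∫ x, prodNet m T ε x * wave (repPt w ε) x = distribFT T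
      (schwartzMul (trans (repPt w ε) (m.mol ε)) (schwartzFT n (m.mol ε))) := by
    rw [distribFT_apply, ← integral_reg_mul_schwartzFT T hM.even]
    refine integral_congr_ae (Eventually.of_forall fun x => ?_)
    simp only [prodNet]
    rw [schwartzFT_trans, mul_assoc]
  rw [e, reg, ← map_sub]
  refine (hT _).trans ((le_of_eq (mul_comm _ _)).trans (le_abs_self _))

end Embedding

/-! ### Taylor expansion and vanishing moments -/

section Taylor

variable {n : ℕ} {ρ : Gauge} {b : I → ℝ}

lemma iteratedDeriv_comp_line {u : E n → ℂ} {Ω : Set (E n)} (hΩ : IsOpen Ω)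
    (hu : ContDiffOn ℝ ∞ u Ω) (w y : E n) {t : ℝ} (ht : w + t • y ∈ Ω) (j : ℕ) :
    iteratedDeriv j (fun t : ℝ => u (w + t • y)) t =
      iteratedFDeriv ℝ j u (w + t • y) fun _ => y := by
  set g : ℝ →L[ℝ] E n := ContinuousLinearMap.toSpanSingleton ℝ y with hg
  set v : E n → ℂ := fun z => u (w + z) with hv
  have hΩ' : IsOpen ((fun z => w + z) ⁻¹' Ω) := hΩ.preimage (by fun_prop)
  have hv' : ContDiffOn ℝ j v ((fun z => w + z) ⁻¹' Ω) :=
    (hu.comp (contDiff_const.add contDiff_id).contDiffOn fun z hz => hz).of_le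
      (by exact_mod_cast le_top)
  have hg' : IsOpen (g ⁻¹' ((fun z => w + z) ⁻¹' Ω)) := hΩ'.preimage g.continuous
  have hgt : g t = t • y := by simp [hg]
  have hmem : g t ∈ (fun z => w + z) ⁻¹' Ω := by
    rw [hgt]
    exact ht
  have h := g.iteratedFDerivWithin_comp_right hv' hΩ'.uniqueDiffOn hg'.uniqueDiffOn hmem
    (i := j) le_rfl
  rw [iteratedFDerivWithin_of_isOpen j hg' hmem, iteratedFDerivWithin_of_isOpen j hΩ' hmem, hgt,
    iteratedFDeriv_comp_add_left] at h
  have hcomp : (fun t : ℝ => u (w + t • y)) = v ∘ g := by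
    ext t
    simp [hv, hg]
  rw [iteratedDeriv_eq_iteratedFDeriv, hcomp, h]
  simp [hg]

/-- Taylor's formula with remainder bound on a ball. -/
lemma norm_sub_taylor_le {u : E n → ℂ} {Ω : Set (E n)} (hΩ : IsOpen Ω) (hu : ContDiffOn ℝ ∞ u Ω)
    {w y : E n} {β B : ℝ} (hball : Metric.closedBall w β ⊆ Ω) {J : ℕ}
    (hB : ∀ z ∈ Metric.closedBall w β, ‖iteratedFDeriv ℝ (J + 1) u z‖ ≤ B) (hy : ‖y‖ ≤ β) :
    ‖u (w + y) - ∑ j ∈ Finset.range (J + 1),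
      ((j.factorial : ℝ)⁻¹ : ℝ) • iteratedFDeriv ℝ j u w fun _ => y‖ ≤ B * β ^ (J + 1) := by
  have hmem : ∀ t ∈ Set.Icc (0 : ℝ) 1, w + t • y ∈ Metric.closedBall w β := fun t ht => by
    rw [mem_closedBall_iff_norm, add_sub_cancel_left]
    exact (norm_smul_le_of_mem ht.1 ht.2).trans hy
  have hβ : 0 ≤ β := (norm_nonneg y).trans hy
  have hB0 : 0 ≤ B := (norm_nonneg _).trans (hB w (Metric.mem_closedBall_self hβ))
  have hφ : ∀ t ∈ Set.Icc (0 : ℝ) 1, ContDiffAt ℝ ∞ (fun t : ℝ => u (w + t • y)) t := by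
    intro t ht
    have h1 : ContDiffAt ℝ ∞ u (w + t • y) := hu.contDiffAt (hΩ.mem_nhds (hball (hmem t ht)))
    exact h1.comp t (by fun_prop)
  have hd : ∀ (j : ℕ), ∀ t ∈ Set.Icc (0 : ℝ) 1,
      iteratedDerivWithin j (fun t : ℝ => u (w + t • y)) (Set.Icc 0 1) t =
        iteratedFDeriv ℝ j u (w + t • y) fun _ => y := fun j t ht => by
    rw [iteratedDerivWithin_eq_iteratedDeriv (uniqueDiffOn_Icc one_pos)
      ((hφ t ht).of_le (by exact_mod_cast le_top)) ht,
      iteratedDeriv_comp_line hΩ hu w y (hball (hmem t ht))]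
  have h1 : (1 : ℝ) ∈ Set.Icc (0 : ℝ) 1 := ⟨zero_le_one, le_rfl⟩
  have h0 : (0 : ℝ) ∈ Set.Icc (0 : ℝ) 1 := ⟨le_rfl, zero_le_one⟩
  have h := taylor_mean_remainder_bound (n := J) (C := B * β ^ (J + 1)) zero_le_one
    (fun t ht => ((hφ t ht).of_le (by exact_mod_cast le_top)).contDiffWithinAt) h1 fun t ht => by
      rw [hd _ t ht]
      refine (ContinuousMultilinearMap.le_opNorm _ _).trans ?_
      rw [Finset.prod_const, Finset.card_univ, Fintype.card_fin]
      gcongr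
      exact hB _ (hmem t ht)
  rw [taylor_within_apply] at h
  simp only [hd _ 0 h0, sub_zero, one_pow, mul_one, one_smul, zero_smul, add_zero] at h
  refine h.trans (div_le_self (by positivity) ?_)
  exact_mod_cast Nat.one_le_iff_ne_zero.2 (Nat.factorial_ne_zero _)

/-- Averaging a function against a mollifier with many vanishing moments reproduces its value, up to
the Taylor remainder of any smooth function close to it. -/
lemma IsMollifier.norm_integral_sub_le {P : 𝓢(E n, ℂ)} {β : ℝ} (h : IsMollifier P β) (hβ : 0 ≤ β)
    {J : ℕ} (hm : VanishingMoments P J) {G u : E n → ℂ} (hG : Continuous G) {Ω : Set (E n)}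
    (hΩ : IsOpen Ω) (hu : ContDiffOn ℝ ∞ u Ω) {w : E n} (hball : Metric.closedBall w β ⊆ Ω)
    {B δ : ℝ} (hB : ∀ z ∈ Metric.closedBall w β, ‖iteratedFDeriv ℝ (J + 1) u z‖ ≤ B)
    (hδ : ∀ z ∈ Metric.closedBall w β, ‖u z - G z‖ ≤ δ) :
    ‖(∫ y, P y * G (w + y)) - G w‖ ≤ (2 * δ + B * β ^ (J + 1)) * 2 := by
  have hw : w ∈ Metric.closedBall w β := Metric.mem_closedBall_self hβ
  have hB0 : 0 ≤ B := (norm_nonneg _).trans (hB w hw)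
  have hδ0 : 0 ≤ δ := (norm_nonneg _).trans (hδ w hw)
  -- The index is shifted: these are the Taylor terms of orders 1 to J, which the moments
  -- annihilate. The constant term is treated apart, using the integral of P.
  set A : ℕ → E n → ℂ := fun j y => (((j + 1).factorial : ℝ)⁻¹ : ℝ) •
    iteratedFDeriv ℝ (j + 1) u w fun _ => y with hA
  have hAc : ∀ j, Continuous (A j) := fun j => by
    have h1 : Continuous fun y : E n => fun _ : Fin (j + 1) => y := by fun_prop
    have h2 : Continuous fun y : E n => iteratedFDeriv ℝ (j + 1) u w fun _ => y :=
      (iteratedFDeriv ℝ (j + 1) u w).cont.comp h1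
    exact h2.const_smul (((j + 1).factorial : ℝ)⁻¹)
  have hA0 : ∀ j ∈ Finset.range J, ∫ y, A j y * P y = 0 := by
    intro j hj
    rw [Finset.mem_range] at hj
    have e : ∀ y, A j y * P y = (((j + 1).factorial : ℝ)⁻¹ : ℝ) •
        ((iteratedFDeriv ℝ (j + 1) u w fun _ => y) * P y) := fun y => by
      rw [hA, smul_mul_assoc]
    simp only [e]
    rw [integral_smul, hm.integral_multilinear h (by lia) (by lia), smul_zero]
  have e1 : (∫ y, P y * G (w + y)) - G w =
      ∫ y, (G (w + y) - G w - ∑ j ∈ Finset.range J, A j y) * P y := by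
    have i1 : Integrable fun y => G (w + y) * P y := h.integrable_mul (by fun_prop)
    have i2 : Integrable fun y => G w * P y := h.integrable_mul continuous_const
    have i3 : ∀ j ∈ Finset.range J, Integrable fun y => A j y * P y :=
      fun j _ => h.integrable_mul (hAc j)
    have i4 : Integrable fun y => G (w + y) * P y - G w * P y := i1.sub i2
    simp only [sub_mul, Finset.sum_mul]
    rw [integral_sub i4 (integrable_finsetSum _ i3), integral_sub i1 i2,
      integral_finsetSum _ i3, Finset.sum_eq_zero hA0, sub_zero, integral_const_mul,
      h.integral_eq_one, mul_one]
    simp only [mul_comm]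
  rw [e1]
  refine h.norm_integral_mul_le (fun y hy => ?_) (by positivity)
  have ht := norm_sub_taylor_le hΩ hu hball hB hy
  rw [Finset.sum_range_succ'] at ht
  simp only [Nat.factorial_zero, Nat.cast_one, inv_one, one_smul, iteratedFDeriv_zero_apply] at ht
  have h1 := hδ w hw
  have h2 := hδ (w + y) (by rwa [mem_closedBall_iff_norm, add_sub_cancel_left])
  -- G is replaced by u at both w and w + y, which costs δ twice; the rest is the Taylor remainder
  -- of u.
  have e2 : G (w + y) - G w - ∑ j ∈ Finset.range J, A j y =
      (u w - G w) - (u (w + y) - G (w + y)) +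
        (u (w + y) - (∑ j ∈ Finset.range J, A j y + u w)) := by ring
  rw [e2]
  calc _ ≤ ‖u w - G w‖ + ‖u (w + y) - G (w + y)‖ +
        ‖u (w + y) - (∑ j ∈ Finset.range J, A j y + u w)‖ :=
        (norm_add_le _ _).trans (add_le_add_left (norm_sub_le _ _) _)
    _ ≤ _ := by linarith

end Taylor

/-! ### The Fourier integral over the box -/

section BoxFourier

variable {n : ℕ} {ρ : Gauge} {b : I → ℝ}

/-- The Fourier integral of `F` over the box `[-r,r]ⁿ`. -/
def boxFT (r : ℝ) (F : E n → ℂ) (v : E n) : ℂ := ∫ x in box n r, F x * wave v x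

lemma norm_wave_sub_one_le (ξ x : E n) : ‖wave ξ x - 1‖ ≤ ‖x‖ * ‖ξ‖ := by
  have h1 := Real.norm_exp_I_mul_ofReal_sub_one_le (x := -inner ℝ x ξ)
  have h2 : wave ξ x = Complex.exp (Complex.I * ((-inner ℝ x ξ : ℝ) : ℂ)) := by
    rw [wave]; congr 1; push_cast; ring
  rw [← h2, norm_neg] at h1
  exact h1.trans (norm_inner_le_norm _ _)

lemma norm_boxFT_sub_le {r : ℝ} (hr : 0 ≤ r) {F : E n → ℂ} (hF : Continuous F) {C : ℝ}
    (hC : ∀ x ∈ box n r, ‖F x‖ ≤ C) (v v' : E n) :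
    ‖boxFT r F v - boxFT r F v'‖ ≤ C * (n * r) * ((n * r) ^ n *
      (volume : Measure (E n)).real (Metric.ball 0 1)) * ‖v - v'‖ := by
  have hi : ∀ v, IntegrableOn (fun x => F x * wave v x) (box n r) := fun v =>
    (hF.mul (continuous_wave v)).continuousOn.integrableOn_compact (isCompact_box r)
  have hC0 : 0 ≤ C := (norm_nonneg _).trans (hC 0 fun i => by simpa using hr)
  rw [boxFT, boxFT, ← integral_sub (hi v) (hi v')]
  refine (norm_setIntegral_le_of_norm_le_const (C := C * (n * r * ‖v - v'‖))
    (isCompact_box r).measure_lt_top fun x hx => ?_).trans ?_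
  · have e : F x * wave v x - F x * wave v' x = F x * (wave v' x * (wave (v - v') x - 1)) := by
      have : wave v x = wave v' x * wave (v - v') x := by rw [← wave_add, add_sub_cancel]
      rw [this]
      ring
    rw [e, norm_mul, norm_mul, norm_wave, one_mul]
    gcongr
    · exact hC x hx
    · refine (norm_wave_sub_one_le _ _).trans ?_
      gcongr
      exact norm_le_of_mem_box hx
  · have := measureReal_box_le (n := n) hr
    calc _ ≤ C * (n * r * ‖v - v'‖) * ((n * r) ^ n *
          (volume : Measure (E n)).real (Metric.ball 0 1)) := by gcongr
      _ = _ := by ring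

/-- On the box both |x| and F are moderate, hence so is the Lipschitz constant; thus the box
transform changes negligibly with the representative of the frequency. -/
lemma PolyModerate.exists_boxFT_lipschitz {F : I → E n → ℂ} (hF : PolyModerate ρ F)
    {k : GenNum ρ ℝ} (hk : 0 < k) : ∃ L : I → ℝ, Moderate ρ L ∧ ∀ᶠ ε in atBot, ∀ v v',
      ‖boxFT (rep k ε) (F ε) v - boxFT (rep k ε) (F ε) v'‖ ≤ L ε * ‖v - v'‖ := by
  obtain ⟨N, C, hC, h⟩ := hF.bound 0
  have hk' := (moderate_const (n : ℝ)).fun_mul (isRep_rep k).1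
  refine ⟨fun ε => C ε * (1 + n * rep k ε) ^ N * (n * rep k ε) * ((n * rep k ε) ^ n *
      (volume : Measure (E n)).real (Metric.ball 0 1)),
    ((hC.fun_mul (((moderate_const 1).fun_add hk').fun_pow N)).fun_mul hk').fun_mul
      ((hk'.fun_pow n).fun_mul (moderate_const _)), ?_⟩
  filter_upwards [h, eventually_rep_pos hk] with ε h hpos v v'
  refine norm_boxFT_sub_le hpos.le (hF.smooth ε).continuous (fun x hx => ?_) v v'
  have h1 := h.2 x
  rw [norm_iteratedFDeriv_zero] at h1
  refine h1.trans ?_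
  have := h.1
  gcongr
  exact norm_le_of_mem_box hx

lemma PolyModerate.moderate_boxFT {F : I → E n → ℂ} (hF : PolyModerate ρ F)
    {k : GenNum ρ ℝ} (hk : 0 < k) (vs : I → E n) :
    Moderate ρ fun ε => boxFT (rep k ε) (F ε) (vs ε) := by
  obtain ⟨N, C, hC, h⟩ := hF.bound 0
  have hk' := (moderate_const (n : ℝ)).fun_mul (isRep_rep k).1
  refine Moderate.of_norm_le ((hC.fun_mul (((moderate_const 1).fun_add hk').fun_pow N)).fun_mul
    ((hk'.fun_pow n).fun_mul
      (moderate_const ((volume : Measure (E n)).real (Metric.ball 0 1))))) ?_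
  filter_upwards [h, eventually_rep_pos hk] with ε h hpos
  have h0 := h.1
  refine (norm_setIntegral_le_of_norm_le_const (C := C ε * (1 + n * rep k ε) ^ N)
    (isCompact_box _).measure_lt_top fun x hx => ?_).trans ?_
  · have h1 := h.2 x
    rw [norm_iteratedFDeriv_zero] at h1
    rw [norm_mul, norm_wave, mul_one]
    refine h1.trans ?_
    gcongr
    exact norm_le_of_mem_box hx
  · exact mul_le_mul_of_nonneg_left (measureReal_box_le hpos.le) (by positivity)

lemma continuous_boxFT {r : ℝ} (hr : 0 ≤ r) {F : E n → ℂ} (hF : Continuous F) :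
    Continuous (boxFT r F) := by
  obtain ⟨C, hC⟩ := (isCompact_box (n := n) r).exists_bound_of_continuousOn hF.continuousOn
  have hC' := hC 0 fun i => by simpa using hr
  have hC0 := (norm_nonneg _).trans hC'
  refine (LipschitzWith.of_dist_le_mul (K := (C * (n * r) * ((n * r) ^ n *
    (volume : Measure (E n)).real (Metric.ball 0 1))).toNNReal) fun v v' => ?_).continuous
  rw [dist_eq_norm, dist_eq_norm, Real.coe_toNNReal _ (by positivity)]
  exact norm_boxFT_sub_le hr hF hC v v'

/-- Fubini over a compact box: multiplying by P̂ in position is averaging by P in frequency. The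
integral of P against the box transform is then amenable to Taylor expansion at w. -/
lemma boxFT_mul_schwartzFT {r : ℝ} {F : E n → ℂ} (hF : Continuous F) (P : 𝓢(E n, ℂ)) (w : E n) :
    boxFT r (fun x => F x * schwartzFT n P x) w = ∫ y, P y * boxFT r F (w + y) := by
  have hi : Integrable (fun x => F x * wave w x) (volume.restrict (box n r)) :=
    (hF.mul (continuous_wave w)).continuousOn.integrableOn_compact (isCompact_box r)
  have h := integral_integral_wave_swap hi (P.integrable (μ := volume))
  rw [boxFT]
  calc _ = ∫ x in box n r, F x * wave w x * ∫ y, P y * wave x y := by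
        refine integral_congr_ae (Eventually.of_forall fun x => ?_)
        simp only
        rw [schwartzFT_apply']
        ring
    _ = _ := h
    _ = _ := by
        refine integral_congr_ae (Eventually.of_forall fun y => ?_)
        simp only [boxFT]
        congr 1
        refine integral_congr_ae (Eventually.of_forall fun x => ?_)
        simp only
        rw [wave_add, wave_comm x y, mul_assoc]

end BoxFourier

/-! ### Functions bounded by a tame polynomial -/

section Tame

variable {n : ℕ} {ρ : Gauge} {b : I → ℝ}

lemma Moderate.of_mem_closedBall {ws ys : I → E n} (hw : Moderate ρ ws) {δ : I → ℝ}
    (hδ : Tendsto δ atBot (𝓝 0)) (hys : ∀ ε, ys ε ∈ Metric.closedBall (ws ε) (δ ε)) :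
    Moderate ρ ys := by
  refine Moderate.of_norm_le (hw.norm.fun_add (moderate_const 1)) ?_
  filter_upwards [hδ.eventually (Iic_mem_nhds one_pos)] with ε h1
  have h2 := mem_closedBall_iff_norm.1 (hys ε)
  have h3 := norm_add_le (ws ε) (ys ε - ws ε)
  rw [add_sub_cancel] at h3
  exact h3.trans (add_le_add_right (h2.trans h1) _)

/-- A generalized function that is bounded by a tame polynomial at `w` has, on balls of radius
`1 / b`, Taylor remainders that are eventually smaller than any power of the gauge. -/
lemma BoundedByTame.exists_net (hb_pos : ∀ ε, 0 < b ε) (hb_mod : Moderate ρ b)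
    (hb : IsLargeInfinite (cls ρ b)) {f : (Fin n → GenNum ρ ℝ) → GenNum ρ ℂ}
    {w : Fin n → GenNum ρ ℝ} (h : BoundedByTame (cls ρ b) f w) :
    ∃ (u : I → E n → ℂ) (Ω : I → Set (E n)), Defines Set.univ Ω u f ∧
      (∀ᶠ ε in atBot, Metric.closedBall (repPt w ε) (b ε)⁻¹ ⊆ Ω ε) ∧
      ∃ M : I → ℝ, Moderate ρ M ∧ ∀ q : ℕ, ∃ J : ℕ, ∀ᶠ ε in atBot, ∃ B : ℝ,
        (∀ z ∈ Metric.closedBall (repPt w ε) (b ε)⁻¹, ‖iteratedFDeriv ℝ (J + 1) (u ε) z‖ ≤ B) ∧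
        B * (b ε)⁻¹ ^ (J + 1) ≤ M ε * ρ ε ^ q := by
  obtain ⟨u, Ω, hdef, r, hr, M, c, hlarge, hbound⟩ := h
  obtain ⟨t, ht, hbt⟩ := exists_rpow_neg_le hb_pos hb_mod hb
  have hβ := tendsto_inv_of_rpow_neg_le hb_pos ht hbt
  -- Since 1/b tends to 0, nets in these balls represent points within the real radius r of w, where
  -- the tame bound is available.
  have hnet : ∀ ys : I → E n, (∀ ε, ys ε ∈ Metric.closedBall (repPt w ε) (b ε)⁻¹) →
      Moderate ρ ys ∧ gnorm ((fun i => cls ρ fun ε => ys ε i) - w) ≤ const ρ r := by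
    intro ys hys
    have hmod : Moderate ρ ys :=
      (isRepPt_repPt w).moderate.of_mem_closedBall hβ hys
    refine ⟨hmod, le_of_eventually ((isRepPt_cls hmod).sub (isRepPt_repPt w)).norm
      (isRep_const r) ?_⟩
    filter_upwards [hβ.eventually (Iic_mem_nhds hr)] with ε h1
    exact (mem_closedBall_iff_norm.1 (hys ε)).trans h1
  have hne : ∀ ε, (Metric.closedBall (repPt w ε) (b ε)⁻¹).Nonempty := fun ε =>
    ⟨_, Metric.mem_closedBall_self (inv_pos.2 (hb_pos ε)).le⟩
  refine ⟨u, Ω, hdef, ?_, ?_⟩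
  · exact eventually_forall_mem_of_forall_net (P := fun ε z => z ∈ Ω ε) hne fun ys hys =>
      hdef.subset (Set.mem_univ _) ys (isRepPt_cls (hnet ys hys).1)
  set cs := rep (c : GenNum ρ ℝ) with hcs
  set ds := rep (↑c⁻¹ : GenNum ρ ℝ) with hds
  have hcsr : IsRep cs (c : GenNum ρ ℝ) := isRep_rep _
  have hdsr : IsRep ds (↑c⁻¹ : GenNum ρ ℝ) := isRep_rep _
  obtain ⟨s, hs, hsb⟩ := hlarge.exists_rpow_le ((isRep_cls hb_mod).mul hdsr)
  have hcd : Negligible ρ fun ε => cs ε * ds ε - 1 := by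
    have := hcsr.mul hdsr
    rw [Units.mul_inv] at this
    exact this.sub_negligible isRep_one
  -- The added 1 is the error ρ^0 in comparing representatives; it is uniform over the ball.
  have hunif : ∀ j : ℕ, ∀ᶠ ε in atBot, ∀ z ∈ Metric.closedBall (repPt w ε) (b ε)⁻¹,
      ‖iteratedFDeriv ℝ j (u ε) z‖ ≤ rep M ε * cs ε ^ j + 1 := fun j =>
    eventually_forall_mem_of_forall_net
      (P := fun ε z => ‖iteratedFDeriv ℝ j (u ε) z‖ ≤ rep M ε * cs ε ^ j + 1) hne fun ys hys => by
      have h1 := isRepPt_cls (hnet ys hys).1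
      have h2 := hbound _ (hnet ys hys).2 ys h1 j
      have h3 := hdef.moderate _ (Set.mem_univ _) ys h1 j
      have h4 := (le_iff (isRep_cls h3.norm) ((isRep_rep M).mul (hcsr.pow j))).1 h2 0
      simpa using h4
  refine ⟨fun ε => |rep M ε| + 1, (isRep_rep M).1.norm.fun_add (moderate_const 1), fun q => ?_⟩
  -- The exponent s/2 serves |c|/b, and t serves 1/b, which multiplies the additive 1 of the
  -- derivative bound.
  set a := min (s / 2) t with ha
  have ha0 : 0 < a := by positivity
  obtain ⟨J, hJ⟩ := exists_nat_ge ((q : ℝ) / a)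
  refine ⟨J, ?_⟩
  filter_upwards [hunif (J + 1), hsb, hcd 0, hbt, eventually_rpow_le (ρ := ρ) (s := s / 2)
    (by positivity) (c := 1 / 2) (by norm_num)] with ε h1 h2 h3 h4 h5
  have hρ := ρ.pos ε
  have hb0 := hb_pos ε
  have h6 : |cs ε| * (b ε)⁻¹ ≤ ρ ε ^ a := by
    rw [pow_zero] at h3
    have h7 : |cs ε * ds ε| ≤ 2 := by
      have h8 := norm_add_le (cs ε * ds ε - 1) 1
      rw [sub_add_cancel, norm_one, Real.norm_eq_abs (cs ε * ds ε)] at h8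
      linarith
    rw [abs_mul] at h7
    rw [abs_mul, abs_of_pos hb0] at h2
    have hp := Real.rpow_pos_of_pos hρ (-s)
    have e1 : ρ ε ^ s = ρ ε ^ (s / 2) * ρ ε ^ (s / 2) := by
      rw [← Real.rpow_add hρ]; congr 1; ring
    have hp2 := Real.rpow_pos_of_pos hρ (s / 2)
    have h9 : |cs ε| * (b ε)⁻¹ * ρ ε ^ (-s) ≤ 2 := by
      calc |cs ε| * (b ε)⁻¹ * ρ ε ^ (-s) ≤ |cs ε| * (b ε)⁻¹ * (b ε * |ds ε|) := by gcongr
        _ = |cs ε| * |ds ε| := by field_simp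
        _ ≤ 2 := h7
    calc |cs ε| * (b ε)⁻¹ = |cs ε| * (b ε)⁻¹ * ρ ε ^ (-s) * ρ ε ^ s := by
          rw [mul_assoc _ (ρ ε ^ (-s)), ← Real.rpow_add hρ, neg_add_cancel, Real.rpow_zero, mul_one]
      _ ≤ 2 * ρ ε ^ s := by gcongr
      _ ≤ ρ ε ^ (s / 2) := by rw [e1]; nlinarith
      _ ≤ ρ ε ^ a := Real.rpow_le_rpow_of_exponent_ge hρ (ρ.le_one ε) (min_le_left _ _)
  have h7 : (b ε)⁻¹ ≤ ρ ε ^ a := (inv_le_rpow h4).trans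
    (Real.rpow_le_rpow_of_exponent_ge hρ (ρ.le_one ε) (min_le_right _ _))
  have h8 : (ρ ε ^ a) ^ (J + 1) ≤ ρ ε ^ q := by
    rw [← Real.rpow_natCast, ← Real.rpow_natCast, ← Real.rpow_mul hρ.le]
    refine Real.rpow_le_rpow_of_exponent_ge hρ (ρ.le_one ε) ?_
    rw [div_le_iff₀ ha0] at hJ
    push_cast
    nlinarith
  refine ⟨_, h1, ?_⟩
  calc (rep M ε * cs ε ^ (J + 1) + 1) * (b ε)⁻¹ ^ (J + 1)
      ≤ (|rep M ε| * |cs ε| ^ (J + 1) + 1) * (b ε)⁻¹ ^ (J + 1) := by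
        have h9 : rep M ε * cs ε ^ (J + 1) ≤ |rep M ε| * |cs ε| ^ (J + 1) := by
          rw [← abs_pow, ← abs_mul]
          exact le_abs_self _
        gcongr ?_ * _
        linarith
    _ = |rep M ε| * (|cs ε| * (b ε)⁻¹) ^ (J + 1) + (b ε)⁻¹ ^ (J + 1) := by rw [mul_pow]; ring
    _ ≤ |rep M ε| * (ρ ε ^ a) ^ (J + 1) + (ρ ε ^ a) ^ (J + 1) := by gcongr
    _ = (|rep M ε| + 1) * (ρ ε ^ a) ^ (J + 1) := by ring
    _ ≤ (|rep M ε| + 1) * ρ ε ^ q := by gcongr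

/-- At points at which `𝓕_k(ι(T))` is bounded by a tame polynomial, it is given by the Fourier
integral of `ι(T)·𝟙` over the box. -/
theorem hftOn_embed_eq (hb_pos : ∀ ε, 0 < b ε) (hb_mod : Moderate ρ b)
    (hb : IsLargeInfinite (cls ρ b)) (m : MollifierNet n b) {k : GenNum ρ ℝ} (hk_pos : 0 < k)
    (T : 𝓢'(E n, ℂ)) {w : Fin n → GenNum ρ ℝ}
    (htame : BoundedByTame (cls ρ b) (hftOn k (embed ρ m T)) w) :
    hftOn k (embed ρ m T) w =
      cls ρ fun ε => ∫ x in box n (rep k ε), prodNet m T ε x * wave (repPt w ε) x := by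
  have hm := sModerate_mol' hb_pos hb_mod hb m
  have hF := polyModerate_reg T hm
  have hval : ∀ y, hftOn k (embed ρ m T) y = cls ρ fun ε =>
      boxFT (rep k ε) (reg T (m.mol ε)) (repPt y ε) :=
    hftOn_eq hk_pos hF (embed_eq hb_pos m T)
  obtain ⟨u, Ω, hdef, hsub, M, hM, hrem⟩ := htame.exists_net hb_pos hb_mod hb
  obtain ⟨L, hL, hLip⟩ := hF.exists_boxFT_lipschitz hk_pos
  obtain ⟨t, ht, hbt⟩ := exists_rpow_neg_le hb_pos hb_mod hb
  have hβ := tendsto_inv_of_rpow_neg_le hb_pos ht hbt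
  -- The tame bound concerns a net `u` that need not be the box transform itself; both define the
  -- same generalized function, and agreement along nets of points makes them uniformly close on the
  -- ball.
  have hclose : ∀ q : ℕ, ∀ᶠ ε in atBot, ∀ z ∈ Metric.closedBall (repPt w ε) (b ε)⁻¹,
      ‖u ε z - boxFT (rep k ε) (reg T (m.mol ε)) z‖ ≤ ρ ε ^ q := by
    intro q
    refine eventually_forall_mem_of_forall_net
      (P := fun ε z => ‖u ε z - boxFT (rep k ε) (reg T (m.mol ε)) z‖ ≤ ρ ε ^ q)
      (fun ε => ⟨_, Metric.mem_closedBall_self (inv_pos.2 (hb_pos ε)).le⟩) fun ys hys => ?_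
    have hmod : Moderate ρ ys :=
      (isRepPt_repPt w).moderate.of_mem_closedBall hβ hys
    have hr := isRepPt_cls hmod
    have h1 := hdef.value _ (Set.mem_univ _) ys hr
    rw [hval] at h1
    have h2 := h1.sub_negligible (isRep_cls (hF.moderate_boxFT hk_pos _))
    have h3 : Negligible ρ fun ε => boxFT (rep k ε) (reg T (m.mol ε))
        (repPt (fun i => cls ρ fun ε => ys ε i) ε) -
        boxFT (rep k ε) (reg T (m.mol ε)) (ys ε) := by
      refine ((((isRepPt_repPt _).sub_negligible hr).norm).mul_moderate hL).mono
        (hLip.mono fun ε h => ?_)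
      exact (h _ _).trans ((le_of_eq (mul_comm _ _)).trans (le_abs_self _))
    have h4 := h2.fun_add h3
    simp only [sub_add_sub_cancel] at h4
    exact h4 q
  rw [hval]
  refine cls_eq_of_sub (Negligible.symm ?_)
  refine negligible_of_le_mul (((moderate_const 2).fun_add hM).fun_mul (moderate_const 2))
    fun q => ?_
  obtain ⟨J, hJ⟩ := hrem q
  filter_upwards [hJ, hsub, hclose q, m.isMollifier hb_pos, m.vanishingMoments hb_pos J,
    eventually_rep_pos hk_pos] with ε hJ hsub hclose hmol hvan hpos
  obtain ⟨B, hB, hBle⟩ := hJ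
  have hβ0 := (inv_pos.2 (hb_pos ε)).le
  have hFc := (hF.smooth ε).continuous
  -- Taylor's formula is applied to `u`, whose derivatives are controlled, while the averaged
  -- function is the box transform.
  have key := hmol.norm_integral_sub_le hβ0 hvan (continuous_boxFT hpos.le hFc) (hdef.isOpen ε)
    (hdef.smooth ε) hsub hB hclose
  rw [← boxFT_mul_schwartzFT hFc] at key
  refine key.trans ?_
  nlinarith

end Tame

end HFT

end

theorem mainTheorem6 (ρ : HFT.Gauge) (n : ℕ)
    -- a large infinite number `b = [b_ε]`, with a positive representative, and its mollifiers
    (b : HFT.I → ℝ) (hb_pos : ∀ ε, 0 < b ε) (hb_mod : HFT.Moderate ρ b)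
    (hb : HFT.IsLargeInfinite (HFT.cls ρ b)) (m : HFT.MollifierNet n b)
    -- a positive infinite number `k`
    (k : HFT.GenNum ρ ℝ) (hk_pos : 0 < k) (hk : HFT.IsInfinite k)
    -- a tempered distribution `T`, such that `ι(T)·𝟙` is supported in `[-k,k]ⁿ`
    (T : 𝓢'(HFT.E n, ℂ))
    (hsupp : HFT.gsupp (fun x => HFT.embed ρ m T x * HFT.oneHat ρ m x) ⊆ HFT.cube n k)
    -- a point `w` at which `𝓕_k(ι(T))` is bounded by a tame polynomial
    (w : Fin n → HFT.GenNum ρ ℝ)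
    (htame : HFT.BoundedByTame (HFT.cls ρ b) (HFT.hftOn k (HFT.embed ρ m T)) w) :
    HFT.hftOn k (HFT.embed ρ m T) w =
        HFT.hft (fun x => HFT.embed ρ m T x * HFT.oneHat ρ m x) w ∧
      ((∃ s : ℝ, 0 < s ∧ HFT.gnorm w ≤ HFT.dRho ρ s * HFT.cls ρ b) →
        HFT.hft (fun x => HFT.embed ρ m T x * HFT.oneHat ρ m x) w =
          HFT.embed ρ m (HFT.distribFT T) w) := by
  have h1 : HFT.hftOn k (HFT.embed ρ m T) w =
      HFT.hft (fun x => HFT.embed ρ m T x * HFT.oneHat ρ m x) w := by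
    rw [HFT.hftOn_embed_eq hb_pos hb_mod hb m hk_pos T htame,
      HFT.hft_embed_mul_oneHat_eq hb_pos hb_mod hb m hk_pos hk T hsupp]
    -- What remains is to enlarge the box given by k to the whole space; this is where the support
    -- hypothesis applies to k itself.
    exact HFT.cls_eq_of_sub (HFT.negligible_setIntegral_box_sub_integral
      (HFT.polyModerate_prodNet hb_pos hb_mod hb m T) (HFT.rapidDecay_prodNet hb_pos hb_mod hb m T)
      (HFT.small_outside_prodNet hb_pos hb_mod hb m hk_pos hk T hsupp) _)
  exact ⟨h1, fun ⟨s, hs, hw⟩ => HFT.hft_embed_mul_oneHat_eq_embed_distribFT hb_pos hb_mod hb m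
    hk_pos hk T hsupp w hs hw⟩
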